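/- Let $G$ be an infinite, connected, locally finite graph. For a finite vertex set $K$, let $\partial K$ be the set of vertices of $K$ that are adjacent to a vertex outside of $K$. Assume that $G$ is amenable, i.e. there is an increasing sequence $G_n$ of finite connected induced subgraphs of $G$ with $\bigcup_n G_n = G$ and $|\partial V(G_n)|/|V(G_n)| \to 0$, and let $\Gamma$ be a subgroup of $\mathrm{Aut}(G)$ that acts on the vertices of $G$ with finitely many orbits. An essential spanning forest of $G$ is a spanning subgraph $F$ of $G$ each of whose components is a tree with infinitely many vertices; the set $\Omega$ of these carries the smallest $\sigma$-field making $F \mapsto F_H$ measurable for every finite subgraph $H$ of $G$, where $F_H$ is the set of edges of $F$ contained in $H$. The number of ends of a tree is the maximal number of pairwise disjoint semi-infinite (self-avoiding) paths in it (possibly $\infty$). Let $\mu_G$ be the measure to which, for every increasing sequence $G_n$ of finite connected induced subgraphs with $\bigcup_n G_n = G$, the uniform measures on the spanning trees of $G_n$ converge weakly. A probability measure $\mu$ on $\Omega$ has the weak Gibbs property if the following holds for each finite induced subgraph $H$ of $G$. For $a, b \in \partial V(H)$ write $a \sim_I b$ if $a$ and $b$ are connected by a path of $F$ contained in $H$.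 Then, conditionally on the relation $\sim_I$ and on $F_{G\setminus H}$ (the set of edges of $F$ not contained in $H$), all spanning forests of $H$ that give the same relation, and each component of which contains at least one point of $\partial V(H)$, are equally likely to be $F_H$. **Lemma 3.3.** Let $\mu$ be a $\Gamma$-invariant probability measure on $\Omega$ that has the weak Gibbs property, and suppose that $\mu$-almost surely $F$ contains exactly one two-ended tree (i.e. exactly one component with exactly two ends). Then $\mu$-almost surely $F$ consists of a single tree, and $\mu = \mu_G$. -/

import Mathlib

open MeasureTheory ProbabilityTheory Filter Topology

namespace EssentialForest

section Configurations

variable {V : Type*}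

/-- Spanning subgraphs of `G`, encoded by the indicator function of their edge set. The space carries
the product topology (with `Bool` discrete) and the product sigma-algebra, that is, the smallest
sigma-algebra making all restrictions to finite sets of edges measurable. -/
abbrev Config (G : SimpleGraph V) : Type _ := G.edgeSet → Bool

/-- The spanning subgraph of `G` encoded by a configuration. -/
def toGraph {G : SimpleGraph V} (ω : Config G) : SimpleGraph V :=
  SimpleGraph.fromEdgeSet {e | ∃ h : e ∈ G.edgeSet, ω ⟨e, h⟩ = true}

/-- An essential spanning forest: no cycles, and every component is infinite. -/
def IsEssentialSpanningForest (F : SimpleGraph V) : Prop :=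
  F.IsAcyclic ∧ ∀ c : F.ConnectedComponent, c.supp.Infinite

/-- A semi-infinite (self-avoiding) path in the component `c` of `F`. -/
def IsRayIn (F : SimpleGraph V) (c : F.ConnectedComponent) (r : ℕ → V) : Prop :=
  Function.Injective r ∧ (∀ n, F.Adj (r n) (r (n + 1))) ∧ ∀ n, r n ∈ c.supp

/-- The component `c` of `F` contains `k` pairwise disjoint semi-infinite paths. -/
def HasDisjointRays (F : SimpleGraph V) (c : F.ConnectedComponent) (k : ℕ) : Prop :=
  ∃ r : Fin k → ℕ → V, (∀ i, IsRayIn F c (r i)) ∧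
    Pairwise fun i j => Disjoint (Set.range (r i)) (Set.range (r j))

/-- The number of topological ends of a tree component of a forest: the maximal number of disjoint
semi-infinite paths in it, possibly infinite. -/
noncomputable def numEnds (F : SimpleGraph V) (c : F.ConnectedComponent) : ℕ∞ :=
  ⨆ (k : ℕ) (_ : HasDisjointRays F c k), (k : ℕ∞)

/-- The vertices of `K` that are adjacent in `G` to a vertex outside of `K`. -/
def bdry (G : SimpleGraph V) (K : Finset V) : Set V :=
  {v | v ∈ K ∧ ∃ w, w ∉ K ∧ G.Adj v w}

/-- An increasing sequence of finite vertex sets that induce connected subgraphs of `G` with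
union `G`. -/
structure IsExhaustion (G : SimpleGraph V) (K : ℕ → Finset V) : Prop where
  mono : Monotone K
  connected : ∀ n, (G.induce (K n : Set V)).Connected
  exhausts : ∀ v, ∃ n, v ∈ K n

/-- Amenability: for some exhaustion, `|∂ K n| / |K n|` tends to `0`. -/
def IsAmenable (G : SimpleGraph V) : Prop :=
  ∃ K : ℕ → Finset V, IsExhaustion G K ∧
    Tendsto (fun n => ((bdry G (K n)).ncard : ℝ) / ((K n).card : ℝ)) atTop (𝓝 0)

/-- A group of automorphisms acts quasitransitively: there are finitely many vertex orbits. -/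
def IsQuasitransitive (G : SimpleGraph V) (Γ : Subgroup (G ≃g G)) : Prop :=
  ∃ S : Set V, S.Finite ∧ ∀ v, ∃ s ∈ S, ∃ γ ∈ Γ, γ s = v

/-- The image of a spanning subgraph under an automorphism: `e` is open in `translate γ ω` if and
only if `γ⁻¹ e` is open in `ω`. -/
def translate {G : SimpleGraph V} (γ : G ≃g G) (ω : Config G) : Config G :=
  fun e => ω (γ.symm.mapEdgeSet e)

/-- Invariance of a measure under a group of automorphisms. -/
def IsInvariant {G : SimpleGraph V} (Γ : Subgroup (G ≃g G)) (μ : Measure (Config G)) : Prop :=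
  ∀ γ ∈ Γ, μ.map (translate γ) = μ

/-- Both endpoints of the edge `e` lie in `H`, i.e. `e` is an edge of the subgraph induced by `H`. -/
def EdgeInside {G : SimpleGraph V} (H : Finset V) (e : G.edgeSet) : Prop :=
  ∀ v ∈ (e : Sym2 V), v ∈ H

/-- `F_H`: the part of the spanning subgraph inside the induced subgraph on `H`. -/
def inside {G : SimpleGraph V} (H : Finset V) (ω : Config G) : SimpleGraph (H : Set V) :=
  (toGraph ω).induce (H : Set V)

/-- `F_{G ∖ H}`: the status of all the edges that are not edges of the subgraph induced by `H`. -/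
def outside {G : SimpleGraph V} (H : Finset V) (ω : Config G) :
    {e : G.edgeSet // ¬ EdgeInside H e} → Bool :=
  fun e => ω e

/-- The relation on the boundary of `H` of being connected by a path of `A`, where `A` is a
subgraph with vertex set `H`. -/
def bdryRel (G : SimpleGraph V) (H : Finset V) (A : SimpleGraph (H : Set V))
    (a b : (H : Set V)) : Prop :=
  (a : V) ∈ bdry G H ∧ (b : V) ∈ bdry G H ∧ A.Reachable a b

/-- `A` is a spanning forest of the subgraph induced by `H`, each component of which contains at
least one boundary vertex of `H`. -/
def IsBdryForest (G : SimpleGraph V) (H : Finset V) (A : SimpleGraph (H : Set V)) : Prop :=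
  A ≤ G.induce (H : Set V) ∧ A.IsAcyclic ∧
    ∀ c : A.ConnectedComponent, ∃ b ∈ c.supp, (b : V) ∈ bdry G H

/-- The sigma-algebra generated by `F_{G ∖ H}` and by the relation that `F_H` induces on the
boundary of `H`. -/
abbrev gibbsSigma (G : SimpleGraph V) (H : Finset V) : MeasurableSpace (Config G) :=
  MeasurableSpace.comap (outside H) inferInstance ⊔
    MeasurableSpace.comap (fun ω : Config G => bdryRel G H (inside H ω)) ⊤

theorem measurableSet_adj {G : SimpleGraph V} (a b : V) :
    MeasurableSet {ω : Config G | (toGraph ω).Adj a b} := by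
  by_cases h : G.Adj a b
  · have : {ω : Config G | (toGraph ω).Adj a b} =
        (fun ω : Config G => ω ⟨s(a, b), h⟩) ⁻¹' {true} := by
      ext ω
      simp [toGraph, h, h.ne]
    rw [this]
    exact measurable_pi_apply _ (MeasurableSet.singleton _)
  · have : {ω : Config G | (toGraph ω).Adj a b} = ∅ := by
      ext ω
      simp [toGraph, h]
    rw [this]
    exact MeasurableSet.empty

theorem measurableSet_inside_eq {G : SimpleGraph V} (H : Finset V)
    (A : SimpleGraph (H : Set V)) : MeasurableSet {ω : Config G | inside H ω = A} := by
  have : {ω : Config G | inside H ω = A} =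
      ⋂ a : (H : Set V), ⋂ b : (H : Set V),
        {ω : Config G | (toGraph ω).Adj a b ↔ A.Adj a b} := by
    ext ω
    simp only [Set.mem_ofPred_eq, Set.mem_iInter, SimpleGraph.ext_iff, funext_iff, eq_iff_iff]
    rfl
  rw [this]
  refine MeasurableSet.iInter fun a => MeasurableSet.iInter fun b => ?_
  exact (measurableSet_adj (G := G) a b).iff (MeasurableSet.const _)

/-- The conditioning sigma-algebra is a sub-sigma-algebra of the product one, so that conditional
probabilities given `gibbsSigma G H` are the genuine ones. -/
theorem gibbsSigma_le (G : SimpleGraph V) (H : Finset V) :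
    gibbsSigma G H ≤ (inferInstance : MeasurableSpace (Config G)) := by
  refine sup_le ?_ ?_
  · exact Measurable.comap_le (measurable_pi_lambda _ fun e => measurable_pi_apply _)
  · rintro _ ⟨s, -, rfl⟩
    have : (fun ω : Config G => bdryRel G H (inside H ω)) ⁻¹' s =
        ⋃ A ∈ {A : SimpleGraph (H : Set V) | bdryRel G H A ∈ s},
          {ω : Config G | inside H ω = A} := by
      ext ω
      simp
    rw [this]
    exact MeasurableSet.biUnion (Set.toFinite _).countable fun A _ => measurableSet_inside_eq H A

/-- The weak Gibbs property: for every finite induced subgraph `H`, conditionally on `F_{G ∖ H}` and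
on the relation that `F_H` induces on the boundary of `H`, all spanning forests of `H` that give
the same relation, and each component of which meets the boundary of `H`, are equally likely to
be `F_H`. -/
def WeakGibbs {G : SimpleGraph V} (μ : Measure (Config G)) : Prop :=
  ∀ (H : Finset V) (A A' : SimpleGraph (H : Set V)),
    IsBdryForest G H A → IsBdryForest G H A' → bdryRel G H A = bdryRel G H A' →
      μ⟦{ω : Config G | inside H ω = A} | gibbsSigma G H⟧ =ᵐ[μ]
        μ⟦{ω : Config G | inside H ω = A'} | gibbsSigma G H⟧

end Configurations

section UniformSpanningTree

variable {V : Type*}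

/-- The spanning trees of the subgraph of `G` induced by `K`, as configurations on `G` (edges that
are not inside `K` are closed). -/
def spanningTrees (G : SimpleGraph V) (K : Finset V) : Set (Config G) :=
  {ω | (∀ e, ω e = true → EdgeInside K e) ∧ (inside K ω).IsTree}

theorem spanningTrees_finite (G : SimpleGraph V) (K : Finset V) :
    (spanningTrees G K).Finite := by
  refine Set.Finite.of_injOn (f := inside K) (t := Set.univ) (fun _ _ => Set.mem_univ _) ?_
    Set.finite_univ
  intro ω hω ω' hω' h
  funext ⟨e, he⟩
  by_cases hin : EdgeInside K (⟨e, he⟩ : G.edgeSet)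
  · induction e using Sym2.ind with
    | _ a b =>
      have ha : a ∈ K := hin a (Sym2.mem_mk_left a b)
      have hb : b ∈ K := hin b (Sym2.mem_mk_right a b)
      have hab : G.Adj a b := he
      have := congrArg (fun A : SimpleGraph (K : Set V) => A.Adj ⟨a, ha⟩ ⟨b, hb⟩) h
      simp only [inside, toGraph, SimpleGraph.comap_adj, SimpleGraph.fromEdgeSet_adj,
        Function.Embedding.subtype_apply, Set.mem_ofPred_eq, eq_iff_iff] at this
      rw [Bool.eq_iff_iff]
      constructor
      · intro h1
        exact (this.1 ⟨⟨he, h1⟩, hab.ne⟩).1.2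
      · intro h1
        exact (this.2 ⟨⟨he, h1⟩, hab.ne⟩).1.2
  · have h1 : ω ⟨e, he⟩ ≠ true := fun h1 => hin (hω.1 _ h1)
    have h2 : ω' ⟨e, he⟩ ≠ true := fun h2 => hin (hω'.1 _ h2)
    rw [Bool.eq_false_iff.2 h1, Bool.eq_false_iff.2 h2]

theorem spanningTrees_nonempty {G : SimpleGraph V} {K : Finset V}
    (hK : (G.induce (K : Set V)).Connected) : (spanningTrees G K).Nonempty := by
  classical
  obtain ⟨T, hT, hTree⟩ := hK.exists_isTree_le
  let S : SimpleGraph V := T.map (Function.Embedding.subtype _)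
  refine ⟨fun e => decide ((e : Sym2 V) ∈ S.edgeSet), ?_, ?_⟩
  · rintro ⟨e, he⟩ h v hv
    induction e using Sym2.ind with
    | _ a b =>
      have h : S.Adj a b := by simpa using h
      obtain ⟨x, y, -, rfl, rfl⟩ := (SimpleGraph.map_adj _ _ _ _).1 h
      rcases Sym2.mem_iff.1 hv with rfl | rfl
      · exact x.2
      · exact y.2
  · convert hTree
    ext x y
    have hS : S.Adj x y ↔ T.Adj x y :=
      SimpleGraph.map_adj_apply (f := Function.Embedding.subtype _)
    simp only [inside, toGraph, SimpleGraph.comap_adj, SimpleGraph.fromEdgeSet_adj,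
      Function.Embedding.subtype_apply, Set.mem_ofPred_eq, decide_eq_true_eq,
      SimpleGraph.mem_edgeSet, hS]
    constructor
    · rintro ⟨⟨_, h⟩, _⟩
      exact h
    · intro h
      exact ⟨⟨hT h, h⟩, (show G.Adj x y from hT h).ne⟩

instance instCountableEdgeSet [Countable V] (G : SimpleGraph V) : Countable G.edgeSet := by
  have : Countable (Sym2 V) := (Quot.mk_surjective (r := Sym2.Rel V)).countable
  infer_instance

/-- The uniform measure on the spanning trees of the connected subgraph induced by `K`. -/
noncomputable def uniformSpanningTree [Countable V] (G : SimpleGraph V) (K : Finset V)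
    (hK : (G.induce (K : Set V)).Connected) : ProbabilityMeasure (Config G) :=
  ⟨uniformOn (spanningTrees G K),
    isProbabilityMeasure_uniformOn (spanningTrees_finite G K) (spanningTrees_nonempty hK)⟩

/-- `μ` is the measure `μ_G`: for every increasing sequence of finite connected induced subgraphs
with union `G`, the uniform measures on their spanning trees converge weakly to `μ`. Since weak
limits are unique, at most one `μ` has this property as soon as there is such a sequence. -/
def IsLimitUST [Countable V] (G : SimpleGraph V) (μ : ProbabilityMeasure (Config G)) : Prop :=
  ∀ (K : ℕ → Finset V) (hK : IsExhaustion G K),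
    Tendsto (fun n => uniformSpanningTree G (K n) (hK.connected n)) atTop (𝓝 μ)

end UniformSpanningTree

end EssentialForest

/-!
# Invariant weak Gibbs forests with exactly one two-ended tree

Why there is only one tree. Call a vertex of the forest a core vertex (`IsCore`) if removing it
leaves at least two infinite branches. A component has at least two ends exactly if it contains a
core vertex, and at least three ends only if it contains a trifurcation, a vertex with three infinite
branches. Inside a finite set there are at most as many trifurcations as boundary vertices
(`card_trifurcation_le`), so by invariance and amenability there are none (`ae_not_isTrifurcation`),
and every component has one or two ends. Now condition on the set of core vertices and let
`noCoreProb μ v` be the conditional probability that the component of `v` contains none of them.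
A non-core vertex `v` is the root of a finite tree, joined by an edge to a parent `u`. To detach this
tree from `u` and hang it on another neighbour `w` of `v` outside of it is a local modification that
does not change the core, and the weak Gibbs property makes it measure preserving
(`WeakGibbs.measure_movable_eq`). It follows that `noCoreProb` is harmonic at the non-core vertices
(`WeakGibbs.noCoreProb_harmonic`); at the core vertices it vanishes. Multiply by the function and sum
over a Følner set: its Dirichlet energy there is at most of the order of the boundary (`energy_le`).
The expected energy at a vertex is constant on the orbits of `Γ`, hence zero by amenability
(`InvariantFun.eq_zero`), and `noCoreProb` is constant. As the core is not empty, the constant is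
zero: every component meets the core (`WeakGibbs.ae_not_noCore`), so each has exactly two ends, and
as only one of them does, there is only one (`WeakGibbs.ae_isTree`).

Why the law is the limit of uniform spanning trees. For a random spanning tree, the connections
outside of a finite set `K` determine a wiring of `K`, and the weak Gibbs property, used in a large
subgraph around `K`, says that the part inside `K` is a uniform spanning tree of the wired graph
(`WeakGibbs.treeGibbs`). Uniform spanning trees decrease stochastically when vertices are wired
together: this is `sum_bases_mono`, proved by induction over the edges from Rayleigh's monotonicity
principle (`rayleigh`), as for the Feder–Mihail theorem. So `μ` is dominated inside `K` by the
uniform spanning tree of `K`. Both have one edge per vertex, up to a boundary term, and by invariance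
and amenability the probabilities that a given edge is open agree in the limit
(`freeProb_eq_of_treeGibbs`). Two stochastically ordered measures with the same edge marginals are
equal. In quantitative form, domination applied to the increasing functions `∏ₑ ωₑ` and
`∑ₑ ωₑ - ∏ₑ ωₑ` squeezes the probabilities of cylinder events
(`tendsto_uniformSpanningTree_forall_edge`), and weak convergence follows (`WeakGibbs.isLimitUST`).
-/


namespace EssentialForest

/-! ### Spanning trees of a wired graph -/

section SetoidRank

variable {X : Type*}

/-- The finest equivalence relation that identifies `x` and `y`. -/
def pairSetoid (x y : X) : Setoid X := Relation.EqvGen.setoid fun a b => a = x ∧ b = y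

theorem pairSetoid_le {x y : X} {Q : Setoid X} : pairSetoid x y ≤ Q ↔ Q x y := by
  constructor
  · intro h
    exact h (Relation.EqvGen.rel _ _ ⟨rfl, rfl⟩)
  · intro h
    exact Setoid.eqvGen_le (by rintro a b ⟨rfl, rfl⟩; exact h)

theorem sup_pairSetoid_rel (Q : Setoid X) (x y : X) : (Q ⊔ pairSetoid x y) x y :=
  pairSetoid_le.1 le_sup_right

/-- The number of classes of an equivalence relation. -/
noncomputable def numClasses (Q : Setoid X) : ℕ := Nat.card (Quotient Q)

theorem numClasses_top [Nonempty X] : numClasses (⊤ : Setoid X) = 1 := by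
  have : Subsingleton (Quotient (⊤ : Setoid X)) := Quotient.subsingleton_iff.2 rfl
  obtain ⟨x⟩ := ‹Nonempty X›
  have : Nonempty (Quotient (⊤ : Setoid X)) := ⟨Quotient.mk _ x⟩
  exact Nat.card_unique

theorem sup_pair_eq_of_rel {Q : Setoid X} {x y : X} (h : Q x y) : Q ⊔ pairSetoid x y = Q :=
  sup_eq_left.2 (pairSetoid_le.2 h)

variable {ι : Type*} (s t : ι → X)

/-- Connectivity in the multigraph on the classes of `Q` whose edges are the `e ∈ S`, where `e`
joins `s e` and `t e`. -/
def conn (Q : Setoid X) (S : Finset ι) : Setoid X := Q ⊔ S.sup fun e => pairSetoid (s e) (t e)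

variable {s t}

theorem conn_empty (Q : Setoid X) : conn s t Q ∅ = Q := by simp [conn]

theorem conn_insert [DecidableEq ι] (Q : Setoid X) (e : ι) (S : Finset ι) :
    conn s t Q (insert e S) = conn s t Q S ⊔ pairSetoid (s e) (t e) := by
  simp only [conn, Finset.sup_insert]
  rw [sup_assoc, sup_comm (pairSetoid _ _)]

theorem conn_sup_pair (Q : Setoid X) (x y : X) (S : Finset ι) :
    conn s t (Q ⊔ pairSetoid x y) S = conn s t Q S ⊔ pairSetoid x y := by
  simp only [conn, sup_assoc, sup_comm (pairSetoid _ _)]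

theorem le_conn (Q : Setoid X) (S : Finset ι) : Q ≤ conn s t Q S := le_sup_left

theorem conn_rel_of_mem (Q : Setoid X) {S : Finset ι} {e : ι} (he : e ∈ S) :
    conn s t Q S (s e) (t e) :=
  pairSetoid_le.1 ((Finset.le_sup (f := fun e => pairSetoid (s e) (t e)) he).trans le_sup_right)

theorem conn_le {Q R : Setoid X} {S : Finset ι} (hQ : Q ≤ R) (hS : ∀ e ∈ S, R (s e) (t e)) :
    conn s t Q S ≤ R :=
  sup_le hQ (Finset.sup_le fun e he => pairSetoid_le.2 (hS e he))

theorem conn_mono {Q Q' : Setoid X} {S S' : Finset ι} (hQ : Q ≤ Q') (hS : S ⊆ S') :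
    conn s t Q S ≤ conn s t Q' S' :=
  sup_le_sup hQ (Finset.sup_mono hS)

variable (s t) in
open Classical in
/-- The spanning trees, with edges in `E`, of the multigraph on the classes of `Q`, as edge sets:
connected with one edge less than there are vertices. -/
noncomputable def bases (Q : Setoid X) (E : Finset ι) : Finset (Finset ι) :=
  {S ∈ E.powerset | conn s t Q S = ⊤ ∧ S.card + 1 = numClasses Q}

theorem mem_bases {Q : Setoid X} {E S : Finset ι} :
    S ∈ bases s t Q E ↔ S ⊆ E ∧ conn s t Q S = ⊤ ∧ S.card + 1 = numClasses Q := by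
  simp [bases]

theorem mem_bases_insert_iff [DecidableEq ι] {Q : Setoid X} {E S : Finset ι} {e : ι}
    (heS : e ∉ S) : S ∈ bases s t Q (insert e E) ↔ S ∈ bases s t Q E := by
  rw [mem_bases, mem_bases, Finset.subset_insert_iff_of_notMem heS]

variable [Finite X]

theorem numClasses_anti {Q Q' : Setoid X} (h : Q ≤ Q') : numClasses Q' ≤ numClasses Q :=
  Nat.card_le_card_of_surjective (Quotient.map' (s₁ := Q) (s₂ := Q') id h) (by
    intro c
    induction c using Quotient.inductionOn with
    | _ a => exact ⟨Quotient.mk _ a, rfl⟩)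

theorem eq_top_of_numClasses_le_one {Q : Setoid X} (h : numClasses Q ≤ 1) : Q = ⊤ := by
  rw [← Quotient.subsingleton_iff]
  exact Finite.card_le_one_iff_subsingleton.1 h

/-- Joining two distinct classes lowers the number of classes by exactly one. -/
theorem numClasses_sup_pair {Q : Setoid X} {x y : X} (h : ¬ Q x y) :
    numClasses (Q ⊔ pairSetoid x y) + 1 = numClasses Q := by
  classical
  let g : X → Quotient Q := fun a => if Q a y then Quotient.mk Q x else Quotient.mk Q a
  have hx : g x = Quotient.mk Q x := by simp [g]
  have hy : g y = Quotient.mk Q x := by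
    simp only [g, if_pos (Q.refl' y)]
  have hker : Q ⊔ pairSetoid x y = Setoid.ker g := by
    apply le_antisymm
    · refine sup_le ?_ (pairSetoid_le.2 ?_)
      · intro a b hab
        rw [Setoid.ker_def]
        by_cases ha : Q a y
        · have hb : Q b y := Q.trans' (Q.symm' hab) ha
          simp [g, ha, hb]
        · have hb : ¬ Q b y := fun hb => ha (Q.trans' hab hb)
          simp only [g, ha, hb, if_false]
          exact Quotient.sound hab
      · rw [Setoid.ker_def, hx, hy]
    · intro a b hab
      rw [Setoid.ker_def] at hab
      have key : ∀ c, (Q ⊔ pairSetoid x y) c (g c).out := by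
        intro c
        by_cases hc : Q c y
        · simp only [g, hc, if_true]
          have h1 : (Q ⊔ pairSetoid x y) c y := (le_sup_left : Q ≤ _) hc
          have h2 : Q x (Quotient.mk Q x).out := Q.symm' (Quotient.mk_out x)
          exact Setoid.trans' _ h1 (Setoid.trans' _ (Setoid.symm' _ (sup_pairSetoid_rel Q x y))
            ((le_sup_left : Q ≤ _) h2))
        · simp only [g, hc, if_false]
          exact (le_sup_left : Q ≤ _) (Q.symm' (Quotient.mk_out c))
      exact Setoid.trans' _ (key a) (hab ▸ Setoid.symm' _ (key b))
  have hrange : Set.range g = {Quotient.mk Q y}ᶜ := by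
    ext c
    induction c using Quotient.inductionOn with
    | _ a =>
      simp only [Set.mem_range, Set.mem_compl_iff, Set.mem_singleton_iff]
      constructor
      · rintro ⟨b, hb⟩ hay
        rw [hay] at hb
        by_cases hby : Q b y
        · simp only [g, hby, if_true] at hb
          exact h (Quotient.exact hb)
        · simp only [g, hby, if_false] at hb
          exact hby (Quotient.exact hb)
      · intro hay
        refine ⟨a, ?_⟩
        have : ¬ Q a y := fun h' => hay (Quotient.sound h')
        simp [g, this]
  unfold numClasses
  rw [hker, Nat.card_congr (Setoid.quotientKerEquivRange g), hrange, Nat.card_coe_set_eq,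
    Set.ncard_compl, Set.ncard_singleton]
  have : 0 < Nat.card (Quotient Q) := by
    have : Nonempty (Quotient Q) := ⟨Quotient.mk _ y⟩
    exact Nat.card_pos
  omega

theorem numClasses_le_sup_pair (Q : Setoid X) (x y : X) :
    numClasses Q ≤ numClasses (Q ⊔ pairSetoid x y) + 1 := by
  by_cases h : Q x y
  · rw [sup_pair_eq_of_rel h]; omega
  · exact (numClasses_sup_pair h).ge

theorem numClasses_le_conn (Q : Setoid X) (S : Finset ι) :
    numClasses Q ≤ numClasses (conn s t Q S) + S.card := by
  classical
  induction S using Finset.induction_on with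
  | empty => simp [conn_empty]
  | insert e S he ih =>
    rw [conn_insert, Finset.card_insert_of_notMem he]
    have := numClasses_le_sup_pair (conn s t Q S) (s e) (t e)
    omega

/-- An independent edge set lowers the number of classes by its cardinality. -/
theorem numClasses_conn_of_independent [DecidableEq ι] (Q : Setoid X) (S : Finset ι)
    (h : ∀ e ∈ S, ¬ conn s t Q (S.erase e) (s e) (t e)) :
    numClasses (conn s t Q S) + S.card = numClasses Q := by
  induction S using Finset.induction_on with
  | empty => simp [conn_empty]
  | insert e S he ih =>
    have h1 := h e (Finset.mem_insert_self e S)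
    rw [Finset.erase_insert he] at h1
    have h2 := numClasses_sup_pair h1
    have h3 := ih fun f hf hc => h f (Finset.mem_insert_of_mem hf) <|
      conn_mono le_rfl (Finset.erase_subset_erase _ (Finset.subset_insert _ _)) hc
    rw [conn_insert, Finset.card_insert_of_notMem he]
    omega

theorem not_rel_of_mem_bases [DecidableEq ι] {Q : Setoid X} {E S : Finset ι} {e : ι}
    (hS : S ∈ bases s t Q E) (he : e ∈ S) : ¬ conn s t Q (S.erase e) (s e) (t e) := by
  intro h
  obtain ⟨-, h1, h2⟩ := mem_bases.1 hS
  have h3 : conn s t Q (S.erase e) = ⊤ := by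
    rw [← h1, ← sup_pair_eq_of_rel h, ← conn_insert, Finset.insert_erase he]
  have h4 := numClasses_le_conn (s := s) (t := t) Q (S.erase e)
  have : Nonempty X := ⟨s e⟩
  rw [h3, numClasses_top, Finset.card_erase_of_mem he] at h4
  have := Finset.card_pos.2 ⟨e, he⟩
  omega

theorem not_rel_of_mem_bases_sup {Q : Setoid X} {E S : Finset ι} {a b : X} (hab : ¬ Q a b)
    (hS : S ∈ bases s t (Q ⊔ pairSetoid a b) E) : ¬ conn s t Q S a b := by
  intro h
  obtain ⟨-, h1, h2⟩ := mem_bases.1 hS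
  rw [conn_sup_pair, sup_pair_eq_of_rel h] at h1
  have h3 := numClasses_le_conn (s := s) (t := t) Q S
  have h4 := numClasses_sup_pair hab
  have : Nonempty X := ⟨a⟩
  rw [h1, numClasses_top] at h3
  omega

theorem insert_mem_bases_iff [DecidableEq ι] {Q : Setoid X} {E S : Finset ι} {e : ι} (he : e ∉ E)
    (hS : S ⊆ E) : insert e S ∈ bases s t Q (insert e E) ↔
      ¬ Q (s e) (t e) ∧ S ∈ bases s t (Q ⊔ pairSetoid (s e) (t e)) E := by
  have heS : e ∉ S := fun h => he (hS h)
  constructor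
  · intro h
    have h1 : ¬ Q (s e) (t e) := fun h' => not_rel_of_mem_bases h (Finset.mem_insert_self e S)
      (le_conn _ _ h')
    obtain ⟨-, h2, h3⟩ := mem_bases.1 h
    refine ⟨h1, mem_bases.2 ⟨hS, ?_, ?_⟩⟩
    · rw [conn_sup_pair, ← conn_insert, h2]
    · rw [Finset.card_insert_of_notMem heS] at h3
      have := numClasses_sup_pair h1
      omega
  · rintro ⟨h1, h⟩
    obtain ⟨-, h2, h3⟩ := mem_bases.1 h
    refine mem_bases.2 ⟨Finset.insert_subset_insert _ hS, ?_, ?_⟩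
    · rw [conn_insert, ← conn_sup_pair, h2]
    · rw [Finset.card_insert_of_notMem heS]
      have := numClasses_sup_pair h1
      omega

/-- Deletion and contraction of an edge that is not a loop. -/
theorem sum_bases_insert [DecidableEq ι] {Q : Setoid X} {E : Finset ι} {e : ι} (he : e ∉ E)
    (hQ : ¬ Q (s e) (t e)) (f : Finset ι → ℝ) :
    ∑ S ∈ bases s t Q (insert e E), f S = ∑ S ∈ bases s t Q E, f S +
      ∑ S ∈ bases s t (Q ⊔ pairSetoid (s e) (t e)) E, f (insert e S) := by
  have hsub : ∀ {Q : Setoid X} {S}, S ∈ bases s t Q E → S ⊆ E := fun h => (mem_bases.1 h).1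
  have hU : bases s t Q (insert e E) = bases s t Q E ∪
      (bases s t (Q ⊔ pairSetoid (s e) (t e)) E).image (insert e) := by
    ext S
    rw [Finset.mem_union, Finset.mem_image]
    constructor
    · intro h
      by_cases heS : e ∈ S
      · refine Or.inr ⟨S.erase e, ?_, Finset.insert_erase heS⟩
        have h1 : S.erase e ⊆ E := by
          rw [← Finset.subset_insert_iff]; exact (mem_bases.1 h).1
        rw [← Finset.insert_erase heS, insert_mem_bases_iff he h1] at h
        exact h.2
      · exact Or.inl ((mem_bases_insert_iff heS).1 h)
    · rintro (h | ⟨S', h, rfl⟩)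
      · exact (mem_bases_insert_iff fun h' => he (hsub h h')).2 h
      · exact (insert_mem_bases_iff he (hsub h)).2 ⟨hQ, h⟩
  rw [hU, Finset.sum_union, Finset.sum_image]
  · intro S hS S' hS' h
    have h1 : e ∉ S := fun h' => he (hsub hS h')
    have h2 : e ∉ S' := fun h' => he (hsub hS' h')
    rw [← Finset.erase_insert h1, ← Finset.erase_insert h2]
    exact congrArg (fun A => A.erase e) h
  · rw [Finset.disjoint_left]
    intro S hS hS'
    obtain ⟨S', -, rfl⟩ := Finset.mem_image.1 hS'
    exact he (hsub hS (Finset.mem_insert_self _ _))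

theorem bases_nonempty_of_le {Q Q' : Setoid X} {E : Finset ι} (hQ : Q ≤ Q')
    (h : (bases s t Q E).Nonempty) : (bases s t Q' E).Nonempty := by
  classical
  obtain ⟨S, hS⟩ := h
  obtain ⟨hSE, hS1, -⟩ := mem_bases.1 hS
  -- a minimal connected subset is a spanning tree
  obtain ⟨T, hTS, hT⟩ := exists_minimal_le_of_wellFoundedLT
    (fun T : Finset ι => conn s t Q' T = ⊤) S
    (top_le_iff.1 (hS1 ▸ conn_mono hQ subset_rfl))
  refine ⟨T, mem_bases.2 ⟨hTS.trans hSE, hT.1, ?_⟩⟩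
  have hind := numClasses_conn_of_independent (s := s) (t := t) Q' T fun e he hc => by
    have h1 : conn s t Q' (T.erase e) = ⊤ := by
      rw [← hT.1, ← sup_pair_eq_of_rel hc, ← conn_insert, Finset.insert_erase he]
    exact Finset.notMem_erase e T (hT.2 h1 (Finset.erase_subset _ _) he)
  rcases isEmpty_or_nonempty X with hX | hX
  · have h2 := (mem_bases.1 hS).2.2
    have : numClasses Q = 0 := by
      have : IsEmpty (Quotient Q) := ⟨fun q => hX.false q.out⟩
      exact Nat.card_of_isEmpty
    omega
  · rw [hT.1, numClasses_top] at hind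
    omega

end SetoidRank

/-! ### Electric networks and the Rayleigh principle -/

section NegativeCorrelation

variable {X ι : Type*} [Finite X] {s t : ι → X}

/-- Among two classes, the one that does not contain `a` contains both `b` and `z`. -/
theorem rel_of_numClasses_le_two {R : Setoid X} (hR : numClasses R ≤ 2) {a b z : X}
    (hab : ¬ R a b) (haz : ¬ R a z) : R b z := by
  by_contra hbz
  have := Fintype.ofFinite (Quotient R)
  have h : 2 < Fintype.card (Quotient R) := Fintype.two_lt_card_iff.2
    ⟨Quotient.mk R a, Quotient.mk R b, Quotient.mk R z, fun h => hab (Quotient.exact h),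
      fun h => haz (Quotient.exact h), fun h => hbz (Quotient.exact h)⟩
  unfold numClasses at hR
  rw [Nat.card_eq_fintype_card] at hR
  omega

open Classical in
/-- The real-valued indicator of a proposition. -/
noncomputable def ind (p : Prop) : ℝ := if p then 1 else 0

theorem ind_true {p : Prop} (h : p) : ind p = 1 := if_pos h
theorem ind_false {p : Prop} (h : ¬ p) : ind p = 0 := if_neg h
theorem ind_congr {p q : Prop} (h : p ↔ q) : ind p = ind q := by rw [propext h]

variable (s t) in
/-- The difference, along the edge `e`, of the indicator of the `conn s t Q S`-class of `a`. -/
noncomputable def cutSign (Q : Setoid X) (S : Finset ι) (a : X) (e : ι) : ℝ :=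
  ind (conn s t Q S a (s e)) - ind (conn s t Q S a (t e))

omit [Finite X] in
theorem cutSign_congr {Q : Setoid X} {S : Finset ι} {a b : X} (h : conn s t Q S a b) (e : ι) :
    cutSign s t Q S a e = cutSign s t Q S b e := by
  have : ∀ z, conn s t Q S a z ↔ conn s t Q S b z := fun z =>
    ⟨fun h' => Setoid.trans' _ (Setoid.symm' _ h) h', fun h' => Setoid.trans' _ h h'⟩
  simp only [cutSign, ind_congr (this _)]

omit [Finite X] in
theorem cutSign_eq_zero {Q : Setoid X} {S : Finset ι} {e : ι}
    (h : conn s t Q S (s e) (t e)) (a : X) : cutSign s t Q S a e = 0 := by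
  have : conn s t Q S a (s e) ↔ conn s t Q S a (t e) :=
    ⟨fun h' => Setoid.trans' _ h' h, fun h' => Setoid.trans' _ h' (Setoid.symm' _ h)⟩
  rw [cutSign, ind_congr this, sub_self]

variable [DecidableEq ι]

/-- Summing `ψ (s e) - ψ (t e)` along the path from `a` to `b` in a spanning tree. -/
theorem sum_cutSign_tree {Q : Setoid X} {E T : Finset ι} (hT : T ∈ bases s t Q E) (ψ : X → ℝ)
    (hψ : ∀ x y, Q x y → ψ x = ψ y) (a b : X) :
    ∑ e ∈ T, (cutSign s t Q (T.erase e) a e - cutSign s t Q (T.erase e) b e) *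
      (ψ (s e) - ψ (t e)) = 2 * (ψ a - ψ b) := by
  set L : X → ℝ := fun a => ∑ e ∈ T, cutSign s t Q (T.erase e) a e * (ψ (s e) - ψ (t e)) with hL
  -- both sides are additive along chains, so it is enough to compare them across `Q` and edges
  let R : Setoid X := Setoid.ker fun a => L a - 2 * ψ a
  have hR : conn s t Q T ≤ R := by
    apply conn_le
    · intro x y hxy
      have : L x = L y := Finset.sum_congr rfl fun e _ => by
        rw [cutSign_congr (le_conn Q _ hxy) e]
      change L x - 2 * ψ x = L y - 2 * ψ y
      rw [this, hψ x y hxy]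
    · intro f hf
      change L (s f) - 2 * ψ (s f) = L (t f) - 2 * ψ (t f)
      have h1 : ∀ x, L x = cutSign s t Q (T.erase f) x f * (ψ (s f) - ψ (t f)) +
          ∑ e ∈ T.erase f, cutSign s t Q (T.erase e) x e * (ψ (s e) - ψ (t e)) :=
        fun x => (Finset.add_sum_erase T _ hf).symm
      have h2 : ∑ e ∈ T.erase f, cutSign s t Q (T.erase e) (s f) e * (ψ (s e) - ψ (t e)) =
          ∑ e ∈ T.erase f, cutSign s t Q (T.erase e) (t f) e * (ψ (s e) - ψ (t e)) := by
        refine Finset.sum_congr rfl fun e he => ?_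
        rw [cutSign_congr (conn_rel_of_mem Q (e := f) ?_) e]
        exact Finset.mem_erase.2 ⟨(Finset.ne_of_mem_erase he).symm, hf⟩
      have h3 := not_rel_of_mem_bases hT hf
      rw [h1 (s f), h1 (t f), h2]
      simp only [cutSign, ind_true (Setoid.refl' _ _), ind_false h3,
        ind_false fun h => h3 (Setoid.symm' _ h)]
      ring
  have h := hR (show conn s t Q T a b by rw [(mem_bases.1 hT).2.1]; trivial)
  have h' : L a - 2 * ψ a = L b - 2 * ψ b := h
  simp only [sub_mul, Finset.sum_sub_distrib]
  change L a - L b = _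
  linarith

open Classical in
/-- Removing `e` from a spanning tree leaves two classes. The cuts of `a` and `b` are opposite
if `e` separates `a` from `b`, and equal otherwise. -/
theorem cutSign_sub_cutSign {Q : Setoid X} {E T : Finset ι} (hT : T ∈ bases s t Q E) {e : ι}
    (he : e ∈ T) {a b : X} (hab : ¬ Q a b) :
    cutSign s t Q (T.erase e) a e - cutSign s t Q (T.erase e) b e =
      2 * if T.erase e ∈ bases s t (Q ⊔ pairSetoid a b) E then
        cutSign s t Q (T.erase e) a e else 0 := by
  have hX : Nonempty X := ⟨a⟩
  have h1 := not_rel_of_mem_bases hT he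
  obtain ⟨hTE, hT1, hT2⟩ := mem_bases.1 hT
  have hk : numClasses (conn s t Q (T.erase e)) = 2 := by
    rw [← numClasses_sup_pair h1, ← conn_insert, Finset.insert_erase he, hT1, numClasses_top]
  by_cases hc : conn s t Q (T.erase e) a b
  · rw [if_neg, cutSign_congr hc, sub_self, mul_zero]
    exact fun h => not_rel_of_mem_bases_sup hab h hc
  · have hmem : T.erase e ∈ bases s t (Q ⊔ pairSetoid a b) E := by
      refine mem_bases.2 ⟨(Finset.erase_subset _ _).trans hTE, ?_, ?_⟩
      · rw [conn_sup_pair]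
        apply eq_top_of_numClasses_le_one
        have := numClasses_sup_pair hc
        omega
      · have := numClasses_sup_pair hab
        have := Finset.card_pos.2 ⟨e, he⟩
        rw [Finset.card_erase_of_mem he]
        omega
    rw [if_pos hmem]
    have hz : ∀ z, ind (conn s t Q (T.erase e) b z) = 1 - ind (conn s t Q (T.erase e) a z) := by
      intro z
      by_cases hz : conn s t Q (T.erase e) a z
      · rw [ind_true hz, ind_false, sub_self]
        exact fun h => hc (Setoid.trans' _ hz (Setoid.symm' _ h))
      · rw [ind_false hz, ind_true (rel_of_numClasses_le_two hk.le hc hz), sub_zero]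
    simp only [cutSign, hz]
    ring

variable (s t) in
/-- The number of two-component spanning forests separating `a` from `b` with `v` on the side
of `a`. It is a multiple of the electric potential of a current from `a` to `b`. -/
noncomputable def potential (Q : Setoid X) (E : Finset ι) (a b v : X) : ℝ :=
  ∑ S ∈ bases s t (Q ⊔ pairSetoid a b) E, ind (conn s t Q S a v)

omit [DecidableEq ι] in
theorem potential_sub {Q : Setoid X} {E : Finset ι} {a b : X} (hab : ¬ Q a b) :
    potential s t Q E a b a - potential s t Q E a b b =
      (bases s t (Q ⊔ pairSetoid a b) E).card := by
  have h1 : potential s t Q E a b a = (bases s t (Q ⊔ pairSetoid a b) E).card := by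
    simp [potential, ind_true trivial]
  have h2 : potential s t Q E a b b = 0 :=
    Finset.sum_eq_zero fun S hS => ind_false (not_rel_of_mem_bases_sup hab hS)
  rw [h1, h2, sub_zero]

omit [DecidableEq ι] [Finite X] in
theorem potential_congr {Q : Setoid X} {E : Finset ι} {a b x y : X} (h : Q x y) :
    potential s t Q E a b x = potential s t Q E a b y := by
  refine Finset.sum_congr rfl fun S _ => ind_congr ?_
  have h' := le_conn (s := s) (t := t) Q S h
  exact ⟨fun h'' => Setoid.trans' _ h'' h', fun h'' => Setoid.trans' _ h'' (Setoid.symm' _ h')⟩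

/-- Kirchhoff's theorem in weak form: `potential` is the potential of a current from `a` to `b`
whose strength is the number of spanning trees. -/
theorem sum_potential_mul {Q : Setoid X} {E : Finset ι} {a b : X} (hab : ¬ Q a b) (ψ : X → ℝ)
    (hψ : ∀ x y, Q x y → ψ x = ψ y) :
    ∑ e ∈ E, (potential s t Q E a b (s e) - potential s t Q E a b (t e)) * (ψ (s e) - ψ (t e)) =
      (bases s t Q E).card * (ψ a - ψ b) := by
  classical
  have hX : Nonempty X := ⟨a⟩
  set B' := bases s t (Q ⊔ pairSetoid a b) E with hB'
  have hpot : ∀ e ∈ E, potential s t Q E a b (s e) - potential s t Q E a b (t e) =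
      ∑ T ∈ bases s t Q E, if e ∈ T ∧ T.erase e ∈ B' then
        cutSign s t Q (T.erase e) a e else 0 := by
    intro e he
    have h1 : potential s t Q E a b (s e) - potential s t Q E a b (t e) =
        ∑ S ∈ B', cutSign s t Q S a e := by
      simp only [potential, cutSign, Finset.sum_sub_distrib, hB']
    have h2 : ∑ S ∈ B' with (e ∉ S ∧ insert e S ∈ bases s t Q E), cutSign s t Q S a e =
        ∑ S ∈ B', cutSign s t Q S a e := by
      refine Finset.sum_filter_of_ne fun S hS hne => ?_
      have hsep : ¬ conn s t Q S (s e) (t e) := fun h => hne (cutSign_eq_zero h a)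
      have heS : e ∉ S := fun h => hsep (conn_rel_of_mem Q h)
      obtain ⟨hS1, hS2, hS3⟩ := mem_bases.1 hS
      have hk : numClasses (conn s t Q S) ≤ 2 := by
        have := numClasses_le_sup_pair (conn s t Q S) a b
        rw [← conn_sup_pair, hS2, numClasses_top] at this
        exact this
      refine ⟨heS, mem_bases.2 ⟨Finset.insert_subset he hS1, ?_, ?_⟩⟩
      · rw [conn_insert]
        apply eq_top_of_numClasses_le_one
        have := numClasses_sup_pair hsep
        omega
      · rw [Finset.card_insert_of_notMem heS]
        have := numClasses_sup_pair hab
        omega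
    rw [h1, ← h2, ← Finset.sum_filter]
    refine Finset.sum_nbij' (fun S => insert e S) (fun T => T.erase e) ?_ ?_ ?_ ?_ ?_
    · intro S hS
      simp only [Finset.mem_filter] at hS ⊢
      refine ⟨hS.2.2, Finset.mem_insert_self _ _, ?_⟩
      rw [Finset.erase_insert hS.2.1]
      exact hS.1
    · intro T hT
      simp only [Finset.mem_filter] at hT ⊢
      refine ⟨hT.2.2, Finset.notMem_erase _ _, ?_⟩
      rw [Finset.insert_erase hT.2.1]
      exact hT.1
    · intro S hS
      simp only [Finset.mem_filter] at hS
      exact Finset.erase_insert hS.2.1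
    · intro T hT
      simp only [Finset.mem_filter] at hT
      exact Finset.insert_erase hT.2.1
    · intro S hS
      simp only [Finset.mem_filter] at hS
      simp only [Finset.erase_insert hS.2.1]
  have hT : ∀ T ∈ bases s t Q E, ∑ e ∈ E, (if e ∈ T ∧ T.erase e ∈ B' then
      cutSign s t Q (T.erase e) a e else 0) * (ψ (s e) - ψ (t e)) = ψ a - ψ b := by
    intro T hT
    have h1 : ∑ e ∈ E, (if e ∈ T ∧ T.erase e ∈ B' then
        cutSign s t Q (T.erase e) a e else 0) * (ψ (s e) - ψ (t e)) =
        ∑ e ∈ T, (if T.erase e ∈ B' then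
        cutSign s t Q (T.erase e) a e else 0) * (ψ (s e) - ψ (t e)) := by
      symm
      refine Finset.sum_subset_zero_on_sdiff (mem_bases.1 hT).1 ?_ ?_
      · intro e he
        simp [(Finset.mem_sdiff.1 he).2]
      · intro e he
        simp [he]
    have h2 := sum_cutSign_tree hT ψ hψ a b
    rw [Finset.sum_congr rfl fun e he => by rw [cutSign_sub_cutSign hT he hab]] at h2
    simp only [mul_assoc, ← Finset.mul_sum] at h2
    rw [h1]
    linarith
  rw [Finset.sum_congr rfl fun e he => by rw [hpot e he]]
  simp only [Finset.sum_mul]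
  rw [Finset.sum_comm, Finset.sum_congr rfl hT, Finset.sum_const, nsmul_eq_mul]

/-- Rayleigh's monotonicity principle: contracting the pair `x, y` does not increase the effective
resistance between `a` and `b`. -/
theorem rayleigh {Q : Setoid X} {E : Finset ι} {a b x y : X}
    (hab : ¬ (Q ⊔ pairSetoid x y) a b) :
    ((bases s t (Q ⊔ pairSetoid x y ⊔ pairSetoid a b) E).card : ℝ) * (bases s t Q E).card ≤
      (bases s t (Q ⊔ pairSetoid a b) E).card * (bases s t (Q ⊔ pairSetoid x y) E).card := by
  set Q' := Q ⊔ pairSetoid x y with hQ'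
  have hQQ' : Q ≤ Q' := le_sup_left
  have hab' : ¬ Q a b := fun h => hab (hQQ' h)
  set φ := potential s t Q E a b
  set φ' := potential s t Q' E a b
  have h11 := sum_potential_mul (s := s) (t := t) (E := E) hab' φ fun _ _ => potential_congr
  have h12 := sum_potential_mul (s := s) (t := t) (E := E) hab' φ' fun _ _ h =>
    potential_congr (hQQ' h)
  have h22 := sum_potential_mul (s := s) (t := t) (E := E) hab φ' fun _ _ => potential_congr
  have hd := potential_sub (s := s) (t := t) (E := E) hab'
  have hd' := potential_sub (s := s) (t := t) (E := E) hab
  have hcs := Finset.sum_mul_sq_le_sq_mul_sq E (fun e => φ (s e) - φ (t e))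
    (fun e => φ' (s e) - φ' (t e))
  simp only [sq] at hcs
  change ∑ e ∈ E, (φ (s e) - φ (t e)) * (φ' (s e) - φ' (t e)) = _ at h12
  change ∑ e ∈ E, (φ (s e) - φ (t e)) * (φ (s e) - φ (t e)) = _ at h11
  change ∑ e ∈ E, (φ' (s e) - φ' (t e)) * (φ' (s e) - φ' (t e)) = _ at h22
  change φ a - φ b = _ at hd
  change φ' a - φ' b = _ at hd'
  rw [h11, h12, h22, hd, hd'] at hcs
  set N := ((bases s t Q E).card : ℝ)
  set N' := ((bases s t Q' E).card : ℝ)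
  set A := ((bases s t (Q ⊔ pairSetoid a b) E).card : ℝ)
  set A' := ((bases s t (Q' ⊔ pairSetoid a b) E).card : ℝ)
  have hN : 0 ≤ N := Nat.cast_nonneg _
  have hN' : 0 ≤ N' := Nat.cast_nonneg _
  have hA : 0 ≤ A := Nat.cast_nonneg _
  have hA' : 0 ≤ A' := Nat.cast_nonneg _
  rcases (mul_nonneg hA' hN).eq_or_lt with h0 | h0
  · rw [← h0]; positivity
  · have : (A' * N) * (A' * N) ≤ (A * N') * (A' * N) := by nlinarith
    exact le_of_mul_le_mul_right this h0

end NegativeCorrelation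

/-! ### Wiring decreases the uniform spanning tree -/

section StochasticDomination

variable {X ι : Type*} [Finite X] {s t : ι → X}

/-- Averages compare if they compare after deletion (index `0`) and after contraction (index `1`)
of an edge, which is negatively correlated with the conditioning (`hr`) and positively correlated
with the function (`hc`). -/
theorem average_le_of_delete_contract {F₀ F₁ G₀ G₁ a₀ a₁ b₀ b₁ : ℝ} (hG₀ : 0 ≤ G₀)
    (ha₀ : 0 ≤ a₀) (ha₁ : 0 < a₁) (hF₀ : 0 ≤ F₀) (hb₀ : 0 ≤ b₀)
    (h₁ : F₁ * b₁ ≤ G₁ * a₁) (h₀ : F₀ * b₀ ≤ G₀ * a₀) (hr : a₁ * b₀ ≤ b₁ * a₀)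
    (hc : F₀ * a₁ ≤ F₁ * a₀) : (F₀ + F₁) * (b₀ + b₁) ≤ (G₀ + G₁) * (a₀ + a₁) := by
  rcases ha₀.eq_or_lt with h | h
  · subst h
    have hF : F₀ = 0 := by nlinarith
    have hb : b₀ = 0 := by nlinarith
    subst hF hb
    nlinarith [mul_nonneg hG₀ ha₁.le]
  · obtain ⟨p, rfl⟩ : ∃ p, F₁ = p * a₁ := ⟨F₁ / a₁, by field_simp⟩
    obtain ⟨q, rfl⟩ : ∃ q, F₀ = q * a₀ := ⟨F₀ / a₀, by field_simp⟩
    have h1 : p * b₁ ≤ G₁ := le_of_mul_le_mul_right (by linarith) ha₁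
    have h0 : q * b₀ ≤ G₀ := le_of_mul_le_mul_right (by linarith) h
    have hpq : q ≤ p := le_of_mul_le_mul_right (a := a₀ * a₁) (by linarith) (by positivity)
    nlinarith [mul_nonneg (sub_nonneg.2 hpq) (sub_nonneg.2 hr),
      mul_le_mul_of_nonneg_right h1 (add_pos h ha₁).le,
      mul_le_mul_of_nonneg_right h0 (add_pos h ha₁).le]

omit [Finite X] in
/-- In a uniform spanning tree, every function is nonnegatively correlated with some edge,
because the number of edges is constant. -/
theorem exists_edge_nonneg_correlation [DecidableEq ι] {Q : Setoid X} {E : Finset ι}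
    (f : Finset ι → ℝ) (hne : (bases s t Q E).Nonempty) (hk : numClasses Q ≠ 1) :
    ∃ e ∈ E, (∃ S ∈ bases s t Q E, e ∈ S) ∧
      (∑ S ∈ bases s t Q E, f S) * (∑ S ∈ bases s t Q E, if e ∈ S then (1 : ℝ) else 0) ≤
        (∑ S ∈ bases s t Q E, if e ∈ S then f S else 0) * (bases s t Q E).card := by
  set B := bases s t Q E with hB
  by_contra! hcon
  have hcard : ∀ S ∈ B, (S.card : ℝ) = numClasses Q - 1 := fun S hS => by
    rw [← (mem_bases.1 hS).2.2]; push_cast; ring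
  have hsum : ∀ g : Finset ι → ℝ, ∑ e ∈ E, ∑ S ∈ B, (if e ∈ S then g S else 0) =
      (numClasses Q - 1) * ∑ S ∈ B, g S := by
    intro g
    rw [Finset.sum_comm, Finset.mul_sum]
    refine Finset.sum_congr rfl fun S hS => ?_
    rw [Finset.sum_ite_mem, Finset.inter_eq_right.2 (mem_bases.1 hS).1, Finset.sum_const,
      nsmul_eq_mul, hcard S hS]
  have h1 := hsum f
  have h2 := hsum fun _ => 1
  have htot : ∑ e ∈ E, ((∑ S ∈ B, if e ∈ S then f S else 0) * (B.card : ℝ) -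
      (∑ S ∈ B, f S) * ∑ S ∈ B, if e ∈ S then (1 : ℝ) else 0) = 0 := by
    rw [Finset.sum_sub_distrib, ← Finset.sum_mul, ← Finset.mul_sum, h1, h2]
    simp only [Finset.sum_const, nsmul_eq_mul]
    ring
  obtain ⟨S, hS⟩ := hne
  have hS' := (mem_bases.1 hS).2.2
  obtain ⟨e, he⟩ : S.Nonempty := by
    rw [← Finset.card_pos]; omega
  refine htot.not_lt (Finset.sum_neg' (fun e he => ?_)
    ⟨e, (mem_bases.1 hS).1 he, sub_neg.2 (hcon e ((mem_bases.1 hS).1 he) ⟨S, hS, he⟩)⟩)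
  by_cases hS : ∃ S ∈ B, e ∈ S
  · exact (sub_neg.2 (hcon e he hS)).le
  · push Not at hS
    rw [Finset.sum_congr rfl fun S h => if_neg (hS S h),
      Finset.sum_congr rfl fun S h => if_neg (hS S h)]
    simp

/-- The Feder-Mihail theorem: contracting a pair of vertices stochastically decreases the uniform
spanning tree. -/
theorem sum_bases_sup_pair_le {Q : Setoid X} {E : Finset ι} {f : Finset ι → ℝ} (hf : Monotone f)
    (h0 : ∀ S, 0 ≤ f S) {x y : X} (hxy : ¬ Q x y) :
    (∑ S ∈ bases s t (Q ⊔ pairSetoid x y) E, f S) * (bases s t Q E).card ≤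
      (∑ S ∈ bases s t Q E, f S) * (bases s t (Q ⊔ pairSetoid x y) E).card := by
  classical
  induction hn : E.card generalizing E Q f with
  | zero =>
    rw [Finset.card_eq_zero] at hn
    subst hn
    have h1 : ∀ {R : Setoid X}, ∀ S ∈ bases s t R ∅, f S = f ∅ := fun S hS => by
      rw [Finset.subset_empty.1 (mem_bases.1 hS).1]
    rw [Finset.sum_congr rfl h1, Finset.sum_congr rfl h1]
    simp only [Finset.sum_const, nsmul_eq_mul]
    exact le_of_eq (by ring)
  | succ n ih =>
    set Q' := Q ⊔ pairSetoid x y with hQ'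
    rcases (bases s t Q' E).eq_empty_or_nonempty with hemp | hne
    · simp [hemp]
    by_cases hk : numClasses Q' = 1
    · have h1 : ∀ S ∈ bases s t Q' E, f S = f ∅ := fun S hS => by
        have := (mem_bases.1 hS).2.2
        rw [hk] at this
        rw [Finset.card_eq_zero.1 (Nat.succ_injective this)]
      have h2 : (bases s t Q E).card * f ∅ ≤ ∑ S ∈ bases s t Q E, f S := by
        rw [← nsmul_eq_mul]
        exact Finset.card_nsmul_le_sum _ _ _ fun S _ => hf (Finset.empty_subset S)
      rw [Finset.sum_congr rfl h1, Finset.sum_const, nsmul_eq_mul]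
      have := mul_le_mul_of_nonneg_left h2
        (Nat.cast_nonneg (α := ℝ) (bases s t Q' E).card)
      linarith
    obtain ⟨e, he, ⟨S₀, hS₀, heS₀⟩, hcor⟩ := exists_edge_nonneg_correlation f hne hk
    have hloop' : ¬ Q' (s e) (t e) := fun h => not_rel_of_mem_bases hS₀ heS₀ (le_conn _ _ h)
    have hloop : ¬ Q (s e) (t e) := fun h => hloop' ((le_sup_left : Q ≤ Q') h)
    obtain ⟨E₀, heE₀, rfl⟩ : ∃ E₀, e ∉ E₀ ∧ insert e E₀ = E :=
      ⟨E.erase e, Finset.notMem_erase e E, Finset.insert_erase he⟩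
    rw [Finset.card_insert_of_notMem heE₀] at hn
    have hmem : ∀ {R : Setoid X}, ∀ S ∈ bases s t R E₀, e ∉ S := fun S hS h =>
      heE₀ ((mem_bases.1 hS).1 h)
    have hxy' : ¬ (Q ⊔ pairSetoid (s e) (t e)) x y := by
      intro h
      have h1 := sup_pair_eq_of_rel h
      have h2 := numClasses_sup_pair hloop'
      rw [hQ', sup_right_comm, h1] at h2
      have h3 := numClasses_sup_pair hloop
      have h4 := numClasses_sup_pair hxy
      omega
    have hcardR : ∀ {R : Setoid X}, ¬ R (s e) (t e) → ((bases s t R (insert e E₀)).card : ℝ) =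
        (bases s t R E₀).card + (bases s t (R ⊔ pairSetoid (s e) (t e)) E₀).card := by
      intro R hR
      have := sum_bases_insert heE₀ hR fun _ => (1 : ℝ)
      simpa using this
    have h1 := ih (Q := Q ⊔ pairSetoid (s e) (t e)) (E := E₀)
      (f := fun S => f (insert e S)) (fun S T h => hf (Finset.insert_subset_insert e h))
      (fun S => h0 _) hxy' (by omega)
    have h2 := ih (Q := Q) (E := E₀) hf h0 hxy (by omega)
    rw [sup_right_comm] at h1
    have h3 := rayleigh (s := s) (t := t) (E := E₀) hloop'
    rw [sum_bases_insert heE₀ hloop, sum_bases_insert heE₀ hloop', hcardR hloop, hcardR hloop']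
    rw [sum_bases_insert heE₀ hloop' f, hcardR hloop',
      sum_bases_insert heE₀ hloop' fun S => if e ∈ S then (1 : ℝ) else 0,
      sum_bases_insert heE₀ hloop' fun S => if e ∈ S then f S else 0,
      Finset.sum_congr rfl fun S hS => if_neg (hmem S hS),
      Finset.sum_congr rfl fun S hS => if_neg (hmem S hS)] at hcor
    simp only [Finset.mem_insert_self, if_true, Finset.sum_const_zero, zero_add, Finset.sum_const,
      nsmul_eq_mul, mul_one] at hcor
    have hpos : (0 : ℝ) < (bases s t (Q' ⊔ pairSetoid (s e) (t e)) E₀).card := by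
      rw [Nat.cast_pos, Finset.card_pos]
      refine ⟨S₀.erase e, ?_⟩
      have hsub : S₀.erase e ⊆ E₀ := by
        rw [← Finset.subset_insert_iff]; exact (mem_bases.1 hS₀).1
      rw [← Finset.insert_erase heS₀, insert_mem_bases_iff heE₀ hsub] at hS₀
      exact hS₀.2
    refine average_le_of_delete_contract (Finset.sum_nonneg fun S _ => h0 S) (Nat.cast_nonneg _)
      hpos (Finset.sum_nonneg fun S _ => h0 S) (Nat.cast_nonneg _) h1 h2 h3 ?_
    linarith

/-- Coarsening the wiring of the vertices stochastically decreases the uniform spanning tree. -/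
theorem sum_bases_mono {Q Q' : Setoid X} (hQ : Q ≤ Q') {E : Finset ι} {f : Finset ι → ℝ}
    (hf : Monotone f) (h0 : ∀ S, 0 ≤ f S) :
    (∑ S ∈ bases s t Q' E, f S) * (bases s t Q E).card ≤
      (∑ S ∈ bases s t Q E, f S) * (bases s t Q' E).card := by
  induction hn : numClasses Q using Nat.strong_induction_on generalizing Q with
  | _ n ih =>
    by_cases h : Q' ≤ Q
    · rw [le_antisymm hQ h]
    · obtain ⟨x, y, hxy', hxy⟩ : ∃ x y, Q' x y ∧ ¬ Q x y := by
        by_contra! hcon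
        exact h fun {x y} => hcon x y
      have h1 := ih _ (by have := numClasses_sup_pair hxy; omega)
        (Q := Q ⊔ pairSetoid x y) (sup_le hQ (pairSetoid_le.2 hxy')) rfl
      have h2 := sum_bases_sup_pair_le (s := s) (t := t) (E := E) hf h0 hxy
      rcases (bases s t Q E).eq_empty_or_nonempty with hemp | hne
      · simp [hemp]
      · obtain hpos := Finset.card_pos.2 (bases_nonempty_of_le
          (le_sup_left : Q ≤ Q ⊔ pairSetoid x y) hne)
        rw [← Nat.cast_pos (α := ℝ)] at hpos
        refine le_of_mul_le_mul_right ?_ hpos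
        have h3 := mul_le_mul_of_nonneg_right h1 (Nat.cast_nonneg (α := ℝ) (bases s t Q E).card)
        have h4 := mul_le_mul_of_nonneg_right h2 (Nat.cast_nonneg (α := ℝ) (bases s t Q' E).card)
        linarith

end StochasticDomination

/-! ### Local modifications under the weak Gibbs property -/

section Swap

variable {V : Type*} {G : SimpleGraph V}

theorem toGraph_adj {ω : Config G} {a b : V} :
    (toGraph ω).Adj a b ↔ ∃ h : G.Adj a b, ω ⟨s(a, b), h⟩ = true := by
  simp only [toGraph, SimpleGraph.fromEdgeSet_adj, Set.mem_ofPred_eq, SimpleGraph.mem_edgeSet]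
  exact ⟨fun h => h.1, fun h => ⟨h, h.1.ne⟩⟩

theorem toGraph_le (ω : Config G) : toGraph ω ≤ G := fun _ _ h => (toGraph_adj.1 h).1

theorem inside_adj {H : Finset V} {ω : Config G} {a b : (H : Set V)} :
    (inside H ω).Adj a b ↔ (toGraph ω).Adj a b := Iff.rfl

theorem edgeInside_mk {H : Finset V} {a b : V} {h : G.Adj a b} :
    EdgeInside (G := G) H ⟨s(a, b), h⟩ ↔ a ∈ H ∧ b ∈ H := by
  simp [EdgeInside]

theorem inside_eq_iff {H : Finset V} {ω ω' : Config G} :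
    inside H ω = inside H ω' ↔ ∀ e, EdgeInside H e → ω e = ω' e := by
  constructor
  · rintro h ⟨e, he⟩ hin
    induction e using Sym2.ind with
    | _ a b =>
      have hab : G.Adj a b := he
      obtain ⟨ha, hb⟩ := edgeInside_mk.1 hin
      have h1 := congrArg (fun A : SimpleGraph (H : Set V) => A.Adj ⟨a, ha⟩ ⟨b, hb⟩) h
      simp only [inside_adj, toGraph_adj, eq_iff_iff] at h1
      rw [Bool.eq_iff_iff]
      exact ⟨fun h2 => (h1.1 ⟨hab, h2⟩).2, fun h2 => (h1.2 ⟨hab, h2⟩).2⟩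
  · intro h
    ext a b
    simp only [inside_adj, toGraph_adj]
    refine exists_congr fun hab => ?_
    rw [h _ (edgeInside_mk.2 ⟨a.2, b.2⟩)]

/-- The two configurations give spanning forests of `H` that the weak Gibbs property compares. -/
def Swappable (H : Finset V) (ω ω' : Config G) : Prop :=
  IsBdryForest G H (inside H ω) ∧ IsBdryForest G H (inside H ω') ∧
    bdryRel G H (inside H ω) = bdryRel G H (inside H ω')

variable {μ : Measure (Config G)} [IsProbabilityMeasure μ]

/-- The weak Gibbs property without conditional expectations: two forests of `H` with the same
boundary relation are equally likely, jointly with any event outside of `H`. -/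
theorem WeakGibbs.measure_inter_eq (hμ : WeakGibbs μ) {H : Finset V}
    {A A' : SimpleGraph (H : Set V)} (hA : IsBdryForest G H A) (hA' : IsBdryForest G H A')
    (hAA' : bdryRel G H A = bdryRel G H A') {D : Set ({e : G.edgeSet // ¬ EdgeInside H e} → Bool)}
    (hD : MeasurableSet D) :
    μ ({ω | inside H ω = A} ∩ outside H ⁻¹' D) = μ ({ω | inside H ω = A'} ∩ outside H ⁻¹' D) := by
  have hm := gibbsSigma_le G H
  have hDm : MeasurableSet[gibbsSigma G H] (outside H ⁻¹' D) :=
    (le_sup_left : MeasurableSpace.comap (outside H) inferInstance ≤ gibbsSigma G H) _ ⟨D, hD, rfl⟩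
  have key : ∀ B : SimpleGraph (H : Set V),
      ∫ ω in outside H ⁻¹' D, (μ⟦{ω : Config G | inside H ω = B} | gibbsSigma G H⟧) ω ∂μ =
        μ.real ({ω | inside H ω = B} ∩ outside H ⁻¹' D) := by
    intro B
    rw [setIntegral_condExp hm _ hDm]
    · rw [integral_indicator (measurableSet_inside_eq H B), Measure.restrict_restrict
        (measurableSet_inside_eq H B)]
      simp
    · exact (integrable_const 1).indicator (measurableSet_inside_eq H B)
  have h := integral_congr_ae (ae_restrict_of_ae (s := outside H ⁻¹' D) (hμ H A A' hA hA' hAA'))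
  rw [key, key] at h
  rwa [← measureReal_eq_measureReal_iff]

open Classical in
/-- Overwriting the edges of `S` by the pattern `b` does not lose mass, on configurations which
agree with a fixed pattern `a` on `S`, as long as the weak Gibbs property for `H` allows it. -/
theorem WeakGibbs.measure_swappable_le (hμ : WeakGibbs μ) {E E' : Set (Config G)}
    (hE : MeasurableSet E) (hE' : MeasurableSet E') (S : Set G.edgeSet) (a b : Config G)
    (ha : ∀ ω ∈ E, ∀ e ∈ S, ω e = a e) (hb : ∀ ω ∈ E, S.piecewise b ω ∈ E') (H : Finset V)
    (hS : ∀ e ∈ S, EdgeInside H e) :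
    μ {ω ∈ E | Swappable H ω (S.piecewise b ω)} ≤ μ E' := by
  have : Fintype (SimpleGraph (H : Set V)) := Fintype.ofFinite _
  set F := {ω ∈ E | Swappable H ω (S.piecewise b ω)} with hF
  -- the inside patterns that occur, with representatives
  let P : Finset (SimpleGraph (H : Set V)) := {A | ∃ ω ∈ F, inside H ω = A}
  have hP : ∀ A ∈ P, ∃ ω ∈ F, inside H ω = A := fun A hA => by simpa [P] using hA
  choose! rep hrepF hrep using hP
  let A' : SimpleGraph (H : Set V) → SimpleGraph (H : Set V) := fun A =>
    inside H (S.piecewise b (rep A))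
  have hinj : Set.InjOn A' P := by
    intro A₁ h₁ A₂ h₂ h
    rw [← hrep A₁ h₁, ← hrep A₂ h₂, inside_eq_iff]
    intro e he
    by_cases heS : e ∈ S
    · rw [ha _ (hrepF A₁ h₁).1 e heS, ha _ (hrepF A₂ h₂).1 e heS]
    · have := inside_eq_iff.1 h e he
      simpa [heS] using this
  have hcover : F ⊆ ⋃ A ∈ P, F ∩ {ω | inside H ω = A} := by
    intro ω hω
    simp only [Set.mem_iUnion]
    exact ⟨inside H ω, by simpa [P] using ⟨ω, hω, rfl⟩, hω, rfl⟩
  have hpiece : ∀ A ∈ P, μ (F ∩ {ω | inside H ω = A}) ≤ μ (E' ∩ {ω | inside H ω = A' A}) := by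
    intro A hA
    let glue : ({e : G.edgeSet // ¬ EdgeInside H e} → Bool) → Config G := fun o e =>
      if h : EdgeInside H e then rep A e else o ⟨e, h⟩
    have hglue : Measurable glue := by
      refine measurable_pi_lambda _ fun e => ?_
      by_cases h : EdgeInside H e
      · simp only [glue, h, dite_true]; exact measurable_const
      · simp only [glue, h, dite_false]; exact measurable_pi_apply _
    obtain ⟨-, hs1, hs2, hs3⟩ := hrepF A hA
    have h1 := hμ.measure_inter_eq hs1 hs2 hs3 (hglue hE)
    rw [hrep A hA] at h1
    calc μ (F ∩ {ω | inside H ω = A})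
        ≤ μ ({ω | inside H ω = A} ∩ outside H ⁻¹' (glue ⁻¹' E)) := by
          refine measure_mono fun ω hω => ⟨hω.2, ?_⟩
          have : glue (outside H ω) = ω := by
            funext e
            by_cases h : EdgeInside H e
            · simp only [glue, h, dite_true]
              exact inside_eq_iff.1 ((hrep A hA).trans (Set.mem_ofPred_eq ▸ hω.2).symm) e h
            · simp only [glue, h, dite_false]; rfl
          change glue (outside H ω) ∈ E
          rw [this]
          exact hω.1.1
      _ = _ := h1
      _ ≤ μ (E' ∩ {ω | inside H ω = A' A}) := by
          refine measure_mono fun ω hω => ⟨?_, hω.1⟩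
          have h2 := hb _ hω.2
          convert h2 using 1
          funext e
          have h3 := inside_eq_iff.1 (show inside H ω = inside H (S.piecewise b (rep A)) from hω.1) e
          by_cases heS : e ∈ S
          · rw [h3 (hS e heS)]
            simp [heS]
          · by_cases h : EdgeInside H e
            · rw [h3 h]
              simp [heS, glue, h]
            · simp [heS, glue, h, outside]
  calc μ F ≤ μ (⋃ A ∈ P, F ∩ {ω | inside H ω = A}) := measure_mono hcover
    _ ≤ ∑ A ∈ P, μ (F ∩ {ω | inside H ω = A}) := measure_biUnion_finset_le _ _
    _ ≤ ∑ A ∈ P, μ (E' ∩ {ω | inside H ω = A' A}) := Finset.sum_le_sum hpiece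
    _ = μ (⋃ A ∈ P, E' ∩ {ω | inside H ω = A' A}) := by
        rw [measure_biUnion_finset]
        · intro A₁ h₁ A₂ h₂ hne
          refine Set.disjoint_left.2 fun ω hω hω' => hne (hinj h₁ h₂ ?_)
          exact (show inside H ω = A' A₁ from hω.2).symm.trans hω'.2
        · exact fun A _ => hE'.inter (measurableSet_inside_eq H _)
    _ ≤ μ E' := measure_mono (Set.iUnion₂_subset fun _ _ => Set.inter_subset_left)

open Classical in
/-- Overwriting finitely many edges by the pattern `b` does not lose mass if, almost surely, the
weak Gibbs property allows the change in all large subgraphs of an exhaustion. -/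
theorem WeakGibbs.measure_le_of_eventually_swappable (hμ : WeakGibbs μ) {H : ℕ → Finset V}
    (hH : ∀ e : G.edgeSet, ∀ᶠ n in atTop, EdgeInside (H n) e) {E E' : Set (Config G)}
    (hE : MeasurableSet E) (hE' : MeasurableSet E') {S : Set G.edgeSet} (hS : S.Finite)
    (a b : Config G) (ha : ∀ ω ∈ E, ∀ e ∈ S, ω e = a e) (hb : ∀ ω ∈ E, S.piecewise b ω ∈ E')
    (hswap : ∀ᵐ ω ∂μ, ω ∈ E → ∀ᶠ n in atTop, Swappable (H n) ω (S.piecewise b ω)) :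
    μ E ≤ μ E' := by
  obtain ⟨N, hN⟩ := eventually_atTop.1 ((eventually_all_finite hS).2 fun e _ => hH e)
  let F : ℕ → Set (Config G) := fun n =>
    {ω ∈ E | ∀ m ≥ n, Swappable (H m) ω (S.piecewise b ω)}
  have hmono : Monotone F := fun n n' h ω hω => ⟨hω.1, fun m hm => hω.2 m (h.trans hm)⟩
  have h1 : μ E ≤ μ (⋃ n, F n) := by
    refine measure_mono_ae ?_
    filter_upwards [hswap] with ω hω hωE
    obtain ⟨n, hn⟩ := eventually_atTop.1 (hω hωE)
    exact Set.mem_iUnion.2 ⟨n, hωE, hn⟩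
  refine h1.trans ?_
  rw [hmono.measure_iUnion]
  refine iSup_le fun n => ?_
  refine (measure_mono ?_).trans (hμ.measure_swappable_le hE hE' S a b ha hb (H (max n N))
    (fun e he => hN _ (le_max_right _ _) e he))
  exact fun ω hω => ⟨hω.1, hω.2 _ (le_max_left _ _)⟩

end Swap

/-! ### Gluing a forest outside of a finite set to edges inside -/

section Glue

variable {V : Type*}

theorem reachable_induction {F : SimpleGraph V} {p : V → Prop} {u v : V} (h : F.Reachable u v)
    (h0 : p u) (hs : ∀ x y, p x → F.Adj x y → p y) : p v := by
  rw [SimpleGraph.reachable_iff_reflTransGen] at h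
  induction h with
  | refl => exact h0
  | tail _ hxy ih => exact hs _ _ ih hxy

theorem not_reachable_deleteEdges_of_isAcyclic {F : SimpleGraph V} (hF : F.IsAcyclic) {u w : V}
    (h : F.Adj u w) : ¬ (F.deleteEdges {s(u, w)}).Reachable u w :=
  SimpleGraph.isBridge_iff.1 (SimpleGraph.isAcyclic_iff_forall_adj_isBridge.1 hF h)

theorem isAcyclic_of_forall_not_reachable {F : SimpleGraph V}
    (h : ∀ u w, F.Adj u w → ¬ (F.deleteEdges {s(u, w)}).Reachable u w) : F.IsAcyclic :=
  SimpleGraph.isAcyclic_iff_forall_adj_isBridge.2 fun u w huw =>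
    SimpleGraph.isBridge_iff.2 (h u w huw)

variable {K : Finset V} {ι : Type*}

/-- The graph `O` together with the edges `e ∈ A`, where `e` joins the vertices `s e` and `t e`
of `K`. -/
def glue (O : SimpleGraph V) (s t : ι → (K : Set V)) (A : Finset ι) : SimpleGraph V :=
  O ⊔ SimpleGraph.fromEdgeSet {z | ∃ e ∈ A, z = s((s e : V), (t e : V))}

/-- The relation on `K` of being connected in `O`. -/
def trace (O : SimpleGraph V) (K : Finset V) : Setoid (K : Set V) :=
  O.reachableSetoid.comap Subtype.val

theorem trace_rel {O : SimpleGraph V} {x y : (K : Set V)} :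
    trace O K x y ↔ O.Reachable x y := Iff.rfl

variable {O : SimpleGraph V} {s t : ι → (K : Set V)} {A : Finset ι}

theorem glue_adj {x y : V} : (glue O s t A).Adj x y ↔
    O.Adj x y ∨ (∃ e ∈ A, s(x, y) = s((s e : V), (t e : V))) ∧ x ≠ y := by
  simp [glue]

theorem le_glue : O ≤ glue O s t A := le_sup_left

theorem glue_reachable_of_mem {e : ι} (he : e ∈ A) : (glue O s t A).Reachable (s e) (t e) := by
  by_cases h : (s e : V) = t e
  · rw [h]
  · exact (glue_adj.2 (Or.inr ⟨⟨e, he, rfl⟩, h⟩)).reachable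

/-- A path of the glued graph either stays in `O`, or enters and leaves `K` along `O`. -/
theorem glue_reachable {u z : V} (h : (glue O s t A).Reachable u z) :
    O.Reachable u z ∨ ∃ k l : (K : Set V), O.Reachable u k ∧ conn s t (trace O K) A k l ∧
      O.Reachable l z := by
  refine reachable_induction (p := fun z => O.Reachable u z ∨ ∃ k l : (K : Set V), O.Reachable u k ∧
    conn s t (trace O K) A k l ∧ O.Reachable l z) h (Or.inl .rfl) ?_
  rintro x y hx hxy
  rcases glue_adj.1 hxy with hxy | ⟨⟨e, he, hxy⟩, -⟩
  · rcases hx with hx | ⟨k, l, h1, h2, h3⟩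
    · exact Or.inl (hx.trans hxy.reachable)
    · exact Or.inr ⟨k, l, h1, h2, h3.trans hxy.reachable⟩
  · have hrel : ∃ i j : (K : Set V), (i : V) = x ∧ (j : V) = y ∧ conn s t (trace O K) A i j := by
      rcases Sym2.eq_iff.1 hxy with ⟨rfl, rfl⟩ | ⟨rfl, rfl⟩
      · exact ⟨_, _, rfl, rfl, conn_rel_of_mem _ he⟩
      · exact ⟨_, _, rfl, rfl, Setoid.symm' _ (conn_rel_of_mem _ he)⟩
    obtain ⟨i, j, rfl, rfl, hij⟩ := hrel
    rcases hx with hx | ⟨k, l, h1, h2, h3⟩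
    · exact Or.inr ⟨i, j, hx, hij, .rfl⟩
    · refine Or.inr ⟨k, j, h1, ?_, .rfl⟩
      exact Setoid.trans' _ h2 (Setoid.trans' _ (le_conn _ _ (trace_rel.2 h3)) hij)

theorem glue_reachable_iff {x y : (K : Set V)} :
    (glue O s t A).Reachable x y ↔ conn s t (trace O K) A x y := by
  constructor
  · intro h
    rcases glue_reachable h with h | ⟨k, l, h1, h2, h3⟩
    · exact le_conn _ _ (trace_rel.2 h)
    · exact Setoid.trans' _ (le_conn _ _ (trace_rel.2 h1))
        (Setoid.trans' _ h2 (le_conn _ _ (trace_rel.2 h3)))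
  · intro h
    have : conn s t (trace O K) A ≤ trace (glue O s t A) K :=
      conn_le (fun _ _ h => SimpleGraph.Reachable.mono le_glue h) fun e he => glue_reachable_of_mem he
    exact this h

theorem conn_trace_eq_top (h : ∀ x ∈ K, ∀ y ∈ K, (glue O s t A).Reachable x y) :
    conn s t (trace O K) A = ⊤ :=
  Setoid.eq_top_iff.2 fun x y => glue_reachable_iff.1 (h x x.2 y y.2)

/-- The part inside `K` of a forest in which `K` is connected is a spanning tree of `K`, wired
according to the connections outside of `K`. -/
theorem mem_bases_of_isAcyclic [DecidableEq ι] {E : Finset ι} (hAE : A ⊆ E)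
    (hK : K.Nonempty)
    (hinj : ∀ e ∈ A, ∀ f ∈ A, s((s e : V), (t e : V)) = s((s f : V), (t f : V)) → e = f)
    (hne : ∀ e ∈ A, (s e : V) ≠ t e)
    (hO : ∀ e ∈ A, ¬ O.Adj (s e) (t e)) (hac : (glue O s t A).IsAcyclic)
    (hconn : conn s t (trace O K) A = ⊤) : A ∈ bases s t (trace O K) E := by
  have hX : Nonempty (K : Set V) := hK.to_subtype
  refine mem_bases.2 ⟨hAE, hconn, ?_⟩
  rw [← numClasses_conn_of_independent (trace O K) A (s := s) (t := t), hconn, numClasses_top,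
    add_comm]
  intro e he h
  refine not_reachable_deleteEdges_of_isAcyclic hac
    (glue_adj.2 (Or.inr ⟨⟨e, he, rfl⟩, hne e he⟩)) ?_
  refine (glue_reachable_iff.2 h).mono ?_
  intro x y hxy
  rw [SimpleGraph.deleteEdges_adj, Set.mem_singleton_iff]
  rcases glue_adj.1 hxy with hxy | ⟨⟨f, hf, hxy⟩, hne'⟩
  · refine ⟨le_glue hxy, fun h' => hO e he ?_⟩
    rwa [← SimpleGraph.mem_edgeSet, ← h', SimpleGraph.mem_edgeSet]
  · refine ⟨glue_adj.2 (Or.inr ⟨⟨f, Finset.mem_of_mem_erase hf, hxy⟩, hne'⟩), fun h' => ?_⟩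
    exact Finset.ne_of_mem_erase hf (hinj f (Finset.mem_of_mem_erase hf) e he (hxy ▸ h'))

/-- Replacing the part inside `K` by another spanning tree of the wired graph keeps a forest a
forest: a cycle through an edge outside of `K` would leave too few classes for the tree. -/
theorem glue_isAcyclic_of_mem_bases [DecidableEq ι] {E : Finset ι} (hO : O.IsAcyclic)
    (hA : A ∈ bases s t (trace O K) E) : (glue O s t A).IsAcyclic := by
  refine isAcyclic_of_forall_not_reachable fun u w huw hr => ?_
  obtain ⟨-, hA1, hA2⟩ := mem_bases.1 hA
  rcases glue_adj.1 huw with huw | ⟨⟨e, he, huw⟩, hne⟩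
  · set O' := O.deleteEdges {s(u, w)} with hO'
    have hle : (glue O s t A).deleteEdges {s(u, w)} ≤ glue O' s t A := by
      intro x y hxy
      rw [SimpleGraph.deleteEdges_adj, glue_adj] at hxy
      rw [glue_adj]
      exact hxy.1.imp (fun h => SimpleGraph.deleteEdges_adj.2 ⟨h, hxy.2⟩) id
    have hnot : ¬ O'.Reachable u w := not_reachable_deleteEdges_of_isAcyclic hO huw
    have hO'O : O' ≤ O := SimpleGraph.deleteEdges_le _
    rcases glue_reachable (hr.mono hle) with h | ⟨k, l, hk, hkl, hl⟩
    · exact hnot h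
    have hnkl : ¬ trace O' K k l := fun h => hnot (hk.trans ((trace_rel.1 h).trans hl))
    have hQ : trace O K ≤ trace O' K ⊔ pairSetoid k l := by
      intro x y hxy
      obtain ⟨j, hj, hjy⟩ : ∃ j : (K : Set V), (trace O' K ⊔ pairSetoid k l) x j ∧
          O'.Reachable j y := by
        refine reachable_induction (p := fun y => ∃ j : (K : Set V),
          (trace O' K ⊔ pairSetoid k l) x j ∧ O'.Reachable j y) (trace_rel.1 hxy) ⟨x, Setoid.refl' _ x, .rfl⟩ ?_
        rintro z z' ⟨j, hj, hjz⟩ hzz'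
        by_cases heq : s(z, z') = s(u, w)
        · rcases Sym2.eq_iff.1 heq with ⟨rfl, rfl⟩ | ⟨rfl, rfl⟩
          · exact ⟨l, Setoid.trans' _ hj (Setoid.trans' _
              ((le_sup_left : trace O' K ≤ _) (trace_rel.2 (hjz.trans hk)))
              (sup_pairSetoid_rel _ k l)), hl⟩
          · exact ⟨k, Setoid.trans' _ hj (Setoid.trans' _
              ((le_sup_left : trace O' K ≤ _) (trace_rel.2 (hjz.trans hl.symm)))
              (Setoid.symm' _ (sup_pairSetoid_rel _ k l))), hk.symm⟩
        · exact ⟨j, hj, hjz.trans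
            (SimpleGraph.Adj.reachable (SimpleGraph.deleteEdges_adj.2 ⟨hzz', heq⟩))⟩
      exact Setoid.trans' _ hj ((le_sup_left : trace O' K ≤ _) (trace_rel.2 hjy))
    have htop : conn s t (trace O' K) A = ⊤ := by
      rw [← sup_pair_eq_of_rel hkl, ← conn_sup_pair]
      exact top_le_iff.1 (hA1 ▸ conn_mono hQ subset_rfl)
    have h1 := numClasses_le_conn (s := s) (t := t) (trace O' K) A
    have hX : Nonempty (K : Set V) := ⟨k⟩
    rw [htop, numClasses_top] at h1
    have hkl' : trace O K k l :=
      trace_rel.2 ((hk.mono hO'O).symm.trans (huw.reachable.trans (hl.mono hO'O).symm))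
    have h2 := numClasses_anti (sup_le (fun _ _ h => (trace_rel.1 h).mono hO'O)
      (pairSetoid_le.2 hkl') : trace O' K ⊔ pairSetoid k l ≤ trace O K)
    have h3 := numClasses_sup_pair hnkl
    omega
  · have hle : (glue O s t A).deleteEdges {s(u, w)} ≤ glue O s t (A.erase e) := by
      intro x y hxy
      rw [SimpleGraph.deleteEdges_adj, glue_adj] at hxy
      rw [glue_adj]
      refine hxy.1.imp id fun ⟨⟨f, hf, hfe⟩, hne⟩ => ⟨⟨f, Finset.mem_erase.2 ⟨?_, hf⟩, hfe⟩, hne⟩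
      rintro rfl
      exact hxy.2 (hfe.trans huw.symm)
    refine not_rel_of_mem_bases hA he (glue_reachable_iff.1 ?_)
    have h := hr.mono hle
    rcases Sym2.eq_iff.1 huw with ⟨rfl, rfl⟩ | ⟨rfl, rfl⟩
    · exact h
    · exact h.symm

theorem glue_reachable_of_conn_eq_top {A' : Finset ι} (hA' : conn s t (trace O K) A' = ⊤) {u v : V}
    (h : (glue O s t A).Reachable u v) : (glue O s t A').Reachable u v := by
  refine reachable_induction h .rfl fun x y hx hxy => hx.trans ?_
  rcases glue_adj.1 hxy with hxy | ⟨⟨e, he, hxy⟩, -⟩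
  · exact (le_glue hxy).reachable
  · have hall : ∀ i j : (K : Set V), (glue O s t A').Reachable i j := fun i j =>
      glue_reachable_iff.2 (by rw [hA']; trivial)
    rcases Sym2.eq_iff.1 hxy with ⟨rfl, rfl⟩ | ⟨rfl, rfl⟩
    · exact hall _ _
    · exact hall _ _

end Glue

/-! ### The parts of a configuration inside and outside of a finite set -/

section Inside

variable {V : Type*} {G : SimpleGraph V}

/-- The edges of the subgraph of `G` induced by `K`. -/
abbrev InsideEdge (G : SimpleGraph V) (K : Finset V) : Type _ :=
  {e : G.edgeSet // EdgeInside K e}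

/-- One endpoint of an edge inside `K`, in an arbitrary orientation. -/
noncomputable def src {K : Finset V} (e : InsideEdge G K) : (K : Set V) :=
  ⟨(Quot.out (e : G.edgeSet).1).1, e.2 _ (Sym2.out_fst_mem _)⟩

/-- The endpoint of an edge inside `K` other than `src`. -/
noncomputable def tgt {K : Finset V} (e : InsideEdge G K) : (K : Set V) :=
  ⟨(Quot.out (e : G.edgeSet).1).2, e.2 _ (Sym2.out_snd_mem _)⟩

theorem src_tgt {K : Finset V} (e : InsideEdge G K) :
    s((src e : V), (tgt e : V)) = (e : G.edgeSet).1 := Quot.out_eq _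

theorem adj_src_tgt {K : Finset V} (e : InsideEdge G K) : G.Adj (src e) (tgt e) := by
  rw [← SimpleGraph.mem_edgeSet, src_tgt]
  exact e.1.2

instance finite_insideEdge (K : Finset V) : Finite (InsideEdge G K) := by
  refine Finite.of_injective (fun e => (src e, tgt e)) fun e f h => ?_
  obtain ⟨h1, h2⟩ := Prod.mk.inj h
  have h3 := src_tgt e
  rw [h1, h2, src_tgt] at h3
  exact Subtype.ext (Subtype.ext h3.symm)

noncomputable instance fintypeInsideEdge (K : Finset V) : Fintype (InsideEdge G K) :=
  Fintype.ofFinite _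

noncomputable instance decidableEqInsideEdge (K : Finset V) : DecidableEq (InsideEdge G K) :=
  Classical.decEq _

/-- The open edges inside `K`. -/
noncomputable def insideEdges (K : Finset V) (ω : Config G) : Finset (InsideEdge G K) :=
  {e | ω e = true}

theorem mem_insideEdges {K : Finset V} {ω : Config G} {e : InsideEdge G K} :
    e ∈ insideEdges K ω ↔ ω e = true := by simp [insideEdges]

open Classical in
/-- The configuration with all edges inside `K` closed. -/
noncomputable def outer (K : Finset V) (ω : Config G) : Config G :=
  fun e => if EdgeInside K e then false else ω e

open Classical in
/-- The configuration whose open edges are those of `A`. -/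
noncomputable def pattern {K : Finset V} (A : Finset (InsideEdge G K)) : Config G :=
  fun e => decide (∃ h : EdgeInside K e, (⟨e, h⟩ : InsideEdge G K) ∈ A)

open Classical in
/-- The configuration with the part inside `K` replaced by `A`. -/
noncomputable def setInside {K : Finset V} (A : Finset (InsideEdge G K)) (ω : Config G) :
    Config G :=
  Set.piecewise {e | EdgeInside K e} (pattern A) ω

/-- The connections between vertices of `K` through open edges that are not inside `K`. -/
noncomputable def outerRel (K : Finset V) (ω : Config G) : Setoid (K : Set V) :=
  trace (toGraph (outer K ω)) K

open Classical in
/-- The configuration with all edges that are not inside `H` closed. -/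
noncomputable def restrict (H : Finset V) (ω : Config G) : Config G :=
  fun e => if EdgeInside H e then ω e else false

theorem pattern_of_mem {K : Finset V} {A : Finset (InsideEdge G K)} (e : InsideEdge G K) :
    pattern A e = true ↔ e ∈ A := by
  simp [pattern, e.2]

theorem setInside_of_inside {K : Finset V} {A : Finset (InsideEdge G K)} {ω : Config G}
    {e : G.edgeSet} (h : EdgeInside K e) : setInside A ω e = pattern A e := by
  simp [setInside, h]

theorem setInside_of_not_inside {K : Finset V} {A : Finset (InsideEdge G K)} {ω : Config G}
    {e : G.edgeSet} (h : ¬ EdgeInside K e) : setInside A ω e = ω e := by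
  simp [setInside, h]

theorem insideEdges_setInside {K : Finset V} (A : Finset (InsideEdge G K)) (ω : Config G) :
    insideEdges K (setInside A ω) = A := by
  ext e
  rw [mem_insideEdges, setInside_of_inside e.2, pattern_of_mem]

theorem outer_setInside {K : Finset V} (A : Finset (InsideEdge G K)) (ω : Config G) :
    outer K (setInside A ω) = outer K ω := by
  funext e
  by_cases h : EdgeInside K e
  · simp [outer, h]
  · simp [outer, h, setInside_of_not_inside h]

theorem outerRel_setInside {K : Finset V} (A : Finset (InsideEdge G K)) (ω : Config G) :
    outerRel K (setInside A ω) = outerRel K ω := by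
  rw [outerRel, outer_setInside, outerRel]

theorem setInside_insideEdges (K : Finset V) (ω : Config G) :
    setInside (insideEdges K ω) ω = ω := by
  funext e
  by_cases h : EdgeInside K e
  · rw [setInside_of_inside h, Bool.eq_iff_iff, pattern_of_mem ⟨e, h⟩, mem_insideEdges]
  · rw [setInside_of_not_inside h]

theorem setInside_setInside {K : Finset V} (A B : Finset (InsideEdge G K)) (ω : Config G) :
    setInside A (setInside B ω) = setInside A ω := by
  funext e
  by_cases h : EdgeInside K e
  · rw [setInside_of_inside h, setInside_of_inside h]
  · rw [setInside_of_not_inside h, setInside_of_not_inside h, setInside_of_not_inside h]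

theorem restrict_setInside {K H : Finset V} (hKH : K ⊆ H) (A : Finset (InsideEdge G K))
    (ω : Config G) : restrict H (setInside A ω) = setInside A (restrict H ω) := by
  funext e
  by_cases h : EdgeInside K e
  · have : EdgeInside H e := fun v hv => hKH (h v hv)
    simp [restrict, this, setInside_of_inside h]
  · simp [restrict, setInside_of_not_inside h]

theorem outer_le {K : Finset V} {ω : Config G} {e : G.edgeSet} (h : outer K ω e = true) :
    ω e = true := by
  by_cases h' : EdgeInside K e <;> simp_all [outer]

theorem toGraph_mono {ω ω' : Config G} (h : ∀ e, ω e = true → ω' e = true) :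
    toGraph ω ≤ toGraph ω' := fun _ _ hab =>
  toGraph_adj.2 ⟨(toGraph_adj.1 hab).1, h _ (toGraph_adj.1 hab).2⟩

theorem restrict_le {H : Finset V} {ω : Config G} : toGraph (restrict H ω) ≤ toGraph ω :=
  toGraph_mono fun e h => by
    by_cases h' : EdgeInside H e <;> simp_all [restrict]

theorem toGraph_eq_glue (K : Finset V) (ω : Config G) :
    toGraph ω = glue (toGraph (outer K ω)) src tgt (insideEdges K ω) := by
  ext a b
  rw [glue_adj]
  constructor
  · intro h
    obtain ⟨hab, h⟩ := toGraph_adj.1 h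
    by_cases hin : EdgeInside K (⟨s(a, b), hab⟩ : G.edgeSet)
    · exact Or.inr ⟨⟨⟨_, hin⟩, mem_insideEdges.2 h, (src_tgt ⟨_, hin⟩).symm⟩, hab.ne⟩
    · refine Or.inl (toGraph_adj.2 ⟨hab, ?_⟩)
      simpa [outer, hin] using h
  · rintro (h | ⟨⟨e, he, hab⟩, hne⟩)
    · obtain ⟨hab, h⟩ := toGraph_adj.1 h
      exact toGraph_adj.2 ⟨hab, outer_le h⟩
    · rw [src_tgt] at hab
      have hadj : G.Adj a b := by
        rw [← SimpleGraph.mem_edgeSet, hab]; exact e.1.2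
      refine toGraph_adj.2 ⟨hadj, ?_⟩
      have : (⟨s(a, b), hadj⟩ : G.edgeSet) = e := Subtype.ext hab
      rw [this]
      exact mem_insideEdges.1 he

theorem toGraph_setInside {K : Finset V} (A : Finset (InsideEdge G K)) (ω : Config G) :
    toGraph (setInside A ω) = glue (toGraph (outer K ω)) src tgt A := by
  rw [toGraph_eq_glue K, outer_setInside, insideEdges_setInside]

theorem insideEdges_mem_bases {K : Finset V} (hK : K.Nonempty) {ω : Config G}
    (hac : (toGraph ω).IsAcyclic) (hconn : ∀ x ∈ K, ∀ y ∈ K, (toGraph ω).Reachable x y) :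
    insideEdges K ω ∈ bases src tgt (outerRel K ω) Finset.univ := by
  have h := toGraph_eq_glue K ω
  refine mem_bases_of_isAcyclic (Finset.subset_univ _) hK ?_ (fun e _ => (adj_src_tgt e).ne) ?_
    (h ▸ hac) (conn_trace_eq_top (by rw [← h]; exact hconn))
  · intro e _ f _ hef
    rw [src_tgt, src_tgt] at hef
    exact Subtype.ext (Subtype.ext hef)
  · intro e _ hadj
    obtain ⟨h1, h2⟩ := toGraph_adj.1 hadj
    have : (⟨s((src e : V), (tgt e : V)), h1⟩ : G.edgeSet) = e := Subtype.ext (src_tgt e)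
    rw [this] at h2
    simp [outer, e.2] at h2

theorem isAcyclic_setInside {K : Finset V} {ω : Config G} (hac : (toGraph ω).IsAcyclic)
    {A : Finset (InsideEdge G K)} (hA : A ∈ bases src tgt (outerRel K ω) Finset.univ) :
    (toGraph (setInside A ω)).IsAcyclic := by
  rw [toGraph_setInside]
  exact glue_isAcyclic_of_mem_bases (hac.anti (toGraph_mono fun e => outer_le)) hA

theorem reachable_setInside_iff {K : Finset V} {ω : Config G}
    (hconn : ∀ x ∈ K, ∀ y ∈ K, (toGraph ω).Reachable x y)
    {A : Finset (InsideEdge G K)} (hA : A ∈ bases src tgt (outerRel K ω) Finset.univ) {u v : V} :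
    (toGraph (setInside A ω)).Reachable u v ↔ (toGraph ω).Reachable u v := by
  rw [toGraph_setInside]
  have h := toGraph_eq_glue K ω
  constructor
  · intro h1
    rw [h]
    refine glue_reachable_of_conn_eq_top (conn_trace_eq_top ?_) h1
    rw [← h]
    exact hconn
  · intro h1
    rw [h] at h1
    exact glue_reachable_of_conn_eq_top (mem_bases.1 hA).2.1 h1

theorem inside_reachable_iff {H : Finset V} {ω : Config G} {a b : (H : Set V)} :
    (inside H ω).Reachable a b ↔ (toGraph (restrict H ω)).Reachable a b := by
  have hadj : ∀ {x y : V}, (toGraph (restrict H ω)).Adj x y ↔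
      (toGraph ω).Adj x y ∧ x ∈ H ∧ y ∈ H := by
    intro x y
    rw [toGraph_adj, toGraph_adj]
    constructor
    · rintro ⟨h1, h2⟩
      by_cases h : EdgeInside H (⟨s(x, y), h1⟩ : G.edgeSet)
      · simp only [restrict, h, if_true] at h2
        exact ⟨⟨h1, h2⟩, edgeInside_mk.1 h⟩
      · simp [restrict, h] at h2
    · rintro ⟨⟨h1, h2⟩, h3⟩
      exact ⟨h1, by simpa [restrict, edgeInside_mk.2 h3] using h2⟩
  constructor
  · intro h
    refine reachable_induction (p := fun z : (H : Set V) =>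
      (toGraph (restrict H ω)).Reachable a z) h .rfl ?_
    intro x y hx hxy
    exact hx.trans (hadj.2 ⟨hxy, x.2, y.2⟩).reachable
  · intro h
    obtain ⟨hb, h⟩ := reachable_induction (p := fun z => ∃ hz : z ∈ H,
      (inside H ω).Reachable a ⟨z, hz⟩) h ⟨a.2, .rfl⟩ (by
        rintro x y ⟨hx, hax⟩ hxy
        obtain ⟨h1, -, hy⟩ := hadj.1 hxy
        exact ⟨hy, hax.trans (SimpleGraph.Adj.reachable (inside_adj.2 h1))⟩)
    exact h

theorem isAcyclic_of_induce {F : SimpleGraph V} {K : Set V}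
    (hF : ∀ x y, F.Adj x y → x ∈ K ∧ y ∈ K) (hac : (F.induce K).IsAcyclic) : F.IsAcyclic := by
  refine isAcyclic_of_forall_not_reachable fun u w huw hr => ?_
  obtain ⟨hu, hw⟩ := hF u w huw
  refine not_reachable_deleteEdges_of_isAcyclic hac (u := ⟨u, hu⟩) (w := ⟨w, hw⟩) huw ?_
  obtain ⟨_, h⟩ := reachable_induction (p := fun z => ∃ hz : z ∈ K,
    ((F.induce K).deleteEdges {s(⟨u, hu⟩, ⟨w, hw⟩)}).Reachable ⟨u, hu⟩ ⟨z, hz⟩) hr ⟨hu, .rfl⟩ (by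
      rintro x y ⟨hx, hux⟩ hxy
      rw [SimpleGraph.deleteEdges_adj] at hxy
      refine ⟨(hF _ _ hxy.1).2, hux.trans (SimpleGraph.Adj.reachable ?_)⟩
      rw [SimpleGraph.deleteEdges_adj]
      refine ⟨hxy.1, fun h => hxy.2 ?_⟩
      have := congrArg (Sym2.map Subtype.val) (Set.mem_singleton_iff.1 h)
      simpa using this)
  exact h

theorem mem_spanningTrees_iff {K : Finset V} {ω : Config G} :
    ω ∈ spanningTrees G K ↔ (∀ e, ω e = true → EdgeInside K e) ∧ (toGraph ω).IsAcyclic ∧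
      K.Nonempty ∧ ∀ x ∈ K, ∀ y ∈ K, (toGraph ω).Reachable x y := by
  refine and_congr_right fun h => ?_
  have hr : restrict K ω = ω := by
    funext e
    by_cases he : EdgeInside K e
    · simp [restrict, he]
    · have : ω e = false := by
        rw [← Bool.not_eq_true]; exact fun h' => he (h e h')
      simp [restrict, he, this]
  constructor
  · intro hT
    refine ⟨isAcyclic_of_induce (K := (K : Set V)) ?_ hT.2, ?_, ?_⟩
    · intro x y hxy
      obtain ⟨h1, h2⟩ := toGraph_adj.1 hxy
      exact edgeInside_mk.1 (h _ h2)
    · obtain ⟨x⟩ := hT.1.nonempty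
      exact ⟨x, x.2⟩
    · intro x hx y hy
      have := hT.1.preconnected ⟨x, hx⟩ ⟨y, hy⟩
      rwa [inside_reachable_iff, hr] at this
  · rintro ⟨h1, ⟨x, hx⟩, h2⟩
    have : Nonempty (K : Set V) := ⟨x, hx⟩
    refine ⟨⟨fun x y => ?_⟩, h1.induce _⟩
    rw [inside_reachable_iff, hr]
    exact h2 x x.2 y y.2

end Inside

/-! ### Measurability of connection events -/

section ConnectionMeasurability

variable {V : Type*} [Countable V] {G : SimpleGraph V}

theorem measurableSet_reachable (a b : V) :
    MeasurableSet {ω : Config G | (toGraph ω).Reachable a b} := by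
  let R : ℕ → V → Set (Config G) := fun n => n.rec (fun b => {_ω | a = b})
    fun _ P b => ⋃ c, P c ∩ {ω | (toGraph ω).Adj c b}
  have hR : ∀ n b, MeasurableSet (R n b) := by
    intro n
    induction n with
    | zero => exact fun b => MeasurableSet.const _
    | succ n ih => exact fun b => MeasurableSet.iUnion fun c => (ih c).inter (measurableSet_adj c b)
  have : {ω : Config G | (toGraph ω).Reachable a b} = ⋃ n, R n b := by
    ext ω
    simp only [Set.mem_ofPred_eq, Set.mem_iUnion]
    constructor
    · intro h
      refine reachable_induction (p := fun z => ∃ n, ω ∈ R n z) h ⟨0, rfl⟩ ?_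
      rintro x y ⟨n, hn⟩ hxy
      exact ⟨n + 1, Set.mem_iUnion.2 ⟨x, hn, hxy⟩⟩
    · rintro ⟨n, hn⟩
      induction n generalizing b with
      | zero =>
        have : a = b := hn
        rw [this]
      | succ n ih =>
        obtain ⟨c, hc, hcb⟩ := Set.mem_iUnion.1 hn
        exact (ih c hc).trans (SimpleGraph.Adj.reachable hcb)
  rw [this]
  exact MeasurableSet.iUnion fun n => hR n b

omit [Countable V] in
theorem measurable_outer (K : Finset V) : Measurable (outer (G := G) K) := by
  refine measurable_pi_lambda _ fun e => ?_
  by_cases h : EdgeInside K e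
  · simp only [outer, h, if_true]; exact measurable_const
  · simp only [outer, h, if_false]; exact measurable_pi_apply _

theorem measurableSet_outerRel_eq (K : Finset V) (q : Setoid (K : Set V)) :
    MeasurableSet {ω : Config G | outerRel K ω = q} := by
  have : {ω : Config G | outerRel K ω = q} = ⋂ x : (K : Set V), ⋂ y : (K : Set V),
      {ω : Config G | (toGraph (outer K ω)).Reachable x y ↔ q x y} := by
    ext ω
    simp only [Set.mem_ofPred_eq, Set.mem_iInter, Setoid.ext_iff]
    rfl
  rw [this]
  exact MeasurableSet.iInter fun x => MeasurableSet.iInter fun y =>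
    MeasurableSet.iff (show MeasurableSet {ω : Config G | (toGraph (outer K ω)).Reachable x y} from
      (measurable_outer K) (measurableSet_reachable (x : V) (y : V))) (MeasurableSet.const _)

omit [Countable V] in
theorem measurableSet_edge (e : G.edgeSet) : MeasurableSet {ω : Config G | ω e = true} :=
  measurableSet_eq_fun (measurable_pi_apply e) measurable_const

omit [Countable V] in
theorem measurableSet_insideEdges_eq (K : Finset V) (A : Finset (InsideEdge G K)) :
    MeasurableSet {ω : Config G | insideEdges K ω = A} := by
  have : {ω : Config G | insideEdges K ω = A} = ⋂ e : InsideEdge G K,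
      {ω : Config G | ω e = true ↔ e ∈ A} := by
    ext ω
    simp only [Set.mem_ofPred_eq, Set.mem_iInter, Finset.ext_iff, mem_insideEdges]
  rw [this]
  exact MeasurableSet.iInter fun e => (measurableSet_edge _).iff (MeasurableSet.const _)

end ConnectionMeasurability

/-! ### Gibbs measures on spanning trees -/

section TreeGibbs

variable {V : Type*} {G : SimpleGraph V}

theorem IsExhaustion.eventually_subset {H : ℕ → Finset V} (hH : IsExhaustion G H) (K : Finset V) :
    ∀ᶠ n in atTop, K ⊆ H n := by
  have h1 : ∀ v, ∀ᶠ n in atTop, v ∈ H n := fun v => by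
    obtain ⟨n, hn⟩ := hH.exhausts v
    exact eventually_atTop.2 ⟨n, fun m hm => hH.mono hm hn⟩
  exact (eventually_all_finset K).2 fun v _ => h1 v

theorem IsExhaustion.eventually_edgeInside {H : ℕ → Finset V} (hH : IsExhaustion G H)
    (e : G.edgeSet) : ∀ᶠ n in atTop, EdgeInside (H n) e := by
  classical
  filter_upwards [hH.eventually_subset (e : Sym2 V).toFinset] with n hn v hv
  exact hn (Sym2.mem_toFinset.2 hv)

theorem IsExhaustion.eventually_reachable {H : ℕ → Finset V} (hH : IsExhaustion G H)
    {ω : Config G} {x y : V} (h : (toGraph ω).Reachable x y) :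
    ∀ᶠ n in atTop, (toGraph (restrict (H n) ω)).Reachable x y := by
  refine reachable_induction (p := fun z => ∀ᶠ n in atTop,
    (toGraph (restrict (H n) ω)).Reachable x z) h (Eventually.of_forall fun _ => .rfl) ?_
  intro z z' hz hzz'
  obtain ⟨h1, h2⟩ := toGraph_adj.1 hzz'
  filter_upwards [hz, hH.eventually_edgeInside ⟨s(z, z'), h1⟩] with n hn he
  refine hn.trans (SimpleGraph.Adj.reachable (toGraph_adj.2 ⟨h1, ?_⟩))
  simp [restrict, he, h2]

/-- A spanning forest with infinite components restricts to a forest each of whose components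
meets the boundary. -/
theorem IsEssentialSpanningForest.isBdryForest_inside {ω : Config G}
    (hω : IsEssentialSpanningForest (toGraph ω)) (H : Finset V) :
    IsBdryForest G H (inside H ω) := by
  refine ⟨fun a b h => toGraph_le ω h, hω.1.induce _, fun c => ?_⟩
  induction c using SimpleGraph.ConnectedComponent.ind with
  | _ v =>
    by_contra! hcon
    refine hω.2 ((toGraph ω).connectedComponentMk v) ((H.finite_toSet).subset ?_)
    intro z hz
    have hz : (toGraph ω).Reachable v z := (SimpleGraph.ConnectedComponent.exact hz).symm
    obtain ⟨hzH, -⟩ := reachable_induction (p := fun z => ∃ hz : z ∈ H,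
      (inside H ω).Reachable v ⟨z, hz⟩) hz ⟨v.2, .rfl⟩ (by
        rintro x y ⟨hx, hvx⟩ hxy
        by_cases hy : y ∈ H
        · exact ⟨hy, hvx.trans (SimpleGraph.Adj.reachable (inside_adj.2 hxy))⟩
        · exact absurd ⟨hx, y, hy, toGraph_le ω hxy⟩
            (hcon ⟨x, hx⟩ (SimpleGraph.ConnectedComponent.sound hvx.symm)))
    exact hzH

theorem isEssentialSpanningForest_of_isTree [Infinite V] {F : SimpleGraph V} (hF : F.IsTree) :
    IsEssentialSpanningForest F := by
  refine ⟨hF.2, fun c => ?_⟩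
  have : c.supp = Set.univ := by
    induction c using SimpleGraph.ConnectedComponent.ind with
    | _ v =>
      exact Set.eq_univ_of_forall fun w => SimpleGraph.ConnectedComponent.sound
        (hF.1.preconnected w v)
  rw [this]
  exact Set.infinite_univ

/-- The measure `ν` gives, conditionally on the configuration outside of `K`, the uniform spanning
tree of `K` with the wiring induced by the outside. -/
structure TreeGibbs (ν : Measure (Config G)) (K : Finset V) : Prop where
  mem_bases : ∀ᵐ ω ∂ν, insideEdges K ω ∈ bases src tgt (outerRel K ω) Finset.univ
  measure_le : ∀ (q : Setoid (K : Set V)), ∀ A ∈ bases src tgt q Finset.univ,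
    ∀ A' ∈ bases src tgt q Finset.univ,
      ν {ω | insideEdges K ω = A ∧ outerRel K ω = q} ≤
        ν {ω | insideEdges K ω = A' ∧ outerRel K ω = q}

/-- Replacing the part of a tree inside `K` by another spanning tree of the wired graph `K` is a
modification that the weak Gibbs property allows in every large subgraph. -/
theorem eventually_swappable_setInside [Infinite V] {H : ℕ → Finset V} (hH : IsExhaustion G H)
    {K : Finset V} {ω : Config G} (hω : (toGraph ω).IsTree) {A : Finset (InsideEdge G K)}
    (hA : A ∈ bases src tgt (outerRel K ω) Finset.univ) :
    ∀ᶠ n in atTop, Swappable (H n) ω (setInside A ω) := by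
  have hconn : ∀ x ∈ K, ∀ y ∈ K, (toGraph ω).Reachable x y := fun x _ y _ =>
    hω.1.preconnected x y
  have htree : (toGraph (setInside A ω)).IsTree := by
    have : Nonempty V := hω.1.nonempty
    refine ⟨⟨fun x y => ?_⟩, isAcyclic_setInside hω.2 hA⟩
    exact (reachable_setInside_iff hconn hA).2 (hω.1.preconnected x y)
  have houter : ∀ n, K ⊆ H n → outer K (restrict (H n) ω) = restrict (H n) (outer K ω) := by
    intro n _
    funext e
    by_cases h1 : EdgeInside K e <;> by_cases h2 : EdgeInside (H n) e <;>
      simp [outer, restrict, h1, h2]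
  have h1 : ∀ᶠ n in atTop, ∀ x y : (K : Set V), (toGraph (restrict (H n) ω)).Reachable x y :=
    eventually_all.2 fun x => eventually_all.2 fun y =>
      hH.eventually_reachable (hconn x x.2 y y.2)
  have h2 : ∀ᶠ n in atTop, ∀ x y : (K : Set V), outerRel K ω x y →
      (toGraph (restrict (H n) (outer K ω))).Reachable x y := by
    refine eventually_all.2 fun x => eventually_all.2 fun y => ?_
    by_cases hxy : outerRel K ω x y
    · filter_upwards [hH.eventually_reachable (trace_rel.1 hxy)] with n hn _ using hn
    · exact Eventually.of_forall fun n h => absurd h hxy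
  filter_upwards [h1, h2, hH.eventually_subset K] with n h1 h2 hK
  refine ⟨(isEssentialSpanningForest_of_isTree hω).isBdryForest_inside _,
    (isEssentialSpanningForest_of_isTree htree).isBdryForest_inside _, ?_⟩
  have hrel : outerRel K (restrict (H n) ω) = outerRel K ω := by
    ext x y
    rw [outerRel, houter n hK, trace_rel]
    exact ⟨fun h => trace_rel.2 (h.mono restrict_le), fun h => h2 x y h⟩
  funext a b
  rw [bdryRel, bdryRel, inside_reachable_iff, inside_reachable_iff, restrict_setInside hK,
    reachable_setInside_iff (fun x hx y hy => h1 ⟨x, hx⟩ ⟨y, hy⟩) (hrel ▸ hA)]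

/-- For a measure supported on spanning trees, the weak Gibbs property implies the full one. -/
theorem WeakGibbs.treeGibbs [Countable V] [Infinite V] {μ : Measure (Config G)}
    [IsProbabilityMeasure μ] (hμ : WeakGibbs μ) {H : ℕ → Finset V} (hH : IsExhaustion G H)
    (htree : ∀ᵐ ω ∂μ, (toGraph ω).IsTree) {K : Finset V} (hK : K.Nonempty) : TreeGibbs μ K := by
  refine ⟨?_, fun q A hA A' hA' => ?_⟩
  · filter_upwards [htree] with ω hω
    exact insideEdges_mem_bases hK hω.2 fun x _ y _ => hω.1.preconnected x y
  · refine hμ.measure_le_of_eventually_swappable hH.eventually_edgeInside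
      ((measurableSet_insideEdges_eq K A).inter (measurableSet_outerRel_eq K q))
      ((measurableSet_insideEdges_eq K A').inter (measurableSet_outerRel_eq K q))
      (S := {e | EdgeInside K e}) ?_ (pattern A) (pattern A') ?_ ?_ ?_
    · exact Set.finite_coe_iff.1 (finite_insideEdge (G := G) K)
    · rintro ω ⟨h1, -⟩ e he
      rw [← show insideEdges K ω = A from h1, ← setInside_of_inside (ω := ω) he,
        setInside_insideEdges]
    · rintro ω ⟨h1, h2⟩
      exact ⟨insideEdges_setInside A' ω, (outerRel_setInside A' ω).trans h2⟩
    · filter_upwards [htree] with ω hω hωE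
      exact eventually_swappable_setInside hH hω
        ((show outerRel K ω = q from hωE.2) ▸ hA')

/-- The uniform spanning tree on `K'` is Gibbs on smaller vertex sets. -/
theorem treeGibbs_uniformSpanningTree [Countable V] {K K' : Finset V} (hKK' : K ⊆ K')
    (hK : K.Nonempty) (hK' : (G.induce (K' : Set V)).Connected) :
    TreeGibbs (uniformSpanningTree G K' hK' : Measure (Config G)) K := by
  classical
  have hfin := spanningTrees_finite G K'
  have hν : (uniformSpanningTree G K' hK' : Measure (Config G)) =
      uniformOn (spanningTrees G K') := rfl
  rw [hν]
  refine ⟨?_, fun q A hA A' hA' => ?_⟩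
  · have h1 : ∀ᵐ ω ∂(uniformOn (spanningTrees G K')), ω ∈ spanningTrees G K' :=
      ae_cond_mem hfin.measurableSet
    filter_upwards [h1] with ω hω
    obtain ⟨-, h2, -, h3⟩ := mem_spanningTrees_iff.1 hω
    exact insideEdges_mem_bases hK h2 fun x hx y hy => h3 x (hKK' hx) y (hKK' hy)
  · rw [uniformOn, cond_apply hfin.measurableSet, cond_apply hfin.measurableSet]
    gcongr 1
    · set E := spanningTrees G K' ∩ {ω | insideEdges K ω = A ∧ outerRel K ω = q}
      set E' := spanningTrees G K' ∩ {ω | insideEdges K ω = A' ∧ outerRel K ω = q}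
      have hE : E.Finite := hfin.subset Set.inter_subset_left
      have hE' : E'.Finite := hfin.subset Set.inter_subset_left
      rw [Measure.count_apply_finite _ hE, Measure.count_apply_finite _ hE', Nat.cast_le]
      refine Finset.card_le_card_of_injOn (setInside A') ?_ ?_
      · intro ω hω
        rw [Set.Finite.coe_toFinset] at hω ⊢
        obtain ⟨hT, hA1, hq⟩ := hω
        obtain ⟨h1, h2, h3, h4⟩ := mem_spanningTrees_iff.1 hT
        have hA'' : A' ∈ bases src tgt (outerRel K ω) Finset.univ := hq ▸ hA'
        refine ⟨mem_spanningTrees_iff.2 ⟨?_, isAcyclic_setInside h2 hA'', h3, ?_⟩,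
          insideEdges_setInside A' ω, (outerRel_setInside A' ω).trans hq⟩
        · intro e he
          by_cases hin : EdgeInside K e
          · exact fun v hv => hKK' (hin v hv)
          · rw [setInside_of_not_inside hin] at he
            exact h1 e he
        · intro x hx y hy
          exact (reachable_setInside_iff (fun x hx y hy => h4 x (hKK' hx) y (hKK' hy)) hA'').2
            (h4 x hx y hy)
      · intro ω hω ω' hω' h
        rw [Set.Finite.coe_toFinset] at hω hω'
        rw [← setInside_insideEdges K ω, ← setInside_insideEdges K ω',
          show insideEdges K ω = A from hω.2.1, show insideEdges K ω' = A from hω'.2.1,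
          ← setInside_setInside A A' ω, h, setInside_setInside]

/-- For the uniform spanning tree of `K` there is no wiring of `K` from the outside. -/
theorem outerRel_uniformSpanningTree [Countable V] {K : Finset V}
    (hK : (G.induce (K : Set V)).Connected) :
    ∀ᵐ ω ∂(uniformSpanningTree G K hK : Measure (Config G)), outerRel K ω = ⊥ := by
  have h1 : ∀ᵐ ω ∂(uniformOn (spanningTrees G K)), ω ∈ spanningTrees G K :=
    ae_cond_mem (spanningTrees_finite G K).measurableSet
  filter_upwards [h1] with ω hω
  have h2 : ∀ e, ω e = true → EdgeInside K e := hω.1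
  have h3 : toGraph (outer K ω) = ⊥ := by
    refine le_bot_iff.1 fun x y hxy => ?_
    obtain ⟨h4, h5⟩ := toGraph_adj.1 hxy
    have := h2 _ (outer_le h5)
    simp [outer, this] at h5
  ext x y
  rw [outerRel, trace_rel, h3, SimpleGraph.reachable_bot]
  exact Subtype.ext_iff.symm

/-- The average of `f` over the spanning trees of the subgraph induced by `K`. -/
noncomputable def treeAverage (G : SimpleGraph V) (K : Finset V)
    (f : Finset (InsideEdge G K) → ℝ) : ℝ :=
  (∑ A ∈ bases src tgt ⊥ Finset.univ, f A) / (bases (src (G := G) (K := K)) tgt ⊥ Finset.univ).card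

instance finite_setoid {X : Type*} [Finite X] : Finite (Setoid X) :=
  Finite.of_injective (fun q : Setoid X => fun x y => q x y) fun q q' h => by
    ext x y; exact iff_of_eq (congrFun (congrFun h x) y)

theorem integral_insideEdges [Countable V] {ν : Measure (Config G)} [IsProbabilityMeasure ν]
    (K : Finset V) (f : Finset (InsideEdge G K) → ℝ) [Fintype (Setoid (K : Set V))] :
    ∫ ω, f (insideEdges K ω) ∂ν = ∑ q : Setoid (K : Set V), ∑ A : Finset (InsideEdge G K),
      f A * ν.real {ω | insideEdges K ω = A ∧ outerRel K ω = q} := by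
  classical
  have hmeas : ∀ q A, MeasurableSet {ω : Config G | insideEdges K ω = A ∧ outerRel K ω = q} :=
    fun q A => (measurableSet_insideEdges_eq K A).inter (measurableSet_outerRel_eq K q)
  have h1 : ∀ ω : Config G, f (insideEdges K ω) = ∑ q : Setoid (K : Set V),
      ∑ A : Finset (InsideEdge G K),
        {ω | insideEdges K ω = A ∧ outerRel K ω = q}.indicator (fun _ => f A) ω := by
    intro ω
    rw [Finset.sum_eq_single (outerRel K ω), Finset.sum_eq_single (insideEdges K ω)]
    · rw [Set.indicator_of_mem]; exact ⟨rfl, rfl⟩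
    · intro A _ hA
      exact Set.indicator_of_notMem (fun h => hA h.1.symm) _
    · simp
    · intro q _ hq
      exact Finset.sum_eq_zero fun A _ => Set.indicator_of_notMem (fun h => hq h.2.symm) _
    · simp
  rw [integral_congr_ae (Eventually.of_forall h1), integral_finsetSum]
  · refine Finset.sum_congr rfl fun q _ => ?_
    rw [integral_finsetSum]
    · refine Finset.sum_congr rfl fun A _ => ?_
      rw [integral_indicator_const _ (hmeas q A), smul_eq_mul, mul_comm]
    · exact fun A _ => (integrable_const _).indicator (hmeas q A)
  · exact fun q _ => integrable_finsetSum _ fun A _ =>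
      (integrable_const _).indicator (hmeas q A)

/-- Given the wiring `q`, the part inside `K` is uniformly distributed on the spanning trees; `m` is
the common mass of these. -/
theorem TreeGibbs.sum_eq {ν : Measure (Config G)} [IsProbabilityMeasure ν] {K : Finset V}
    (hν : TreeGibbs ν K) (q : Setoid (K : Set V)) :
    ∃ m : ℝ, 0 ≤ m ∧ ∀ f : Finset (InsideEdge G K) → ℝ, ∑ A : Finset (InsideEdge G K),
      f A * ν.real {ω | insideEdges K ω = A ∧ outerRel K ω = q} =
        (∑ A ∈ bases src tgt q Finset.univ, f A) * m := by
  classical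
  have h0 : ∀ A ∉ bases src tgt q Finset.univ,
      ν.real {ω | insideEdges K ω = A ∧ outerRel K ω = q} = 0 := by
    intro A hA
    rw [measureReal_eq_zero_iff]
    refine measure_mono_null ?_ (ae_iff.1 hν.mem_bases)
    rintro ω ⟨rfl, rfl⟩
    exact hA
  have h1 : ∀ f : Finset (InsideEdge G K) → ℝ, ∑ A : Finset (InsideEdge G K),
      f A * ν.real {ω | insideEdges K ω = A ∧ outerRel K ω = q} =
        ∑ A ∈ bases src tgt q Finset.univ,
          f A * ν.real {ω | insideEdges K ω = A ∧ outerRel K ω = q} := fun f =>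
    (Finset.sum_subset (Finset.subset_univ _) fun A _ hA => by rw [h0 A hA, mul_zero]).symm
  rcases (bases (src (G := G) (K := K)) tgt q Finset.univ).eq_empty_or_nonempty with h | ⟨A₀, hA₀⟩
  · refine ⟨0, le_rfl, fun f => ?_⟩
    rw [h1, h]
    simp
  · refine ⟨ν.real {ω | insideEdges K ω = A₀ ∧ outerRel K ω = q}, measureReal_nonneg,
      fun f => ?_⟩
    rw [h1, Finset.sum_mul]
    refine Finset.sum_congr rfl fun A hA => ?_
    congr 1
    exact congrArg ENNReal.toReal
      (le_antisymm (hν.measure_le q A hA A₀ hA₀) (hν.measure_le q A₀ hA₀ A hA))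

theorem bases_bot_nonempty [Countable V] {K : Finset V} (hK : (G.induce (K : Set V)).Connected) :
    (bases (src (G := G) (K := K)) tgt ⊥ Finset.univ).Nonempty := by
  obtain ⟨x⟩ := hK.nonempty
  obtain ⟨ω, h1, h2⟩ := ((treeGibbs_uniformSpanningTree (subset_refl K) ⟨x, x.2⟩ hK).mem_bases.and
    (outerRel_uniformSpanningTree hK)).exists
  exact ⟨_, h2 ▸ h1⟩

/-- Feder-Mihail domination: the tree inside `K` is stochastically below the uniform spanning
tree on `K`. -/
theorem TreeGibbs.integral_le_treeAverage [Countable V] {ν : Measure (Config G)}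
    [IsProbabilityMeasure ν] {K : Finset V} (hν : TreeGibbs ν K)
    (hK : (G.induce (K : Set V)).Connected) {f : Finset (InsideEdge G K) → ℝ} (hf : Monotone f)
    (h0 : ∀ A, 0 ≤ f A) : ∫ ω, f (insideEdges K ω) ∂ν ≤ treeAverage G K f := by
  classical
  have := Fintype.ofFinite (Setoid (K : Set V))
  have hpos : (0 : ℝ) < (bases (src (G := G) (K := K)) tgt ⊥ Finset.univ).card :=
    Nat.cast_pos.2 (Finset.card_pos.2 (bases_bot_nonempty hK))
  choose m hm0 hm using hν.sum_eq
  have h1 : ∑ q, (bases (src (G := G) (K := K)) tgt q Finset.univ).card * m q = 1 := by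
    have := integral_insideEdges (ν := ν) K fun _ => 1
    simp only [integral_const, probReal_univ, smul_eq_mul, mul_one] at this
    rw [this]
    refine Finset.sum_congr rfl fun q _ => ?_
    rw [hm q fun _ => 1]
    simp
  rw [integral_insideEdges, treeAverage, le_div_iff₀ hpos, Finset.sum_mul]
  calc ∑ q, (∑ A : Finset (InsideEdge G K),
          f A * ν.real {ω | insideEdges K ω = A ∧ outerRel K ω = q}) *
          (bases (src (G := G) (K := K)) tgt ⊥ Finset.univ).card
      ≤ ∑ q, (∑ A ∈ bases src tgt ⊥ Finset.univ, f A) *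
          ((bases (src (G := G) (K := K)) tgt q Finset.univ).card * m q) := by
        refine Finset.sum_le_sum fun q _ => ?_
        rw [hm]
        have := mul_le_mul_of_nonneg_right (sum_bases_mono (s := src (G := G) (K := K)) (t := tgt)
          (bot_le : ⊥ ≤ q) (E := Finset.univ) hf h0) (hm0 q)
        linarith
    _ = _ := by rw [← Finset.mul_sum, h1, mul_one]

theorem integral_uniformSpanningTree [Countable V] {K : Finset V}
    (hK : (G.induce (K : Set V)).Connected) (f : Finset (InsideEdge G K) → ℝ) :
    ∫ ω, f (insideEdges K ω) ∂(uniformSpanningTree G K hK : Measure (Config G)) =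
      treeAverage G K f := by
  classical
  have := Fintype.ofFinite (Setoid (K : Set V))
  have hpos : (0 : ℝ) < (bases (src (G := G) (K := K)) tgt ⊥ Finset.univ).card :=
    Nat.cast_pos.2 (Finset.card_pos.2 (bases_bot_nonempty hK))
  obtain ⟨x⟩ := hK.nonempty
  obtain ⟨m, -, hm⟩ := (treeGibbs_uniformSpanningTree (subset_refl K) ⟨x, x.2⟩ hK).sum_eq ⊥
  have h1 : ∀ f : Finset (InsideEdge G K) → ℝ,
      ∫ ω, f (insideEdges K ω) ∂(uniformSpanningTree G K hK : Measure (Config G)) =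
        (∑ A ∈ bases src tgt ⊥ Finset.univ, f A) * m := by
    intro f
    rw [integral_insideEdges, ← hm f]
    refine Finset.sum_eq_single _ (fun q _ hq => ?_) (by simp)
    refine Finset.sum_eq_zero fun A _ => ?_
    rw [(measureReal_eq_zero_iff (by finiteness)).2, mul_zero]
    refine measure_mono_null ?_ (ae_iff.1 (outerRel_uniformSpanningTree hK))
    rintro ω ⟨-, h⟩ h'
    exact hq (h.symm.trans h')
  have h2 := h1 fun _ => 1
  simp only [integral_const, probReal_univ, smul_eq_mul, mul_one, Finset.sum_const,
    nsmul_eq_mul] at h2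
  rw [h1 f, treeAverage, eq_div_iff hpos.ne', mul_assoc, mul_comm m, ← h2, mul_one]

end TreeGibbs

/-! ### Mass densities on amenable graphs -/

section Density

variable {V : Type*} {G : SimpleGraph V}

/-- The neighbours of a vertex of a locally finite graph. -/
noncomputable def nbrs (hlf : ∀ v, (G.neighborSet v).Finite) (v : V) : Finset V := (hlf v).toFinset

theorem mem_nbrs {hlf : ∀ v, (G.neighborSet v).Finite} {v w : V} :
    w ∈ nbrs hlf v ↔ G.Adj v w := by simp [nbrs]

theorem bdry_subset (K : Finset V) : bdry G K ⊆ K := fun _ h => h.1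

open Classical in
theorem ncard_bdry (K : Finset V) : (bdry G K).ncard = {v ∈ K | v ∈ bdry G K}.card := by
  rw [← Set.ncard_coe_finset]
  congr 1
  ext v
  simpa using fun h => bdry_subset K h

/-- A function on the vertices that is constant on the orbits of `Γ`. -/
def InvariantFun (Γ : Subgroup (G ≃g G)) (a : V → ℝ) : Prop := ∀ γ ∈ Γ, ∀ v, a (γ v) = a v

variable {Γ : Subgroup (G ≃g G)}

theorem InvariantFun.exists_le (hΓ : IsQuasitransitive G Γ) {a : V → ℝ} (ha : InvariantFun Γ a) :
    ∃ M, 0 ≤ M ∧ ∀ v, a v ≤ M := by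
  obtain ⟨S, hS, hSv⟩ := hΓ
  obtain ⟨M, hM⟩ := (hS.image a).bddAbove
  refine ⟨max M 0, le_max_right _ _, fun v => ?_⟩
  obtain ⟨s, hs, γ, hγ, rfl⟩ := hSv v
  rw [ha γ hγ]
  exact (hM ⟨s, hs, rfl⟩).trans (le_max_left _ _)

theorem sum_nbrs_equivariant (hlf : ∀ v, (G.neighborSet v).Finite) (γ : G ≃g G) (v : V)
    (f : V → ℝ) : ∑ w ∈ nbrs hlf (γ v), f w = ∑ w ∈ nbrs hlf v, f (γ w) := by
  symm
  refine Finset.sum_nbij' γ γ.symm ?_ ?_ ?_ ?_ ?_ <;> intro w hw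
  · exact mem_nbrs.2 (γ.map_rel_iff.2 (mem_nbrs.1 hw))
  · have := mem_nbrs.1 hw
    rw [mem_nbrs, ← γ.map_rel_iff]
    simpa using this
  · simp
  · simp
  · rfl

theorem invariantFun_degree (hlf : ∀ v, (G.neighborSet v).Finite) :
    InvariantFun Γ fun v => ((nbrs hlf v).card : ℝ) := by
  intro γ _ v
  have := sum_nbrs_equivariant hlf γ v fun _ => 1
  simpa using this

open Classical in
/-- Only boundary vertices contribute pairs that leave `K`. -/
theorem sum_nbrs_le_sum_inter_add (hlf : ∀ v, (G.neighborSet v).Finite) {D M : ℝ}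
    (hD : ∀ v, ((nbrs hlf v).card : ℝ) ≤ D) (hM : 0 ≤ M) {φ : V → V → ℝ} (hφ : ∀ v w, φ v w ≤ M)
    (K : Finset V) : ∑ v ∈ K, ∑ w ∈ nbrs hlf v, φ v w ≤
      ∑ v ∈ K, ∑ w ∈ nbrs hlf v with w ∈ K, φ v w + D * M * (bdry G K).ncard := by
  have h1 : ∀ v ∈ K, ∑ w ∈ nbrs hlf v with w ∉ K, φ v w ≤
      if v ∈ bdry G K then D * M else 0 := by
    intro v hv
    split_ifs with hb
    · calc ∑ w ∈ nbrs hlf v with w ∉ K, φ v w ≤ ∑ w ∈ nbrs hlf v with w ∉ K, M :=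
            Finset.sum_le_sum fun w _ => hφ v w
        _ ≤ ∑ w ∈ nbrs hlf v, M := Finset.sum_le_sum_of_subset_of_nonneg
            (Finset.filter_subset _ _) fun _ _ _ => hM
        _ ≤ D * M := by
            rw [Finset.sum_const, nsmul_eq_mul]
            exact mul_le_mul_of_nonneg_right (hD v) hM
    · rw [Finset.filter_false_of_mem, Finset.sum_empty]
      intro w hw hwK
      exact hb ⟨hv, w, hwK, mem_nbrs.1 hw⟩
  have h2 : ∑ v ∈ K, (if v ∈ bdry G K then D * M else 0) = D * M * (bdry G K).ncard := by
    rw [← Finset.sum_filter, Finset.sum_const, nsmul_eq_mul, ncard_bdry, mul_comm]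
  rw [← h2, ← Finset.sum_add_distrib]
  refine Finset.sum_le_sum fun v hv => ?_
  rw [← Finset.sum_filter_add_sum_filter_not (nbrs hlf v) (· ∈ K)]
  exact add_le_add le_rfl (h1 v hv)

/-- An invariant function whose sums over a Følner exhaustion are of the order of the boundary
vanishes identically. -/
theorem InvariantFun.eq_zero (hconn : G.Connected) (hlf : ∀ v, (G.neighborSet v).Finite)
    (hΓ : IsQuasitransitive G Γ) {K : ℕ → Finset V} (hK : IsExhaustion G K)
    (hfol : Tendsto (fun n => ((bdry G (K n)).ncard : ℝ) / ((K n).card : ℝ)) atTop (𝓝 0))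
    {a : V → ℝ} (ha : InvariantFun Γ a) (h0 : ∀ v, 0 ≤ a v) {C : ℝ}
    (hC : ∀ n, ∑ v ∈ K n, a v ≤ C * (bdry G (K n)).ncard) (v : V) : a v = 0 := by
  classical
  obtain ⟨D, hD0, hD⟩ := (invariantFun_degree hlf (Γ := Γ)).exists_le hΓ
  by_contra hv
  have hv : 0 < a v := lt_of_le_of_ne (h0 v) (Ne.symm hv)
  -- spreading `a` to the neighbours preserves the hypotheses and makes `a` positive everywhere
  let T : (V → ℝ) → V → ℝ := fun a v => a v + ∑ w ∈ nbrs hlf v, a w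
  let P : (V → ℝ) → Prop := fun a => InvariantFun Γ a ∧ (∀ v, 0 ≤ a v) ∧
    ∃ C, ∀ n, ∑ v ∈ K n, a v ≤ C * (bdry G (K n)).ncard
  have hTP : ∀ a, P a → P (T a) := by
    rintro a ⟨ha, h0, C, hC⟩
    obtain ⟨M, hM0, hM⟩ := ha.exists_le hΓ
    refine ⟨?_, fun v => add_nonneg (h0 v) (Finset.sum_nonneg fun w _ => h0 w),
      C + (D * C + D * M), fun n => ?_⟩
    · intro γ hγ v
      simp only [T]
      rw [ha γ hγ, sum_nbrs_equivariant]
      simp only [ha γ hγ]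
    · have h1 := sum_nbrs_le_sum_inter_add hlf hD hM0 (φ := fun _ w => a w) (fun _ w => hM w) (K n)
      have h2 : ∑ v ∈ K n, ∑ w ∈ nbrs hlf v with w ∈ K n, a w ≤ D * ∑ w ∈ K n, a w := by
        rw [Finset.sum_comm' (s' := fun w => {v ∈ nbrs hlf w | v ∈ K n}) (t' := K n), Finset.mul_sum]
        · refine Finset.sum_le_sum fun w _ => ?_
          rw [Finset.sum_const, nsmul_eq_mul]
          refine mul_le_mul_of_nonneg_right (le_trans ?_ (hD w)) (h0 w)
          exact_mod_cast Finset.card_le_card (Finset.filter_subset _ _)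
        · intro x y
          simp only [Finset.mem_filter, mem_nbrs]
          rw [G.adj_comm]
          tauto
      have h3 := mul_le_mul_of_nonneg_left (hC n) hD0
      simp only [T, Finset.sum_add_distrib]
      have := hC n
      linarith
  have hiter : ∀ R, P (T^[R] a) := by
    intro R
    induction R with
    | zero => exact ⟨ha, h0, C, hC⟩
    | succ R ih => rw [Function.iterate_succ_apply']; exact hTP _ ih
  have hmono : ∀ v, Monotone fun R => T^[R] a v := fun v => monotone_nat_of_le_succ fun R => by
    rw [Function.iterate_succ_apply']
    exact le_add_of_nonneg_right (Finset.sum_nonneg fun w _ => (hiter R).2.1 w)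
  have hpos : ∀ w, ∃ R, 0 < T^[R] a w := by
    intro w
    refine reachable_induction (p := fun w => ∃ R, 0 < T^[R] a w) (hconn.preconnected v w)
      ⟨0, hv⟩ ?_
    rintro x y ⟨R, hR⟩ hxy
    refine ⟨R + 1, ?_⟩
    rw [Function.iterate_succ_apply']
    refine add_pos_of_nonneg_of_pos ((hiter R).2.1 y) ?_
    exact Finset.sum_pos' (fun w _ => (hiter R).2.1 w) ⟨x, mem_nbrs.2 hxy.symm, hR⟩
  obtain ⟨S, hS, hSv⟩ := id hΓ
  obtain ⟨R, hR⟩ : ∃ R, ∀ s ∈ S, 0 < T^[R] a s := by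
    choose r hr using hpos
    obtain ⟨R, hR⟩ := (hS.image r).bddAbove
    exact ⟨R, fun s hs => (hr s).trans_le (hmono s (hR ⟨s, hs, rfl⟩))⟩
  obtain ⟨hinv, -, C', hC'⟩ := hiter R
  obtain ⟨ε, hε, hle⟩ : ∃ ε > 0, ∀ w, ε ≤ T^[R] a w := by
    obtain ⟨s₀, hs₀, -⟩ := hSv v
    obtain ⟨m, hm, hmin⟩ := Set.exists_min_image S (T^[R] a) hS ⟨s₀, hs₀⟩
    refine ⟨_, hR m hm, fun w => ?_⟩
    obtain ⟨s, hs, γ, hγ, rfl⟩ := hSv w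
    rw [hinv γ hγ]
    exact hmin s hs
  have hbound : ∀ n, ε ≤ C' * (((bdry G (K n)).ncard : ℝ) / ((K n).card : ℝ)) := by
    intro n
    obtain ⟨x⟩ := (hK.connected n).nonempty
    have hcard : (0 : ℝ) < (K n).card := Nat.cast_pos.2 (Finset.card_pos.2 ⟨x, x.2⟩)
    rw [← mul_div_assoc, le_div_iff₀ hcard]
    refine le_trans ?_ (hC' n)
    rw [mul_comm, ← nsmul_eq_mul]
    exact Finset.card_nsmul_le_sum _ _ _ fun w _ => hle w
  have := ge_of_tendsto' (hfol.const_mul C') hbound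
  rw [mul_zero] at this
  exact absurd this (not_le.2 hε)

end Density

/-! ### Translates of configurations and of uniform spanning trees -/

section Translate

variable {V : Type*} {G : SimpleGraph V}

theorem translate_apply_mapEdgeSet (γ : G ≃g G) (ω : Config G) (e : G.edgeSet) :
    translate γ ω (γ.mapEdgeSet e) = ω e := by
  have : γ.symm.mapEdgeSet (γ.mapEdgeSet e) = e := γ.mapEdgeSet.symm_apply_apply e
  rw [translate, this]

theorem translate_adj {γ : G ≃g G} {ω : Config G} {a b : V} :
    (toGraph (translate γ ω)).Adj (γ a) (γ b) ↔ (toGraph ω).Adj a b := by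
  rw [toGraph_adj, toGraph_adj]
  constructor
  · rintro ⟨h1, h2⟩
    have h3 : G.Adj a b := γ.map_rel_iff.1 h1
    refine ⟨h3, ?_⟩
    rw [← translate_apply_mapEdgeSet γ ω]
    exact h2
  · rintro ⟨h1, h2⟩
    refine ⟨γ.map_rel_iff.2 h1, ?_⟩
    rw [← translate_apply_mapEdgeSet γ ω] at h2
    exact h2

/-- An automorphism of `G` is an isomorphism from a spanning subgraph to its translate. -/
def translateIso (γ : G ≃g G) (ω : Config G) : toGraph ω ≃g toGraph (translate γ ω) where
  toEquiv := γ.toEquiv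
  map_rel_iff' := translate_adj

theorem translateIso_apply (γ : G ≃g G) (ω : Config G) (v : V) : translateIso γ ω v = γ v := rfl

theorem translate_symm_translate (γ : G ≃g G) (ω : Config G) :
    translate γ.symm (translate γ ω) = ω := by
  funext e
  obtain ⟨f, rfl⟩ := γ.symm.mapEdgeSet.surjective e
  rw [translate_apply_mapEdgeSet]
  rfl

theorem translate_translate_symm (γ : G ≃g G) (ω : Config G) :
    translate γ (translate γ.symm ω) = ω := translate_symm_translate γ.symm ω

theorem measurable_translate (γ : G ≃g G) : Measurable (translate γ) :=
  measurable_pi_lambda _ fun _ => measurable_pi_apply _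

theorem edgeInside_map {γ : G ≃g G} {K : Finset V} {e : G.edgeSet} :
    EdgeInside (K.map γ.toEquiv.toEmbedding) (γ.mapEdgeSet e) ↔ EdgeInside K e := by
  obtain ⟨e, he⟩ := e
  induction e using Sym2.ind with
  | _ a b =>
    have h1 : γ.mapEdgeSet ⟨s(a, b), he⟩ = ⟨s(γ a, γ b), γ.map_rel_iff.2 he⟩ := rfl
    have hab : G.Adj a b := he
    rw [h1]
    have h2 : ∀ x, γ x ∈ K.map γ.toEquiv.toEmbedding ↔ x ∈ K := fun x =>
      Finset.mem_map' (f := γ.toEquiv.toEmbedding)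
    exact (edgeInside_mk.trans (and_congr (h2 a) (h2 b))).trans
      (edgeInside_mk (h := hab)).symm

theorem translate_mem_spanningTrees {γ : G ≃g G} {K : Finset V} {ω : Config G}
    (h : ω ∈ spanningTrees G K) : translate γ ω ∈ spanningTrees G (K.map γ.toEquiv.toEmbedding) := by
  obtain ⟨h1, h2, h3, h4⟩ := mem_spanningTrees_iff.1 h
  refine mem_spanningTrees_iff.2 ⟨fun e he => ?_, (translateIso γ ω).isAcyclic_iff.1 h2,
    h3.map, ?_⟩
  · obtain ⟨e, rfl⟩ := γ.mapEdgeSet.surjective e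
    rw [translate_apply_mapEdgeSet] at he
    exact edgeInside_map.2 (h1 e he)
  · intro x hx y hy
    obtain ⟨x, hx', rfl⟩ := Finset.mem_map.1 hx
    obtain ⟨y, hy', rfl⟩ := Finset.mem_map.1 hy
    exact (translateIso γ ω).reachable_iff.2 (h4 x hx' y hy')

theorem map_symm_map {γ : G ≃g G} (K : Finset V) :
    (K.map γ.toEquiv.toEmbedding).map γ.symm.toEquiv.toEmbedding = K := by
  ext x
  constructor
  · intro h
    obtain ⟨y, hy, rfl⟩ := Finset.mem_map.1 h
    obtain ⟨z, hz, rfl⟩ := Finset.mem_map.1 hy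
    have : γ.symm (γ z) = z := γ.symm_apply_apply z
    change γ.symm (γ z) ∈ K
    rwa [this]
  · intro h
    exact Finset.mem_map.2 ⟨γ x, Finset.mem_map.2 ⟨x, h, rfl⟩, γ.symm_apply_apply x⟩

theorem image_translate_spanningTrees (γ : G ≃g G) (K : Finset V) :
    translate γ '' spanningTrees G K = spanningTrees G (K.map γ.toEquiv.toEmbedding) := by
  apply Set.Subset.antisymm
  · rintro _ ⟨ω, h, rfl⟩
    exact translate_mem_spanningTrees h
  · intro ω hω
    refine ⟨translate γ.symm ω, ?_, translate_translate_symm γ ω⟩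
    have := translate_mem_spanningTrees (γ := γ.symm) hω
    rwa [map_symm_map] at this

theorem connected_induce_map {K : Finset V} (hK : (G.induce (K : Set V)).Connected) (γ : G ≃g G) :
    (G.induce (K.map γ.toEquiv.toEmbedding : Set V)).Connected := by
  obtain ⟨ω, hω⟩ := spanningTrees_nonempty hK
  have hle : inside (K.map γ.toEquiv.toEmbedding) (translate γ ω) ≤
      G.induce (K.map γ.toEquiv.toEmbedding : Set V) := fun a b h =>
    show G.Adj a b from toGraph_le _ (inside_adj.1 h)
  exact (translate_mem_spanningTrees (γ := γ) hω).2.1.mono hle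

theorem uniformSpanningTree_map [Countable V] {K : Finset V}
    (hK : (G.induce (K : Set V)).Connected) (γ : G ≃g G) (e : G.edgeSet) :
    (uniformSpanningTree G _ (connected_induce_map hK γ) : Measure (Config G))
      {ω | ω (γ.mapEdgeSet e) = true} =
        (uniformSpanningTree G K hK : Measure (Config G)) {ω | ω e = true} := by
  change uniformOn _ _ = uniformOn _ _
  have hinj : Function.Injective (translate γ) :=
    Function.LeftInverse.injective (translate_symm_translate γ)
  rw [uniformOn, uniformOn, cond_apply (spanningTrees_finite G _).measurableSet,
    cond_apply (spanningTrees_finite G _).measurableSet, ← image_translate_spanningTrees]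
  have h2 : translate γ '' spanningTrees G K ∩ {ω | ω (γ.mapEdgeSet e) = true} =
      translate γ '' (spanningTrees G K ∩ {ω | ω e = true}) := by
    ext ω
    constructor
    · rintro ⟨⟨ω, h, rfl⟩, h'⟩
      refine ⟨ω, ⟨h, ?_⟩, rfl⟩
      rwa [Set.mem_ofPred_eq, translate_apply_mapEdgeSet] at h'
    · rintro ⟨ω, ⟨h, h'⟩, rfl⟩
      refine ⟨⟨ω, h, rfl⟩, ?_⟩
      rwa [Set.mem_ofPred_eq, translate_apply_mapEdgeSet]
  rw [h2, Measure.count_injective_image hinj, Measure.count_injective_image hinj]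

end Translate

/-! ### Limits of edge probabilities -/

section FreeLimit

variable {V : Type*} [Countable V] {G : SimpleGraph V}

theorem TreeGibbs.integral_le_uniform {ν : Measure (Config G)} [IsProbabilityMeasure ν]
    {K : Finset V} (hν : TreeGibbs ν K) (hK : (G.induce (K : Set V)).Connected)
    {f : Finset (InsideEdge G K) → ℝ} (hf : Monotone f) (h0 : ∀ A, 0 ≤ f A) :
    ∫ ω, f (insideEdges K ω) ∂ν ≤
      ∫ ω, f (insideEdges K ω) ∂(uniformSpanningTree G K hK : Measure (Config G)) := by
  rw [integral_uniformSpanningTree hK]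
  exact hν.integral_le_treeAverage hK hf h0

omit [Countable V] in
theorem ind_nonneg (p : Prop) : 0 ≤ ind p := by
  by_cases h : p <;> simp [ind, h]

omit [Countable V] in
theorem ind_mono {p q : Prop} (h : p → q) : ind p ≤ ind q := by
  by_cases hp : p
  · rw [ind_true hp, ind_true (h hp)]
  · rw [ind_false hp]; exact ind_nonneg q

omit [Countable V] in
theorem integral_ind {Ω : Type*} [MeasurableSpace Ω] {ν : Measure Ω}
    {p : Ω → Prop} (hp : MeasurableSet {ω | p ω}) : ∫ ω, ind (p ω) ∂ν = ν.real {ω | p ω} := by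
  classical
  have : (fun ω => ind (p ω)) = {ω | p ω}.indicator fun _ => (1 : ℝ) := by
    funext ω
    by_cases h : p ω
    · rw [ind_true h, Set.indicator_of_mem]; exact h
    · rw [ind_false h, Set.indicator_of_notMem]; exact h
  rw [this, integral_indicator_const _ hp, smul_eq_mul, mul_one]

omit [Countable V] in
theorem integrable_ind {Ω : Type*} [MeasurableSpace Ω] {ν : Measure Ω} [IsFiniteMeasure ν]
    {p : Ω → Prop} (hp : MeasurableSet {ω | p ω}) : Integrable (fun ω => ind (p ω)) ν := by
  classical
  have : (fun ω => ind (p ω)) = {ω | p ω}.indicator fun _ => (1 : ℝ) := by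
    funext ω
    by_cases h : p ω
    · rw [ind_true h, Set.indicator_of_mem]; exact h
    · rw [ind_false h, Set.indicator_of_notMem]; exact h
  rw [this]
  exact (integrable_const _).indicator hp

omit [Countable V] in
theorem measurableSet_forall_edge (S : Finset G.edgeSet) :
    MeasurableSet {ω : Config G | ∀ e ∈ S, ω e = true} := by
  have : {ω : Config G | ∀ e ∈ S, ω e = true} = ⋂ e ∈ S, {ω : Config G | ω e = true} := by
    ext ω; simp
  rw [this]
  exact S.measurableSet_biInter fun e _ => measurableSet_edge e

theorem TreeGibbs.real_forall_le {ν : Measure (Config G)} [IsProbabilityMeasure ν]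
    {K : Finset V} (hν : TreeGibbs ν K) (hK : (G.induce (K : Set V)).Connected)
    {S : Finset G.edgeSet} (hS : ∀ e ∈ S, EdgeInside K e) :
    ν.real {ω | ∀ e ∈ S, ω e = true} ≤
      (uniformSpanningTree G K hK : Measure (Config G)).real {ω | ∀ e ∈ S, ω e = true} := by
  have h := hν.integral_le_uniform hK
    (f := fun A => ind (∀ e ∈ S, ∃ h : EdgeInside K e, (⟨e, h⟩ : InsideEdge G K) ∈ A))
    (fun A B hAB => ind_mono fun h e he => ⟨hS e he, hAB (h e he).2⟩) fun A => ind_nonneg _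
  have h1 : ∀ ω : Config G, (∀ e ∈ S, ∃ h : EdgeInside K e,
      (⟨e, h⟩ : InsideEdge G K) ∈ insideEdges K ω) ↔ ∀ e ∈ S, ω e = true := by
    intro ω
    simp only [mem_insideEdges]
    exact ⟨fun h e he => (h e he).2, fun h e he => ⟨hS e he, h e he⟩⟩
  simp only [h1] at h
  rwa [integral_ind (measurableSet_forall_edge S), integral_ind (measurableSet_forall_edge S)] at h

theorem TreeGibbs.real_edge_le {ν : Measure (Config G)} [IsProbabilityMeasure ν]
    {K : Finset V} (hν : TreeGibbs ν K) (hK : (G.induce (K : Set V)).Connected)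
    {e : G.edgeSet} (he : EdgeInside K e) : ν.real {ω | ω e = true} ≤
      (uniformSpanningTree G K hK : Measure (Config G)).real {ω | ω e = true} := by
  have := hν.real_forall_le hK (S := {e}) (by simpa using he)
  simpa using this

/-- The number of open edges of `S`, minus the indicator that all of them are open, is an
increasing function. -/
theorem TreeGibbs.sum_real_sub_le {ν : Measure (Config G)} [IsProbabilityMeasure ν]
    {K : Finset V} (hν : TreeGibbs ν K) (hK : (G.induce (K : Set V)).Connected)
    {S : Finset G.edgeSet} (hS : ∀ e ∈ S, EdgeInside K e) :
    ∑ e ∈ S, ν.real {ω | ω e = true} - ν.real {ω | ∀ e ∈ S, ω e = true} ≤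
      ∑ e ∈ S, (uniformSpanningTree G K hK : Measure (Config G)).real {ω | ω e = true} -
      (uniformSpanningTree G K hK : Measure (Config G)).real {ω | ∀ e ∈ S, ω e = true} := by
  classical
  let o : G.edgeSet → Finset (InsideEdge G K) → Prop := fun e A =>
    ∃ h : EdgeInside K e, (⟨e, h⟩ : InsideEdge G K) ∈ A
  have hmono : ∀ {e A B}, A ⊆ B → o e A → o e B := fun hAB h => ⟨h.1, hAB h.2⟩
  have hle1 : ∀ p, ind p ≤ 1 := fun p => by
    rw [← ind_true trivial]; exact ind_mono fun _ => trivial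
  have h := hν.integral_le_uniform hK
    (f := fun A => ∑ e ∈ S, ind (o e A) - ind (∀ e ∈ S, o e A) + 1) ?_ ?_
  · have h1 : ∀ ω : Config G, (∀ e ∈ S, o e (insideEdges K ω)) ↔ ∀ e ∈ S, ω e = true := by
      intro ω
      simp only [o, mem_insideEdges]
      exact ⟨fun h e he => (h e he).2, fun h e he => ⟨hS e he, h e he⟩⟩
    have h2 : ∀ ω : Config G, ∑ e ∈ S, ind (o e (insideEdges K ω)) =
        ∑ e ∈ S, ind (ω e = true) := by
      intro ω
      refine Finset.sum_congr rfl fun e he => ind_congr ?_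
      simp only [o, mem_insideEdges]
      exact ⟨fun h => h.2, fun h => ⟨hS e he, h⟩⟩
    simp only [h1, h2] at h
    have h3 : ∀ (ν : Measure (Config G)) [IsProbabilityMeasure ν],
        ∫ ω, (∑ e ∈ S, ind (ω e = true) - ind (∀ e ∈ S, ω e = true) + 1) ∂ν =
          ∑ e ∈ S, ν.real {ω | ω e = true} - ν.real {ω | ∀ e ∈ S, ω e = true} + 1 := by
      intro ν _
      have hi1 : ∀ e ∈ S, Integrable (fun ω : Config G => ind (ω e = true)) ν := fun e _ =>
        integrable_ind (measurableSet_edge e)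
      have hi2 : Integrable (fun ω : Config G => ind (∀ e ∈ S, ω e = true)) ν :=
        integrable_ind (measurableSet_forall_edge S)
      have hi3 : Integrable (fun ω : Config G =>
          ∑ e ∈ S, ind (ω e = true) - ind (∀ e ∈ S, ω e = true)) ν :=
        (integrable_finsetSum _ hi1).sub hi2
      rw [integral_add hi3 (integrable_const _),
        integral_sub (integrable_finsetSum _ hi1) hi2, integral_finsetSum _ hi1,
        integral_ind (measurableSet_forall_edge S)]
      simp only [integral_ind (measurableSet_edge _), integral_const, probReal_univ, smul_eq_mul,
        mul_one]
    rw [h3, h3] at h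
    linarith
  · intro A B hAB
    have hsum : ∀ e ∈ S, ind (o e A) ≤ ind (o e B) := fun e _ => ind_mono (hmono hAB)
    by_cases hB : ∀ e ∈ S, o e B
    · by_cases hA : ∀ e ∈ S, o e A
      · simp only [ind_true hA, ind_true hB]
        have := Finset.sum_le_sum hsum
        linarith
      · simp only [ind_false hA, ind_true hB]
        push Not at hA
        obtain ⟨f, hf, hfA⟩ := hA
        have h1 := Finset.sum_le_sum fun e (he : e ∈ S.erase f) =>
          hsum e (Finset.mem_of_mem_erase he)
        rw [← Finset.add_sum_erase S _ hf, ← Finset.add_sum_erase S (fun e => ind (o e B)) hf,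
          ind_false hfA, ind_true (hB f hf)]
        linarith
    · have hA : ¬ ∀ e ∈ S, o e A := fun h => hB fun e he => hmono hAB (h e he)
      simp only [ind_false hA, ind_false hB]
      have := Finset.sum_le_sum hsum
      linarith
  · intro A
    have h1 := Finset.sum_nonneg fun e (_ : e ∈ S) => ind_nonneg (o e A)
    have h2 := hle1 (∀ e ∈ S, o e A)
    linarith

/-- The infimum, over all finite connected subgraphs, of the probability that `e` is in the uniform
spanning tree. -/
noncomputable def freeProb (G : SimpleGraph V) (e : G.edgeSet) : ℝ :=
  sInf {p | ∃ (K : Finset V) (hK : (G.induce (K : Set V)).Connected), EdgeInside K e ∧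
    p = (uniformSpanningTree G K hK : Measure (Config G)).real {ω | ω e = true}}

theorem freeProb_le {K : Finset V} (hK : (G.induce (K : Set V)).Connected) {e : G.edgeSet}
    (he : EdgeInside K e) :
    freeProb G e ≤ (uniformSpanningTree G K hK : Measure (Config G)).real {ω | ω e = true} :=
  csInf_le ⟨0, by rintro _ ⟨K, hK, -, rfl⟩; exact measureReal_nonneg⟩ ⟨K, hK, he, rfl⟩

theorem freeProb_map (γ : G ≃g G) (e : G.edgeSet) :
    freeProb G (γ.mapEdgeSet e) = freeProb G e := by
  rw [freeProb, freeProb]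
  congr 1
  ext p
  constructor
  · rintro ⟨K, hK, he, rfl⟩
    have h1 := connected_induce_map hK γ.symm
    have h2 := uniformSpanningTree_map hK γ.symm (γ.mapEdgeSet e)
    have h3 := edgeInside_map (γ := γ.symm) (K := K) (e := γ.mapEdgeSet e)
    have h4 : γ.symm.mapEdgeSet (γ.mapEdgeSet e) = e := γ.mapEdgeSet.symm_apply_apply e
    rw [h4] at h2 h3
    exact ⟨_, h1, h3.2 he, congrArg ENNReal.toReal h2.symm⟩
  · rintro ⟨K, hK, he, rfl⟩
    exact ⟨_, connected_induce_map hK γ, edgeInside_map.2 he,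
      congrArg ENNReal.toReal (uniformSpanningTree_map hK γ e).symm⟩

omit [Countable V] in
theorem integral_card_insideEdges {ν : Measure (Config G)} [IsProbabilityMeasure ν]
    (K : Finset V) : ∫ ω, ((insideEdges K ω).card : ℝ) ∂ν =
      ∑ e : InsideEdge G K, ν.real {ω | ω e = true} := by
  have h1 : ∀ ω : Config G, ((insideEdges K ω).card : ℝ) =
      ∑ e : InsideEdge G K, ind (ω e = true) := by
    intro ω
    rw [insideEdges, Finset.card_filter]
    push_cast
    refine Finset.sum_congr rfl fun e _ => ?_
    by_cases h : ω e = true <;> simp [ind, h]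
  simp only [h1]
  rw [integral_finsetSum]
  · exact Finset.sum_congr rfl fun e _ => integral_ind (measurableSet_edge _)
  · exact fun e _ => integrable_ind (measurableSet_edge _)

theorem numClasses_bot {X : Type*} : numClasses (⊥ : Setoid X) = Nat.card X := by
  unfold numClasses
  exact Nat.card_congr (Equiv.ofBijective (Quotient.mk ⊥)
    ⟨fun a b h => Quotient.exact h, Quotient.mk_surjective⟩).symm

theorem sum_uniformSpanningTree_edge {K : Finset V} (hK : (G.induce (K : Set V)).Connected) :
    ∑ e : InsideEdge G K,
      (uniformSpanningTree G K hK : Measure (Config G)).real {ω | ω e = true} = K.card - 1 := by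
  rw [← integral_card_insideEdges]
  obtain ⟨x⟩ := hK.nonempty
  have h : ∀ᵐ ω ∂(uniformSpanningTree G K hK : Measure (Config G)),
      ((insideEdges K ω).card : ℝ) = K.card - 1 := by
    filter_upwards [(treeGibbs_uniformSpanningTree (subset_refl K) ⟨x, x.2⟩ hK).mem_bases,
      outerRel_uniformSpanningTree hK] with ω h1 h2
    rw [h2] at h1
    have h3 := (mem_bases.1 h1).2.2
    rw [numClasses_bot, Nat.card_eq_fintype_card] at h3
    have h4 : Fintype.card (K : Set V) = K.card := by simp
    rw [h4] at h3
    rw [← h3]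
    push_cast
    ring
  rw [integral_congr_ae h]
  simp

omit [Countable V] in
/-- A forest whose components all meet the boundary has at least `|K| - |∂K|` edges. -/
theorem IsBdryForest.card_le {K : Finset V} {ω : Config G} (h : IsBdryForest G K (inside K ω)) :
    K.card ≤ (insideEdges K ω).card + (bdry G K).ncard := by
  have h1 := numClasses_le_conn (s := src (G := G) (K := K)) (t := tgt) ⊥ (insideEdges K ω)
  have h4 : Fintype.card (K : Set V) = K.card := by simp
  rw [numClasses_bot, Nat.card_eq_fintype_card, h4] at h1
  refine h1.trans ?_
  rw [add_comm]
  refine Nat.add_le_add_left ?_ _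
  have hfin : (bdry G K).Finite := K.finite_toSet.subset (bdry_subset K)
  have := hfin.to_subtype
  rw [← Nat.card_coe_set_eq]
  refine Nat.card_le_card_of_surjective (fun b : bdry G K =>
    Quotient.mk (conn src tgt ⊥ (insideEdges K ω)) ⟨b, bdry_subset K b.2⟩) ?_
  intro c
  induction c using Quotient.inductionOn with
  | _ v =>
    obtain ⟨b, hb, hbd⟩ := h.2.2 ((inside K ω).connectedComponentMk v)
    refine ⟨⟨b, hbd⟩, Quotient.sound ?_⟩
    have hr : (inside K ω).Reachable b v := SimpleGraph.ConnectedComponent.exact hb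
    refine reachable_induction (p := fun z => conn src tgt ⊥ (insideEdges K ω) b z) hr
      (Setoid.refl' _ _) ?_
    intro x y hx hxy
    refine Setoid.trans' _ hx ?_
    obtain ⟨h1, h2⟩ := toGraph_adj.1 (inside_adj.1 hxy)
    have hin : EdgeInside K (⟨s((x : V), (y : V)), h1⟩ : G.edgeSet) := edgeInside_mk.2 ⟨x.2, y.2⟩
    have hrel := conn_rel_of_mem (s := src (G := G) (K := K)) (t := tgt) ⊥
      (mem_insideEdges (e := ⟨_, hin⟩).2 h2)
    have hst := src_tgt (⟨_, hin⟩ : InsideEdge G K)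
    rcases Sym2.eq_iff.1 hst with ⟨h5, h6⟩ | ⟨h5, h6⟩
    · rwa [Subtype.ext h5, Subtype.ext h6] at hrel
    · rw [Subtype.ext h5, Subtype.ext h6] at hrel
      exact Setoid.symm' _ hrel

end FreeLimit

/-! ### Identification of the limit of uniform spanning trees -/

section TreeLimit

variable {V : Type*} {G : SimpleGraph V}

open Classical in
/-- The extension of a function on the edges to all pairs of vertices. -/
noncomputable def edgeFun (b : G.edgeSet → ℝ) (v w : V) : ℝ :=
  if h : G.Adj v w then b ⟨s(v, w), h⟩ else 0

theorem edgeFun_of_adj {b : G.edgeSet → ℝ} {v w : V} (h : G.Adj v w) :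
    edgeFun b v w = b ⟨s(v, w), h⟩ := by rw [edgeFun, dif_pos h]

open Classical in
/-- Each edge inside `K` is counted at most twice. -/
theorem sum_edgeFun_le (hlf : ∀ v, (G.neighborSet v).Finite) {b : G.edgeSet → ℝ}
    (hb : ∀ e, 0 ≤ b e) (K : Finset V) :
    ∑ v ∈ K, ∑ w ∈ nbrs hlf v with w ∈ K, edgeFun b v w ≤ 2 * ∑ e : InsideEdge G K, b e := by
  let P : Finset (V × V) := {p ∈ K ×ˢ K | G.Adj p.1 p.2}
  have h0 : ∀ v w, 0 ≤ edgeFun b v w := fun v w => by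
    unfold edgeFun; split_ifs; exacts [hb _, le_rfl]
  have h1 : ∑ v ∈ K, ∑ w ∈ nbrs hlf v with w ∈ K, edgeFun b v w =
      ∑ p ∈ P, edgeFun b p.1 p.2 := by
    rw [Finset.sum_filter, Finset.sum_product]
    refine Finset.sum_congr rfl fun v hv => ?_
    rw [← Finset.sum_filter]
    refine Finset.sum_congr ?_ fun _ _ => rfl
    ext w
    simp [mem_nbrs, and_comm]
  let m : InsideEdge G K × Bool → V × V := fun x =>
    if x.2 then ((src x.1 : V), (tgt x.1 : V)) else ((tgt x.1 : V), (src x.1 : V))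
  have hm : ∀ x, edgeFun b (m x).1 (m x).2 = b x.1 := by
    rintro ⟨e, i⟩
    have h2 := adj_src_tgt e
    cases i
    · simp only [m, Bool.false_eq_true, if_false]
      rw [edgeFun_of_adj h2.symm]
      congr 1
      exact Subtype.ext (Sym2.eq_swap.trans (src_tgt e))
    · simp only [m, if_true]
      rw [edgeFun_of_adj h2]
      congr 1
      exact Subtype.ext (src_tgt e)
  have hP : P ⊆ Finset.univ.image m := by
    rintro ⟨v, w⟩ hp
    simp only [P, Finset.mem_filter, Finset.mem_product] at hp
    obtain ⟨hK, hvw⟩ := hp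
    let e : InsideEdge G K := ⟨⟨s(v, w), hvw⟩, edgeInside_mk.2 hK⟩
    rw [Finset.mem_image]
    rcases Sym2.eq_iff.1 (src_tgt e) with ⟨h5, h6⟩ | ⟨h5, h6⟩
    · exact ⟨(e, true), Finset.mem_univ _, by simp [m, h5, h6]⟩
    · exact ⟨(e, false), Finset.mem_univ _, by simp [m, h5, h6]⟩
  calc _ = ∑ p ∈ P, edgeFun b p.1 p.2 := h1
    _ ≤ ∑ p ∈ Finset.univ.image m, edgeFun b p.1 p.2 :=
        Finset.sum_le_sum_of_subset_of_nonneg hP fun _ _ _ => h0 _ _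
    _ ≤ ∑ x, edgeFun b (m x).1 (m x).2 :=
        Finset.sum_image_le_of_nonneg (f := fun p : V × V => edgeFun b p.1 p.2) fun _ _ => h0 _ _
    _ = 2 * ∑ e : InsideEdge G K, b e := by
        simp only [hm, Fintype.sum_prod_type, Fintype.sum_bool, Finset.sum_add_distrib]
        ring

variable {Γ : Subgroup (G ≃g G)}

theorem invariantFun_sum_edgeFun (hlf : ∀ v, (G.neighborSet v).Finite) {b : G.edgeSet → ℝ}
    (hb : ∀ γ ∈ Γ, ∀ e, b (γ.mapEdgeSet e) = b e) :
    InvariantFun Γ fun v => ∑ w ∈ nbrs hlf v, edgeFun b v w := by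
  intro γ hγ v
  simp only
  rw [sum_nbrs_equivariant]
  refine Finset.sum_congr rfl fun w hw => ?_
  have h := mem_nbrs.1 hw
  rw [edgeFun_of_adj h, edgeFun_of_adj (γ.map_rel_iff.2 h), ← hb γ hγ ⟨s(v, w), h⟩]
  rfl

theorem IsInvariant.real_edge {μ : Measure (Config G)} (hinv : IsInvariant Γ μ) {γ : G ≃g G}
    (hγ : γ ∈ Γ) (e : G.edgeSet) :
    μ.real {ω | ω (γ.mapEdgeSet e) = true} = μ.real {ω | ω e = true} := by
  conv_lhs => rw [← hinv γ hγ]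
  rw [map_measureReal_apply (measurable_translate γ) (measurableSet_edge _)]
  congr 1
  ext ω
  rw [Set.mem_preimage, Set.mem_ofPred_eq, translate_apply_mapEdgeSet, Set.mem_ofPred_eq]

variable [Countable V]

/-- In an amenable graph the edge marginals of an invariant Gibbs tree are the infima of the
finite-volume ones, because both have one edge per vertex up to a boundary term. -/
theorem freeProb_eq_of_treeGibbs (hconn : G.Connected) (hlf : ∀ v, (G.neighborSet v).Finite)
    (hamen : IsAmenable G) (hΓ : IsQuasitransitive G Γ) {μ : Measure (Config G)}
    [IsProbabilityMeasure μ] (hforest : ∀ᵐ ω ∂μ, IsEssentialSpanningForest (toGraph ω))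
    (hinv : IsInvariant Γ μ) (hμ : ∀ K : Finset V, K.Nonempty → TreeGibbs μ K) (e : G.edgeSet) :
    freeProb G e = μ.real {ω | ω e = true} := by
  classical
  obtain ⟨K, hK, hfol⟩ := hamen
  have hne : ∀ n, (K n).Nonempty := fun n => by
    obtain ⟨x⟩ := (hK.connected n).nonempty
    exact ⟨x, x.2⟩
  let b : G.edgeSet → ℝ := fun e => freeProb G e - μ.real {ω | ω e = true}
  have hb0 : ∀ e, 0 ≤ b e := by
    intro e
    refine sub_nonneg.2 (le_csInf ?_ ?_)
    · obtain ⟨n, hn⟩ := (hK.eventually_edgeInside e).exists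
      exact ⟨_, K n, hK.connected n, hn, rfl⟩
    · rintro _ ⟨L, hL, he, rfl⟩
      obtain ⟨x⟩ := hL.nonempty
      exact (hμ L ⟨x, x.2⟩).real_edge_le hL he
  have hb1 : ∀ e, b e ≤ 1 := by
    intro e
    obtain ⟨n, hn⟩ := (hK.eventually_edgeInside e).exists
    have h1 := freeProb_le (hK.connected n) hn
    have h2 : (uniformSpanningTree G (K n) (hK.connected n) : Measure (Config G)).real
      {ω | ω e = true} ≤ 1 := measureReal_le_one
    have h3 : 0 ≤ μ.real {ω | ω e = true} := measureReal_nonneg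
    change freeProb G e - _ ≤ 1
    linarith
  have hbinv : ∀ γ ∈ Γ, ∀ e, b (γ.mapEdgeSet e) = b e := fun γ hγ e => by
    simp only [b]
    rw [freeProb_map, hinv.real_edge hγ]
  obtain ⟨D, hD0, hD⟩ := (invariantFun_degree hlf (Γ := Γ)).exists_le hΓ
  have hsum : ∀ n, ∑ e : InsideEdge G (K n), b e ≤ (bdry G (K n)).ncard := by
    intro n
    have h1 : ∑ e : InsideEdge G (K n), freeProb G e ≤ (K n).card := by
      refine (Finset.sum_le_sum fun e _ => freeProb_le (hK.connected n) e.2).trans ?_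
      rw [sum_uniformSpanningTree_edge]
      linarith
    have h2 : ((K n).card : ℝ) - (bdry G (K n)).ncard ≤
        ∑ e : InsideEdge G (K n), μ.real {ω | ω e = true} := by
      rw [← integral_card_insideEdges]
      have h3 : ∀ᵐ ω ∂μ, ((K n).card : ℝ) - (bdry G (K n)).ncard ≤
          ((insideEdges (K n) ω).card : ℝ) := by
        filter_upwards [hforest] with ω hω
        have := (hω.isBdryForest_inside (K n)).card_le
        rw [sub_le_iff_le_add]
        exact_mod_cast this
      have h4 : Integrable (fun ω => ((insideEdges (K n) ω).card : ℝ)) μ := by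
        have h5 : ∀ ω : Config G, ((insideEdges (K n) ω).card : ℝ) =
            ∑ e : InsideEdge G (K n), ind (ω e = true) := by
          intro ω
          rw [insideEdges, Finset.card_filter]
          push_cast
          refine Finset.sum_congr rfl fun e _ => ?_
          by_cases h : ω e = true <;> simp [ind, h]
        simp only [h5]
        exact integrable_finsetSum _ fun e _ => integrable_ind (measurableSet_edge _)
      have := integral_mono_ae (integrable_const _) h4 h3
      simpa using this
    simp only [b, Finset.sum_sub_distrib]
    linarith
  have hzero := InvariantFun.eq_zero hconn hlf hΓ hK hfol
    (invariantFun_sum_edgeFun hlf hbinv) (fun v => Finset.sum_nonneg fun w _ => by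
      unfold edgeFun; split_ifs; exacts [hb0 _, le_rfl]) (C := 2 + D * 1) (fun n => by
      have h1 := sum_nbrs_le_sum_inter_add hlf hD zero_le_one (φ := edgeFun b) (fun v w => by
        unfold edgeFun; split_ifs; exacts [hb1 _, zero_le_one]) (K n)
      have h2 := sum_edgeFun_le hlf hb0 (K n)
      have h3 := hsum n
      linarith)
  have hbe : b e = 0 := by
    obtain ⟨e, he⟩ := e
    induction e using Sym2.ind with
    | _ v w =>
      have hvw : G.Adj v w := he
      have h1 := (Finset.sum_eq_zero_iff_of_nonneg (fun w _ => by
        unfold edgeFun; split_ifs; exacts [hb0 _, le_rfl])).1 (hzero v) w (mem_nbrs.2 hvw)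
      rwa [edgeFun_of_adj hvw] at h1
  exact sub_eq_zero.1 hbe

theorem tendsto_uniformSpanningTree_edge {K : ℕ → Finset V} (hK : IsExhaustion G K)
    (e : G.edgeSet) : Tendsto (fun n => (uniformSpanningTree G (K n) (hK.connected n) :
      Measure (Config G)).real {ω | ω e = true}) atTop (𝓝 (freeProb G e)) := by
  refine tendsto_order.2 ⟨fun a ha => ?_, fun a ha => ?_⟩
  · filter_upwards [hK.eventually_edgeInside e] with n hn
    exact ha.trans_le (freeProb_le _ hn)
  · have hne : {p | ∃ (K : Finset V) (hK : (G.induce (K : Set V)).Connected), EdgeInside K e ∧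
        p = (uniformSpanningTree G K hK : Measure (Config G)).real {ω | ω e = true}}.Nonempty := by
      obtain ⟨n, hn⟩ := (hK.eventually_edgeInside e).exists
      exact ⟨_, K n, hK.connected n, hn, rfl⟩
    obtain ⟨_, ⟨L, hL, he, rfl⟩, hlt⟩ := exists_lt_of_csInf_lt hne ha
    obtain ⟨x⟩ := hL.nonempty
    filter_upwards [hK.eventually_subset L] with n hn
    exact ((treeGibbs_uniformSpanningTree hn ⟨x, x.2⟩ (hK.connected n)).real_edge_le hL he).trans_lt
      hlt

/-- The probability that finitely many given edges are open converges: it is squeezed between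
the two bounds given by stochastic domination. -/
theorem tendsto_uniformSpanningTree_forall_edge {μ : Measure (Config G)} [IsProbabilityMeasure μ]
    (hμ : ∀ K : Finset V, K.Nonempty → TreeGibbs μ K)
    (hfree : ∀ e, freeProb G e = μ.real {ω | ω e = true})
    {K : ℕ → Finset V} (hK : IsExhaustion G K) (S : Finset G.edgeSet) :
    Tendsto (fun n => (uniformSpanningTree G (K n) (hK.connected n) :
      Measure (Config G)).real {ω | ∀ e ∈ S, ω e = true}) atTop
      (𝓝 (μ.real {ω | ∀ e ∈ S, ω e = true})) := by
  have hin : ∀ᶠ n in atTop, ∀ e ∈ S, EdgeInside (K n) e :=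
    (eventually_all_finset S).2 fun e _ => hK.eventually_edgeInside e
  have hne : ∀ n, (K n).Nonempty := fun n => by
    obtain ⟨x⟩ := (hK.connected n).nonempty
    exact ⟨x, x.2⟩
  have hsum : Tendsto (fun n => μ.real {ω | ∀ e ∈ S, ω e = true} +
      (∑ e ∈ S, (uniformSpanningTree G (K n) (hK.connected n) :
        Measure (Config G)).real {ω | ω e = true} - ∑ e ∈ S, μ.real {ω | ω e = true})) atTop
      (𝓝 (μ.real {ω | ∀ e ∈ S, ω e = true})) := by
    have h1 := tendsto_finsetSum S fun e (_ : e ∈ S) => tendsto_uniformSpanningTree_edge hK e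
    simp only [hfree] at h1
    have h2 := (h1.sub_const (∑ e ∈ S, μ.real {ω | ω e = true})).const_add
      (μ.real {ω | ∀ e ∈ S, ω e = true})
    simpa using h2
  refine tendsto_of_tendsto_of_tendsto_of_le_of_le' tendsto_const_nhds hsum ?_ ?_
  · filter_upwards [hin] with n hn
    exact (hμ _ (hne n)).real_forall_le (hK.connected n) hn
  · filter_upwards [hin] with n hn
    have := (hμ _ (hne n)).sum_real_sub_le (hK.connected n) hn
    linarith

/-- Configurations with prescribed open and closed edges. -/
def cylinder (S D : Finset G.edgeSet) : Set (Config G) :=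
  {ω | (∀ e ∈ S, ω e = true) ∧ ∀ e ∈ D, ω e = false}

omit [Countable V] in
theorem measurableSet_cylinder (S D : Finset G.edgeSet) : MeasurableSet (cylinder S D) := by
  have h : MeasurableSet {ω : Config G | ∀ e ∈ D, ω e = false} := by
    have : {ω : Config G | ∀ e ∈ D, ω e = false} = ⋂ e ∈ D, {ω : Config G | ω e = false} := by
      ext ω; simp
    rw [this]
    exact D.measurableSet_biInter fun e _ =>
      measurableSet_eq_fun (measurable_pi_apply e) measurable_const
  exact (measurableSet_forall_edge S).inter h

/-- Convergence of the probabilities that given edges are open implies weak convergence. -/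
theorem tendsto_of_tendsto_forall_edge {ν : ℕ → ProbabilityMeasure (Config G)}
    {μ : ProbabilityMeasure (Config G)}
    (h : ∀ S : Finset G.edgeSet, Tendsto
      (fun n => (ν n : Measure (Config G)).real {ω | ∀ e ∈ S, ω e = true}) atTop
      (𝓝 ((μ : Measure (Config G)).real {ω | ∀ e ∈ S, ω e = true}))) :
    Tendsto ν atTop (𝓝 μ) := by
  classical
  -- inclusion-exclusion over the closed edges
  have hcyl : ∀ D S : Finset G.edgeSet, Tendsto
      (fun n => (ν n : Measure (Config G)).real (cylinder S D)) atTop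
      (𝓝 ((μ : Measure (Config G)).real (cylinder S D))) := by
    intro D
    induction D using Finset.induction_on with
    | empty => intro S; simpa [cylinder] using h S
    | insert f D _ ih =>
      intro S
      have key : ∀ ρ : ProbabilityMeasure (Config G),
          (ρ : Measure (Config G)).real (cylinder S (insert f D)) =
            (ρ : Measure (Config G)).real (cylinder S D) -
              (ρ : Measure (Config G)).real (cylinder (insert f S) D) := by
        intro ρ
        rw [eq_sub_iff_add_eq, ← measureReal_union _ (measurableSet_cylinder _ _)]
        · congr 1
          ext ω
          simp only [cylinder, Set.mem_union, Set.mem_ofPred_eq, Finset.forall_mem_insert]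
          cases ω f <;> simp
        · refine Set.disjoint_left.2 fun ω hω hω' => ?_
          have h1 := hω.2 f (Finset.mem_insert_self f D)
          have h2 := hω'.1 f (Finset.mem_insert_self f S)
          rw [h1] at h2
          exact absurd h2 (by simp)
      simp only [key]
      exact (ih S).sub (ih (insert f S))
  have hpi : IsPiSystem {A : Set (Config G) | ∃ S D, A = cylinder S D} := by
    rintro _ ⟨S, D, rfl⟩ _ ⟨S', D', rfl⟩ -
    refine ⟨S ∪ S', D ∪ D', ?_⟩
    ext ω
    simp only [cylinder, Set.mem_inter_iff, Set.mem_ofPred_eq, Finset.forall_mem_union]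
    tauto
  refine hpi.tendsto_probabilityMeasure_of_tendsto_of_mem ?_ ?_ ?_
  · rintro _ ⟨S, D, rfl⟩
    exact measurableSet_cylinder S D
  · intro u hu x hx
    obtain ⟨I, t, ht, hsub⟩ := (isOpen_pi_iff.1 hu) x hx
    have hs : cylinder {e ∈ I | x e = true} {e ∈ I | x e = false} =
        (I : Set G.edgeSet).pi fun e => {x e} := by
      ext ω
      simp only [cylinder, Set.mem_ofPred_eq, Finset.mem_filter, Set.mem_pi, Set.mem_singleton_iff,
        Finset.mem_coe]
      constructor
      · rintro ⟨h1, h2⟩ e he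
        cases hxe : x e
        · exact h2 e ⟨he, hxe⟩
        · exact h1 e ⟨he, hxe⟩
      · intro h1
        exact ⟨fun e he => (h1 e he.1).trans he.2, fun e he => (h1 e he.1).trans he.2⟩
    refine ⟨_, ⟨{e ∈ I | x e = true}, {e ∈ I | x e = false}, rfl⟩, ?_, ?_⟩
    · rw [hs]
      exact set_pi_mem_nhds I.finite_toSet fun e _ => (isOpen_discrete _).mem_nhds rfl
    · rw [hs]
      exact (Set.pi_mono fun e he => Set.singleton_subset_iff.2 (ht e he).2).trans hsub
  · rintro _ ⟨S, D, rfl⟩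
    rw [← NNReal.tendsto_coe]
    exact hcyl D S

/-- An invariant measure with the weak Gibbs property that is supported on spanning trees is the
limit of uniform spanning trees. -/
theorem WeakGibbs.isLimitUST [Infinite V] (hconn : G.Connected)
    (hlf : ∀ v, (G.neighborSet v).Finite) (hamen : IsAmenable G) (hΓ : IsQuasitransitive G Γ)
    {μ : ProbabilityMeasure (Config G)} (hinv : IsInvariant Γ (μ : Measure (Config G)))
    (hgibbs : WeakGibbs (μ : Measure (Config G)))
    (htree : ∀ᵐ ω ∂(μ : Measure (Config G)), (toGraph ω).IsTree) : IsLimitUST G μ := by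
  obtain ⟨H, hH, -⟩ := id hamen
  have hμ : ∀ K : Finset V, K.Nonempty → TreeGibbs (μ : Measure (Config G)) K := fun K hK =>
    hgibbs.treeGibbs hH htree hK
  have hfree := freeProb_eq_of_treeGibbs hconn hlf hamen hΓ
    (htree.mono fun ω hω => isEssentialSpanningForest_of_isTree hω) hinv hμ
  intro K hK
  exact tendsto_of_tendsto_forall_edge fun S =>
    tendsto_uniformSpanningTree_forall_edge hμ hfree hK S

end TreeLimit

/-! ### Infinite branches and ends of a tree -/

section Branches

variable {V : Type*} {F : SimpleGraph V}

/-- The vertices on the side of `w` when the edge between `v` and `w` is removed. -/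
def branch (F : SimpleGraph V) (v w : V) : Set V := {u | (F.deleteEdges {s(v, w)}).Reachable w u}

/-- The edge from `v` to `w` leads to an infinite branch. -/
def InfDir (F : SimpleGraph V) (v w : V) : Prop := F.Adj v w ∧ (branch F v w).Infinite

/-- The vertex `v` has two infinite branches. -/
def IsCore (F : SimpleGraph V) (v : V) : Prop := ∃ w w', w ≠ w' ∧ InfDir F v w ∧ InfDir F v w'

/-- The vertex `v` has three infinite branches. -/
def IsTrifurcation (F : SimpleGraph V) (v : V) : Prop :=
  ∃ w₁ w₂ w₃, w₁ ≠ w₂ ∧ w₁ ≠ w₃ ∧ w₂ ≠ w₃ ∧ InfDir F v w₁ ∧ InfDir F v w₂ ∧ InfDir F v w₃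

theorem mem_branch_self (v w : V) : w ∈ branch F v w := SimpleGraph.Reachable.rfl

theorem branch_subset_reachable {v w x : V} (h : x ∈ branch F v w) : F.Reachable w x :=
  SimpleGraph.Reachable.mono (SimpleGraph.deleteEdges_le _) h

theorem notMem_branch (hF : F.IsAcyclic) {v w : V} (h : F.Adj v w) : v ∉ branch F v w := fun h' =>
  not_reachable_deleteEdges_of_isAcyclic hF h (SimpleGraph.Reachable.symm h')

theorem mem_branch_of_adj {v w x y : V} (hx : x ∈ branch F v w) (hxy : F.Adj x y) (hy : y ≠ v) :
    y ∈ branch F v w := by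
  by_cases h : s(x, y) = s(v, w)
  · rcases Sym2.eq_iff.1 h with ⟨-, rfl⟩ | ⟨-, rfl⟩
    · exact mem_branch_self v y
    · exact absurd rfl hy
  · exact SimpleGraph.Reachable.trans hx
      (SimpleGraph.Adj.reachable (SimpleGraph.deleteEdges_adj.2 ⟨hxy, h⟩))

theorem disjoint_branch_swap (hF : F.IsAcyclic) {v w : V} (h : F.Adj v w) :
    Disjoint (branch F v w) (branch F w v) := by
  rw [Set.disjoint_left]
  intro x hx hx'
  have h1 : (F.deleteEdges {s(v, w)}).Reachable v x := by
    rw [Sym2.eq_swap]; exact hx'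
  exact not_reachable_deleteEdges_of_isAcyclic hF h (h1.trans (SimpleGraph.Reachable.symm hx))

/-- The branch at `v` towards `w` lies, seen from another vertex `w'`, behind the edge from `w'` to
`v`. -/
theorem branch_subset (hF : F.IsAcyclic) {v w w' : V} (hw : F.Adj v w)
    (hne : w ≠ w') : branch F v w ⊆ branch F w' v := by
  intro x hx
  refine (reachable_induction (p := fun y => y ∈ branch F v w ∧ y ∈ branch F w' v) hx
    ⟨mem_branch_self v w, mem_branch_of_adj (mem_branch_self w' v) hw hne⟩ ?_).2
  rintro y z ⟨hy, hy'⟩ hyz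
  have hz : z ∈ branch F v w := SimpleGraph.Reachable.trans hy hyz.reachable
  have hyv : y ≠ v := fun h => notMem_branch hF hw (h ▸ hy)
  have hzv : z ≠ v := fun h => notMem_branch hF hw (h ▸ hz)
  refine ⟨hz, SimpleGraph.Reachable.trans hy'
    (SimpleGraph.Adj.reachable (SimpleGraph.deleteEdges_adj.2
      ⟨(SimpleGraph.deleteEdges_adj.1 hyz).1, fun h => ?_⟩))⟩
  rcases Sym2.eq_iff.1 h with ⟨-, h⟩ | ⟨h, -⟩
  · exact hzv h
  · exact hyv h

theorem disjoint_branch (hF : F.IsAcyclic) {v w w' : V} (hw : F.Adj v w) (hw' : F.Adj v w')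
    (hne : w ≠ w') : Disjoint (branch F v w) (branch F v w') :=
  (disjoint_branch_swap hF hw').symm.mono_left (branch_subset hF hw hne)

theorem eq_or_mem_branch {v x : V} (h : F.Reachable v x) :
    x = v ∨ ∃ z, F.Adj v z ∧ x ∈ branch F v z := by
  refine reachable_induction (p := fun x => x = v ∨ ∃ z, F.Adj v z ∧ x ∈ branch F v z) h
    (Or.inl rfl) ?_
  intro x y hx hxy
  by_cases hy : y = v
  · exact Or.inl hy
  rcases hx with rfl | ⟨z, hz, hx⟩
  · exact Or.inr ⟨y, hxy, mem_branch_self x y⟩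
  · exact Or.inr ⟨z, hz, mem_branch_of_adj hx hxy hy⟩

theorem branch_subset_iUnion (v w : V) :
    branch F w v ⊆ {v} ∪ ⋃ z ∈ {z | F.Adj v z ∧ z ≠ w}, branch F v z := by
  intro x hx
  refine reachable_induction (p := fun x => x ∈ {v} ∪ ⋃ z ∈ {z | F.Adj v z ∧ z ≠ w},
    branch F v z) hx (Or.inl rfl) ?_
  intro x y hx hxy
  obtain ⟨hxy', hne⟩ := SimpleGraph.deleteEdges_adj.1 hxy
  by_cases hy : y = v
  · exact Or.inl hy
  refine Or.inr ?_
  simp only [Set.mem_iUnion]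
  rcases hx with hx | hx
  · have hx : x = v := hx
    subst hx
    refine ⟨y, ⟨hxy', ?_⟩, mem_branch_self x y⟩
    rintro rfl
    exact hne Sym2.eq_swap
  · simp only [Set.mem_iUnion] at hx
    obtain ⟨z, hz, hx⟩ := hx
    exact ⟨z, hz, mem_branch_of_adj hx hxy' hy⟩

/-- An infinite branch behind the edge from `w` to `v` continues beyond `v`, by local finiteness. -/
theorem exists_infDir_ne (hlf : ∀ v, (F.neighborSet v).Finite) {v w : V}
    (h : (branch F w v).Infinite) : ∃ z, z ≠ w ∧ InfDir F v z := by
  by_contra! hcon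
  refine h ((((Set.finite_singleton v).union ?_)).subset (branch_subset_iUnion v w))
  refine Set.Finite.biUnion ((hlf v).subset fun z hz => hz.1) fun z hz => ?_
  by_contra hinf
  exact hcon z hz.2 ⟨hz.1, hinf⟩

theorem exists_infDir (hlf : ∀ v, (F.neighborSet v).Finite) {v : V}
    (h : {x | F.Reachable v x}.Infinite) : ∃ z, InfDir F v z := by
  by_contra! hcon
  refine h (Set.Finite.subset (s := {v} ∪ ⋃ z ∈ {z | F.Adj v z}, branch F v z)
    ((Set.finite_singleton v).union ?_) ?_)
  · refine Set.Finite.biUnion (hlf v) fun z hz => ?_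
    by_contra hinf
    exact hcon z ⟨hz, hinf⟩
  · intro x hx
    rcases eq_or_mem_branch hx with rfl | ⟨z, hz, hxz⟩
    · exact Or.inl rfl
    · exact Or.inr (Set.mem_biUnion hz hxz)

theorem InfDir.isCore (hF : F.IsAcyclic) (hlf : ∀ v, (F.neighborSet v).Finite) {v w : V}
    (h : InfDir F v w) (hv : IsCore F v) : IsCore F w := by
  obtain ⟨w', hne, hw'⟩ : ∃ w', w' ≠ w ∧ InfDir F v w' := by
    obtain ⟨w₁, w₂, hne, h1, h2⟩ := hv
    by_cases hw : w₁ = w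
    · exact ⟨w₂, fun h => hne (hw.trans h.symm), h2⟩
    · exact ⟨w₁, hw, h1⟩
  obtain ⟨z, hz, hwz⟩ := exists_infDir_ne hlf h.2
  exact ⟨v, z, hz.symm, ⟨h.1.symm, hw'.2.mono (branch_subset hF hw'.1 hne)⟩, hwz⟩

/-- König's lemma: an infinite branch contains a semi-infinite path. -/
theorem InfDir.exists_ray (hF : F.IsAcyclic) (hlf : ∀ v, (F.neighborSet v).Finite) {v w : V}
    (h : InfDir F v w) : ∃ r : ℕ → V, Function.Injective r ∧ (∀ n, F.Adj (r n) (r (n + 1))) ∧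
      ∀ n, r n ∈ branch F v w := by
  let D := {p : V × V // InfDir F p.1 p.2}
  have step : ∀ p : D, ∃ q : D, q.1.1 = p.1.2 ∧ q.1.2 ≠ p.1.1 := fun p => by
    obtain ⟨z, hz, hwz⟩ := exists_infDir_ne hlf p.2.2
    exact ⟨⟨(p.1.2, z), hwz⟩, rfl, hz⟩
  choose f hf1 hf2 using step
  let d : ℕ → D := fun n => f^[n] ⟨(v, w), h⟩
  have hd : ∀ n, d (n + 1) = f (d n) := fun n => Function.iterate_succ_apply' f n _
  have hsub1 : ∀ n, branch F (d (n + 1)).1.1 (d (n + 1)).1.2 ⊆ branch F (d n).1.1 (d n).1.2 := by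
    intro n
    have h1 := branch_subset hF (d (n + 1)).2.1 (w' := (d n).1.1) (by rw [hd]; exact hf2 _)
    have h2 : (d (n + 1)).1.1 = (d n).1.2 := by rw [hd]; exact hf1 _
    rw [h2] at h1 ⊢
    exact h1
  have hsub : Antitone fun n => branch F (d n).1.1 (d n).1.2 := antitone_nat_of_succ_le hsub1
  refine ⟨fun n => (d n).1.2, ?_, fun n => ?_, fun n => ?_⟩
  · refine Function.Injective.of_lt_imp_ne fun m n hmn heq => ?_
    have h1 : (d n).1.2 ∈ branch F (d (m + 1)).1.1 (d (m + 1)).1.2 :=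
      hsub (Nat.succ_le_of_lt hmn) (mem_branch_self _ _)
    have h2 : (d (m + 1)).1.1 = (d m).1.2 := by rw [hd]; exact hf1 _
    have h3 := notMem_branch hF (d (m + 1)).2.1
    rw [h2] at h1 h3
    exact h3 (heq ▸ h1)
  · have h2 : (d (n + 1)).1.1 = (d n).1.2 := by rw [hd]; exact hf1 _
    have h3 := (d (n + 1)).2.1
    rwa [h2] at h3
  · exact hsub (Nat.zero_le n) (mem_branch_self _ _)

theorem IsCore.hasDisjointRays (hF : F.IsAcyclic) (hlf : ∀ v, (F.neighborSet v).Finite) {v : V}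
    (hv : IsCore F v) : HasDisjointRays F (F.connectedComponentMk v) 2 := by
  obtain ⟨w, w', hne, hw, hw'⟩ := hv
  obtain ⟨r, h1, h2, h3⟩ := hw.exists_ray hF hlf
  obtain ⟨r', h1', h2', h3'⟩ := hw'.exists_ray hF hlf
  have hd : Disjoint (Set.range r) (Set.range r') :=
    (disjoint_branch hF hw.1 hw'.1 hne).mono (by rintro _ ⟨n, rfl⟩; exact h3 n)
      (by rintro _ ⟨n, rfl⟩; exact h3' n)
  have hsupp : ∀ {u x}, F.Adj v u → x ∈ branch F v u → x ∈ (F.connectedComponentMk v).supp :=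
    fun hu hx => SimpleGraph.ConnectedComponent.sound
      (hu.reachable.trans (branch_subset_reachable hx)).symm
  refine ⟨![r, r'], fun i => ?_, fun i j hij => ?_⟩
  · fin_cases i
    · exact ⟨h1, h2, fun n => hsupp hw.1 (h3 n)⟩
    · exact ⟨h1', h2', fun n => hsupp hw'.1 (h3' n)⟩
  · fin_cases i <;> fin_cases j
    · exact absurd rfl hij
    · exact hd
    · exact hd.symm
    · exact absurd rfl hij

/-- The edge from `v` to `w` leads towards the end of the path `r`. -/
def Towards (F : SimpleGraph V) (r : ℕ → V) (v w : V) : Prop :=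
  F.Adj v w ∧ ∀ᶠ n in atTop, r n ∈ branch F v w

variable {r : ℕ → V} (hr : Function.Injective r) (hadj : ∀ n, F.Adj (r n) (r (n + 1)))

include hr hadj

theorem exists_towards {v : V} (hv : F.Reachable v (r 0)) : ∃ w, Towards F r v w := by
  have hreach : ∀ n, F.Reachable v (r n) := fun n => by
    induction n with
    | zero => exact hv
    | succ n ih => exact ih.trans (hadj n).reachable
  obtain ⟨m, hm⟩ : ∃ m, ∀ n ≥ m, r n ≠ v := by
    by_cases h : ∃ k, r k = v
    · obtain ⟨k, hk⟩ := h
      refine ⟨k + 1, fun n hn h' => ?_⟩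
      have := hr (h'.trans hk.symm)
      omega
    · push Not at h
      exact ⟨0, fun n _ => h n⟩
  rcases eq_or_mem_branch (hreach m) with h | ⟨z, hz, hmz⟩
  · exact absurd h (hm m le_rfl)
  · refine ⟨z, hz, eventually_atTop.2 ⟨m, fun n hn => ?_⟩⟩
    induction n, hn using Nat.le_induction with
    | base => exact hmz
    | succ n hn ih => exact mem_branch_of_adj ih (hadj n) (hm _ (by omega))

theorem towards_succ (n : ℕ) : Towards F r (r n) (r (n + 1)) := by
  refine ⟨hadj n, eventually_atTop.2 ⟨n + 1, fun m hm => ?_⟩⟩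
  induction m, hm using Nat.le_induction with
  | base => exact mem_branch_self _ _
  | succ m hm ih =>
    refine mem_branch_of_adj ih (hadj m) fun h => ?_
    have := hr h
    omega

omit hadj in
theorem Towards.infDir {v w : V} (h : Towards F r v w) : InfDir F v w := by
  refine ⟨h.1, ?_⟩
  obtain ⟨m, hm⟩ := eventually_atTop.1 h.2
  refine Set.infinite_of_injective_forall_mem (f := fun n => r (n + m)) ?_ fun n => hm _ (by omega)
  intro a b hab
  have := hr hab
  omega

omit hr hadj

theorem Towards.unique (hF : F.IsAcyclic) {v w w' : V} (h : Towards F r v w)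
    (h' : Towards F r v w') : w = w' := by
  by_contra hne
  obtain ⟨n, h1, h2⟩ := (h.2.and h'.2).exists
  exact Set.disjoint_left.1 (disjoint_branch hF h.1 h'.1 hne) h1 h2

theorem Towards.not_swap (hF : F.IsAcyclic) {v w : V} (h : Towards F r v w) :
    ¬ Towards F r w v := fun h' => by
  obtain ⟨n, h1, h2⟩ := (h.2.and h'.2).exists
  exact Set.disjoint_left.1 (disjoint_branch_swap hF h.1) h1 h2

/-- If the end of `r` is not beyond the edge from `v` to `w`, then it is beyond the reverse edge. -/
theorem Towards.of_ne (hF : F.IsAcyclic) {v w z : V} (hz : Towards F r v z) (hw : F.Adj v w)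
    (hne : z ≠ w) : Towards F r w v :=
  ⟨hw.symm, hz.2.mono fun _ h => branch_subset hF hz.1 hne h⟩

/-- Following the edges towards the end of `r`, any two vertices of a component meet. -/
theorem exists_iterate_eq (hF : F.IsAcyclic) {δ : V → V} {c : V}
    (hδ : ∀ v, F.Reachable c v → Towards F r v (δ v)) {x y : V} (hx : F.Reachable c x)
    (hxy : F.Reachable x y) : ∃ k l, δ^[k] x = δ^[l] y := by
  refine (reachable_induction (p := fun y => F.Reachable x y ∧ ∃ k l, δ^[k] x = δ^[l] y) hxy
    ⟨.rfl, 0, 0, rfl⟩ ?_).2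
  rintro y z ⟨hy, k, l, hkl⟩ hyz
  refine ⟨hy.trans hyz.reachable, ?_⟩
  have hyδ := hδ y (hx.trans hy)
  by_cases h : δ y = z
  · cases l with
    | zero =>
      refine ⟨k + 1, 0, ?_⟩
      rw [Function.iterate_succ_apply', hkl]
      exact h
    | succ l =>
      refine ⟨k, l, ?_⟩
      rw [hkl, Function.iterate_succ_apply, h]
  · have hzy : δ z = y :=
      (hδ z (hx.trans (hy.trans hyz.reachable))).unique hF (hyδ.of_ne hF hyz h)
    refine ⟨k, l + 1, ?_⟩
    rw [hkl, Function.iterate_succ_apply, hzy]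

/-- Two disjoint semi-infinite paths: the second one leaves the direction of the first. -/
theorem exists_ne_of_disjoint (hF : F.IsAcyclic) {r r' : ℕ → V} {δ : V → V}
    (hδ : ∀ v, F.Reachable (r 0) v → Towards F r v (δ v)) (hr : Function.Injective r)
    (hadj : ∀ n, F.Adj (r n) (r (n + 1))) (hreach : ∀ n, F.Reachable (r 0) (r' n))
    (hdisj : ∀ m n, r m ≠ r' n) : ∃ n, r' (n + 1) ≠ δ (r' n) := by
  by_contra! hcon
  have hreach0 : ∀ n, F.Reachable (r 0) (r n) := fun n => by
    induction n with
    | zero => exact .rfl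
    | succ n ih => exact ih.trans (hadj n).reachable
  have h0 : ∀ n, δ^[n] (r 0) = r n := fun n => by
    induction n with
    | zero => rfl
    | succ n ih =>
      rw [Function.iterate_succ_apply', ih]
      exact (hδ _ (hreach0 n)).unique hF (towards_succ hr hadj n)
  have h1 : ∀ n, δ^[n] (r' 0) = r' n := fun n => by
    induction n with
    | zero => rfl
    | succ n ih => rw [Function.iterate_succ_apply', ih, hcon n]
  obtain ⟨k, l, hkl⟩ := exists_iterate_eq hF hδ (x := r 0) (y := r' 0) .rfl (hreach 0)
  rw [h0, h1] at hkl
  exact hdisj k l hkl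

theorem exists_towards_fun {r : ℕ → V} (hr : Function.Injective r)
    (hadj : ∀ n, F.Adj (r n) (r (n + 1))) :
    ∃ δ : V → V, ∀ v, F.Reachable (r 0) v → Towards F r v (δ v) := by
  choose! δ hδ using fun v (hv : F.Reachable (r 0) v) => exists_towards hr hadj hv.symm
  exact ⟨δ, hδ⟩

theorem exists_isCore_of_hasDisjointRays (hF : F.IsAcyclic) {c : F.ConnectedComponent}
    (h : HasDisjointRays F c 2) : ∃ v ∈ c.supp, IsCore F v := by
  obtain ⟨r, hr, hdisj⟩ := h
  have hreach : ∀ i j m n, F.Reachable (r i m) (r j n) := fun i j m n =>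
    SimpleGraph.ConnectedComponent.exact (((hr i).2.2 m).trans ((hr j).2.2 n).symm)
  obtain ⟨δ, hδ⟩ := exists_towards_fun (hr 0).1 (hr 0).2.1
  obtain ⟨n, hn⟩ := exists_ne_of_disjoint hF hδ (hr 0).1 (hr 0).2.1 (fun n => hreach 0 1 0 n)
    fun m n h => Set.disjoint_left.1 (hdisj (show (0 : Fin 2) ≠ 1 by decide)) ⟨m, rfl⟩ ⟨n, h.symm⟩
  exact ⟨r 1 n, (hr 1).2.2 n, _, _, hn, (towards_succ (hr 1).1 (hr 1).2.1 n).infDir (hr 1).1,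
    (hδ _ (hreach 0 1 0 n)).infDir (hr 0).1⟩

/-- Three disjoint semi-infinite paths force a trifurcation: otherwise the vertices with an
infinite branch not leading to the first path form a line, on which the other two meet. -/
theorem exists_isTrifurcation_of_hasDisjointRays (hF : F.IsAcyclic) {c : F.ConnectedComponent}
    (h : HasDisjointRays F c 3) : ∃ v ∈ c.supp, IsTrifurcation F v := by
  obtain ⟨r, hr, hdisj⟩ := h
  have hreach : ∀ i j m n, F.Reachable (r i m) (r j n) := fun i j m n =>
    SimpleGraph.ConnectedComponent.exact (((hr i).2.2 m).trans ((hr j).2.2 n).symm)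
  have hdisj' : ∀ i j, i ≠ j → ∀ m n, r i m ≠ r j n := fun i j hij m n h =>
    Set.disjoint_left.1 (hdisj hij) ⟨m, rfl⟩ ⟨n, h.symm⟩
  obtain ⟨δ, hδ⟩ := exists_towards_fun (hr 0).1 (hr 0).2.1
  by_contra! hcon
  let B : Set V := {u | F.Reachable (r 0 0) u ∧ ∃ w, w ≠ δ u ∧ InfDir F u w}
  have hBδ : ∀ u ∈ B, δ u ∈ B ∧ InfDir F (δ u) u ∧ u ≠ δ (δ u) := by
    rintro u ⟨hu, w, hw, huw⟩
    have h1 := hδ u hu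
    have h2 : F.Reachable (r 0 0) (δ u) := hu.trans h1.1.reachable
    have h3 : InfDir F (δ u) u := ⟨h1.1.symm, huw.2.mono (branch_subset hF huw.1 hw)⟩
    have h4 : u ≠ δ (δ u) := fun h => h1.not_swap hF (by
      have := hδ _ h2
      rwa [← h] at this)
    exact ⟨⟨h2, u, h4, h3⟩, h3, h4⟩
  have hinj : ∀ k, ∀ u ∈ B, ∀ u' ∈ B, δ^[k] u = δ^[k] u' → u = u' := by
    intro k
    induction k with
    | zero => exact fun u _ u' _ h => h
    | succ k ih =>
      intro u hu u' hu' h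
      rw [Function.iterate_succ_apply, Function.iterate_succ_apply] at h
      have h1 := ih _ (hBδ u hu).1 _ (hBδ u' hu').1 h
      by_contra hne
      obtain ⟨h2, h3, h4⟩ := hBδ u hu
      obtain ⟨-, h3', h4'⟩ := hBδ u' hu'
      rw [← h1] at h3' h4'
      refine hcon (δ u) ?_ ⟨u, u', δ (δ u), hne, h4, h4', h3, h3', (hδ _ h2.1).infDir (hr 0).1⟩
      exact ((SimpleGraph.ConnectedComponent.sound h2.1).symm.trans ((hr 0).2.2 0))
  have htail : ∀ i, i ≠ 0 → ∃ n, ∀ m ≥ n, r i m ∈ B ∧ δ (r i (m + 1)) = r i m := by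
    intro i hi
    obtain ⟨n, hn⟩ := exists_ne_of_disjoint hF hδ (hr 0).1 (hr 0).2.1 (fun n => hreach 0 i 0 n)
      (hdisj' 0 i hi.symm)
    have key : ∀ m ≥ n, r i (m + 1) ≠ δ (r i m) := by
      intro m hm
      induction m, hm using Nat.le_induction with
      | base => exact hn
      | succ m hm ih =>
        have h1 := (hδ _ (hreach 0 i 0 m)).of_ne hF ((hr i).2.1 m) ih.symm
        rw [(hδ _ (hreach 0 i 0 (m + 1))).unique hF h1]
        intro h
        have := (hr i).1 h
        omega
    refine ⟨n, fun m hm => ⟨⟨hreach 0 i 0 m, _, key m hm,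
      (towards_succ (hr i).1 (hr i).2.1 m).infDir (hr i).1⟩, ?_⟩⟩
    exact (hδ _ (hreach 0 i 0 (m + 1))).unique hF
      ((hδ _ (hreach 0 i 0 m)).of_ne hF ((hr i).2.1 m) (key m hm).symm)
  have hback : ∀ i n, (∀ m ≥ n, r i m ∈ B ∧ δ (r i (m + 1)) = r i m) →
      ∀ k, δ^[k] (r i (n + k)) = r i n := by
    intro i n h k
    induction k with
    | zero => rfl
    | succ k ih =>
      rw [Function.iterate_succ_apply, ← Nat.add_assoc, (h (n + k) (by omega)).2, ih]
  have hmeet : ∀ i j n n', i ≠ j → (∀ m ≥ n, r i m ∈ B ∧ δ (r i (m + 1)) = r i m) →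
      (∀ m ≥ n', r j m ∈ B ∧ δ (r j (m + 1)) = r j m) →
      ∀ k d, δ^[k] (r i n) ≠ δ^[k + d] (r j n') := by
    intro i j n n' hij hi hj k d h
    have hBit : ∀ d, δ^[d] (r j n') ∈ B := fun d => by
      induction d with
      | zero => exact (hj n' le_rfl).1
      | succ d ih => rw [Function.iterate_succ_apply']; exact (hBδ _ ih).1
    rw [Function.iterate_add_apply] at h
    have h1 := hinj k _ (hi n le_rfl).1 _ (hBit d) h
    rw [← hback i n hi d] at h1
    exact hdisj' i j hij _ _ (hinj d _ (hi _ (by omega)).1 _ (hj n' le_rfl).1 h1)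
  obtain ⟨n₁, hn₁⟩ := htail 1 (by decide)
  obtain ⟨n₂, hn₂⟩ := htail 2 (by decide)
  obtain ⟨k, l, hkl⟩ := exists_iterate_eq hF hδ (x := r 1 n₁) (y := r 2 n₂) (hreach 0 1 0 n₁)
    (hreach 1 2 n₁ n₂)
  rcases le_total k l with h | h
  · obtain ⟨d, rfl⟩ := Nat.exists_eq_add_of_le h
    exact hmeet 1 2 n₁ n₂ (by decide) hn₁ hn₂ k d hkl
  · obtain ⟨d, rfl⟩ := Nat.exists_eq_add_of_le h
    exact hmeet 2 1 n₂ n₁ (by decide) hn₂ hn₁ l d hkl.symm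

theorem HasDisjointRays.mono {c : F.ConnectedComponent} {k l : ℕ} (hkl : k ≤ l)
    (h : HasDisjointRays F c l) : HasDisjointRays F c k := by
  obtain ⟨r, hr, hd⟩ := h
  exact ⟨fun i => r (Fin.castLE hkl i), fun i => hr _, fun i j hij =>
    hd fun h => hij (Fin.castLE_injective hkl h)⟩

theorem hasDisjointRays_of_numEnds_eq_two {c : F.ConnectedComponent} (h : numEnds F c = 2) :
    HasDisjointRays F c 2 := by
  by_contra hcon
  have : numEnds F c ≤ 1 := by
    refine iSup₂_le fun k hk => ?_
    have : k ≤ 1 := by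
      by_contra hk1
      exact hcon (hk.mono (by omega))
    exact_mod_cast this
  rw [h] at this
  exact absurd this (by decide)

theorem numEnds_eq_two {c : F.ConnectedComponent} (h2 : HasDisjointRays F c 2)
    (h3 : ¬ HasDisjointRays F c 3) : numEnds F c = 2 := by
  refine le_antisymm (iSup₂_le fun k hk => ?_) (le_iSup₂_of_le 2 h2 le_rfl)
  have : k ≤ 2 := by
    by_contra hk2
    exact h3 (hk.mono (by omega))
  exact_mod_cast this

end Branches

/-! ### The Burton–Keane estimate -/

section Counting

variable {V : Type*} {F : SimpleGraph V}

open Classical in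
/-- A forest on `A` has at most `|A|` edges, so its degrees sum to at most `2 |A|`. -/
theorem sum_card_adj_le (hF : F.IsAcyclic) (A : Finset V) :
    ∑ v ∈ A, {w ∈ A | F.Adj v w}.card ≤ 2 * A.card := by
  rcases A.eq_empty_or_nonempty with rfl | hA
  · simp
  have hne : Nonempty (A : Set V) := hA.to_subtype
  obtain ⟨T, hT, -, hTree⟩ :=
    (SimpleGraph.connected_top (V := (A : Set V))).exists_isTree_le_of_le_of_isAcyclic
    le_top (hF.induce (A : Set V))
  have h1 := (F.induce (A : Set V)).sum_degrees_eq_twice_card_edges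
  have h2 := hTree.card_edgeFinset
  have h3 : (F.induce (A : Set V)).edgeFinset.card ≤ T.edgeFinset.card :=
    Finset.card_le_card (SimpleGraph.edgeFinset_mono hT)
  have h4 : Fintype.card (A : Set V) = A.card := by simp
  have h5 : ∑ v ∈ A, {w ∈ A | F.Adj v w}.card = ∑ v, (F.induce (A : Set V)).degree v := by
    rw [← Finset.sum_coe_sort A]
    refine Finset.sum_congr rfl fun v _ => ?_
    rw [← SimpleGraph.card_neighborFinset_eq_degree]
    symm
    refine Finset.card_bij (fun w _ => (w : V)) ?_ (fun _ _ _ _ h => Subtype.ext h) ?_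
    · intro w hw
      exact Finset.mem_filter.2
        ⟨w.2, (SimpleGraph.mem_neighborFinset (F.induce (A : Set V)) v w).1 hw⟩
    · intro w hw
      obtain ⟨hwA, hw⟩ := Finset.mem_filter.1 hw
      exact ⟨⟨w, hwA⟩, (SimpleGraph.mem_neighborFinset _ _ _).2 hw, rfl⟩
  rw [h5, h1]
  omega

open Classical in
/-- The Burton–Keane estimate: inside `K`, the vertices with two infinite branches span a forest in
which a vertex off the boundary has degree at least two, and at least three at a trifurcation. -/
theorem card_trifurcation_le {G : SimpleGraph V} (hF : F.IsAcyclic) (hFG : F ≤ G)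
    (hlf : ∀ v, (G.neighborSet v).Finite) (K : Finset V) :
    {v ∈ K | IsTrifurcation F v}.card ≤ 3 * (bdry G K).ncard := by
  have hlf' : ∀ v, (F.neighborSet v).Finite := fun v => (hlf v).subset fun w h => hFG h
  have hcore : ∀ v, IsTrifurcation F v → IsCore F v := fun v ⟨a, b, _, hab, _, _, ha, hb, _⟩ =>
    ⟨a, b, hab, ha, hb⟩
  set A : Finset V := {v ∈ K | IsCore F v} with hA
  have key : ∀ v ∈ A, 2 + (if IsTrifurcation F v then 1 else 0) ≤
      {w ∈ A | F.Adj v w}.card + 3 * if v ∈ bdry G K then 1 else 0 := by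
    intro v hv
    obtain ⟨hvK, hvc⟩ := Finset.mem_filter.1 hv
    by_cases hb : v ∈ bdry G K
    · simp only [hb, if_true]
      split_ifs <;> omega
    · simp only [hb, if_false]
      have hmem : ∀ w, InfDir F v w → w ∈ ({w ∈ A | F.Adj v w} : Finset V) := by
        intro w hw
        refine Finset.mem_filter.2 ⟨Finset.mem_filter.2 ⟨?_, hw.isCore hF hlf' hvc⟩, hw.1⟩
        by_contra hwK
        exact hb ⟨hvK, w, hwK, hFG hw.1⟩
      split_ifs with htri
      · obtain ⟨a, b, c, hab, hac, hbc, ha, hb', hc⟩ := htri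
        have : ({a, b, c} : Finset V) ⊆ {w ∈ A | F.Adj v w} := by
          intro w hw
          simp only [Finset.mem_insert, Finset.mem_singleton] at hw
          rcases hw with rfl | rfl | rfl
          exacts [hmem _ ha, hmem _ hb', hmem _ hc]
        have h1 := Finset.card_le_card this
        rw [Finset.card_eq_three.2 ⟨a, b, c, hab, hac, hbc, rfl⟩] at h1
        omega
      · obtain ⟨a, b, hab, ha, hb'⟩ := hvc
        have : ({a, b} : Finset V) ⊆ {w ∈ A | F.Adj v w} := by
          intro w hw
          simp only [Finset.mem_insert, Finset.mem_singleton] at hw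
          rcases hw with rfl | rfl
          exacts [hmem _ ha, hmem _ hb']
        have h1 := Finset.card_le_card this
        rw [Finset.card_pair hab] at h1
        omega
  have h1 := Finset.sum_le_sum key
  rw [Finset.sum_add_distrib, Finset.sum_add_distrib, Finset.sum_const, ← Finset.mul_sum,
    ← Finset.card_filter, ← Finset.card_filter] at h1
  have h2 := sum_card_adj_le hF A
  have h3 : ({v ∈ A | IsTrifurcation F v} : Finset V) = {v ∈ K | IsTrifurcation F v} := by
    ext v
    simp only [hA, Finset.mem_filter]
    exact ⟨fun h => ⟨h.1.1, h.2⟩, fun h => ⟨⟨h.1, hcore v h.2⟩, h.2⟩⟩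
  have h4 : ({v ∈ A | v ∈ bdry G K} : Finset V).card ≤ (bdry G K).ncard := by
    rw [ncard_bdry]
    exact Finset.card_le_card (Finset.filter_subset_filter _ (Finset.filter_subset _ _))
  rw [h3] at h1
  rw [smul_eq_mul] at h1
  omega

end Counting

/-! ### Branches under isomorphisms -/

section Isomorphism

variable {V V' : Type*} {F : SimpleGraph V} {F' : SimpleGraph V'}

theorem map_mem_branch (φ : F ≃g F') {v w x : V} (h : x ∈ branch F v w) :
    φ x ∈ branch F' (φ v) (φ w) := by
  refine reachable_induction (p := fun x => φ x ∈ branch F' (φ v) (φ w)) h (mem_branch_self _ _) ?_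
  intro x y hx hxy
  obtain ⟨h1, h2⟩ := SimpleGraph.deleteEdges_adj.1 hxy
  refine SimpleGraph.Reachable.trans hx
    (SimpleGraph.Adj.reachable (SimpleGraph.deleteEdges_adj.2 ⟨φ.map_rel_iff.2 h1, fun h => h2 ?_⟩))
  have h3 : Sym2.map φ s(x, y) = Sym2.map φ s(v, w) := h
  exact Sym2.map.injective φ.injective h3

theorem InfDir.map (φ : F ≃g F') {v w : V} (h : InfDir F v w) : InfDir F' (φ v) (φ w) :=
  ⟨φ.map_rel_iff.2 h.1, (h.2.image φ.injective.injOn).mono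
    (by rintro _ ⟨x, hx, rfl⟩; exact map_mem_branch φ hx)⟩

theorem IsCore.map (φ : F ≃g F') {v : V} (h : IsCore F v) : IsCore F' (φ v) := by
  obtain ⟨a, b, hab, ha, hb⟩ := h
  exact ⟨φ a, φ b, φ.injective.ne hab, ha.map φ, hb.map φ⟩

theorem isCore_map_iff (φ : F ≃g F') {v : V} : IsCore F' (φ v) ↔ IsCore F v := by
  refine ⟨fun h => ?_, fun h => h.map φ⟩
  have := h.map φ.symm
  rwa [φ.symm_apply_apply] at this

theorem IsTrifurcation.map (φ : F ≃g F') {v : V} (h : IsTrifurcation F v) :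
    IsTrifurcation F' (φ v) := by
  obtain ⟨a, b, c, hab, hac, hbc, ha, hb, hc⟩ := h
  exact ⟨φ a, φ b, φ c, φ.injective.ne hab, φ.injective.ne hac, φ.injective.ne hbc, ha.map φ,
    hb.map φ, hc.map φ⟩

theorem isTrifurcation_map_iff (φ : F ≃g F') {v : V} :
    IsTrifurcation F' (φ v) ↔ IsTrifurcation F v := by
  refine ⟨fun h => ?_, fun h => h.map φ⟩
  have := h.map φ.symm
  rwa [φ.symm_apply_apply] at this

end Isomorphism

/-! ### Measurability of infinite branches -/

section BranchMeasurability

variable {V : Type*} [Countable V] {G : SimpleGraph V}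

open Classical in
/-- The configuration with the edge between `v` and `w`, if there is one, closed. -/
noncomputable def closeEdge (v w : V) (ω : Config G) : Config G :=
  fun e => if (e : Sym2 V) = s(v, w) then false else ω e

omit [Countable V] in
theorem toGraph_closeEdge (v w : V) (ω : Config G) :
    toGraph (closeEdge v w ω) = (toGraph ω).deleteEdges {s(v, w)} := by
  ext a b
  rw [SimpleGraph.deleteEdges_adj, toGraph_adj, toGraph_adj, Set.mem_singleton_iff]
  constructor
  · rintro ⟨h1, h2⟩
    by_cases h : s(a, b) = s(v, w)
    · simp [closeEdge, h] at h2
    · simp only [closeEdge, h, if_false] at h2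
      exact ⟨⟨h1, h2⟩, h⟩
  · rintro ⟨⟨h1, h2⟩, h⟩
    exact ⟨h1, by simpa only [closeEdge, h, if_false] using h2⟩

omit [Countable V] in
theorem measurable_closeEdge (v w : V) : Measurable (closeEdge (G := G) v w) := by
  refine measurable_pi_lambda _ fun e => ?_
  by_cases h : (e : Sym2 V) = s(v, w)
  · simp only [closeEdge, h, if_true]; exact measurable_const
  · simp only [closeEdge, h, if_false]; exact measurable_pi_apply _

theorem measurableSet_mem_branch (v w x : V) :
    MeasurableSet {ω : Config G | x ∈ branch (toGraph ω) v w} := by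
  have h := measurable_closeEdge (G := G) v w (measurableSet_reachable w x)
  have h2 : {ω : Config G | x ∈ branch (toGraph ω) v w} =
      closeEdge v w ⁻¹' {ω | (toGraph ω).Reachable w x} := by
    ext ω
    rw [Set.mem_preimage, Set.mem_ofPred_eq, Set.mem_ofPred_eq, toGraph_closeEdge]
    rfl
  rwa [h2]

theorem measurableSet_infinite {Ω : Type*} [MeasurableSpace Ω] {A : Ω → Set V}
    (h : ∀ x, MeasurableSet {ω | x ∈ A ω}) : MeasurableSet {ω | (A ω).Infinite} := by
  have h2 : {ω | (A ω).Infinite} = {ω | ∀ s : Finset V, ∃ x, x ∈ A ω ∧ x ∉ s} := by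
    ext ω
    exact ⟨fun h s => h.exists_notMem_finset s, fun h hfin => by
      obtain ⟨x, hx, hxs⟩ := h hfin.toFinset
      exact hxs (hfin.mem_toFinset.2 hx)⟩
  rw [h2]
  refine measurableSet_setOfPred.2 (Measurable.forall fun s => Measurable.exists fun x => ?_)
  exact (measurableSet_setOfPred.1 (h x)).and measurable_const

theorem measurableSet_branch_infinite (v w : V) :
    MeasurableSet {ω : Config G | (branch (toGraph ω) v w).Infinite} :=
  measurableSet_infinite (measurableSet_mem_branch v w)

theorem measurableSet_infDir (v w : V) : MeasurableSet {ω : Config G | InfDir (toGraph ω) v w} :=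
  (measurableSet_adj v w).inter (measurableSet_branch_infinite v w)

theorem measurableSet_isCore (v : V) : MeasurableSet {ω : Config G | IsCore (toGraph ω) v} := by
  have h := fun w => measurableSet_setOfPred.1 (measurableSet_infDir (G := G) v w)
  exact measurableSet_setOfPred.2 (Measurable.exists fun a => Measurable.exists fun b =>
    measurable_const.and ((h a).and (h b)))

theorem measurableSet_isTrifurcation (v : V) :
    MeasurableSet {ω : Config G | IsTrifurcation (toGraph ω) v} := by
  have h := fun w => measurableSet_setOfPred.1 (measurableSet_infDir (G := G) v w)
  exact measurableSet_setOfPred.2 (Measurable.exists fun a => Measurable.exists fun b =>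
    Measurable.exists fun c => measurable_const.and (measurable_const.and (measurable_const.and
      ((h a).and ((h b).and (h c))))))

omit [Countable V] in
theorem isEssentialSpanningForest_iff {F : SimpleGraph V} : IsEssentialSpanningForest F ↔
    F.IsAcyclic ∧ ∀ v, {x | F.Reachable v x}.Infinite := by
  refine and_congr_right fun _ => ?_
  have hs : ∀ v, (F.connectedComponentMk v).supp = {x | F.Reachable v x} := fun v => by
    ext x
    rw [SimpleGraph.ConnectedComponent.mem_supp_iff, SimpleGraph.ConnectedComponent.eq]
    exact F.reachable_comm
  constructor
  · intro h v
    rw [← hs]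
    exact h _
  · intro h c
    induction c using SimpleGraph.ConnectedComponent.ind with
    | _ v => rw [hs]; exact h v

omit [Countable V] in
theorem isAcyclic_iff_notMem_branch {F : SimpleGraph V} :
    F.IsAcyclic ↔ ∀ v w, F.Adj v w → v ∉ branch F v w :=
  ⟨fun h _ _ hvw => notMem_branch h hvw, fun h =>
    isAcyclic_of_forall_not_reachable fun u w huw hr => h u w huw hr.symm⟩

theorem measurableSet_isEssentialSpanningForest :
    MeasurableSet {ω : Config G | IsEssentialSpanningForest (toGraph ω)} := by
  have h : {ω : Config G | IsEssentialSpanningForest (toGraph ω)} =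
      {ω : Config G | (∀ v w, (toGraph ω).Adj v w → v ∉ branch (toGraph ω) v w) ∧
        ∀ v, {x | (toGraph ω).Reachable v x}.Infinite} := by
    ext ω
    exact isEssentialSpanningForest_iff.trans (and_congr_left' isAcyclic_iff_notMem_branch)
  rw [h]
  refine measurableSet_setOfPred.2 (.and (Measurable.forall fun v => Measurable.forall fun w =>
    (measurableSet_setOfPred.1 (measurableSet_adj v w)).imp
      (measurableSet_setOfPred.1 (measurableSet_mem_branch v w v)).not) (Measurable.forall fun v => ?_))
  exact measurableSet_setOfPred.1 (measurableSet_infinite fun x => measurableSet_reachable v x)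

/-- An invariant measure on essential spanning forests of an amenable graph does not charge forests
with trifurcations. -/
theorem ae_not_isTrifurcation (hconn : G.Connected) (hlf : ∀ v, (G.neighborSet v).Finite)
    (hamen : IsAmenable G) {Γ : Subgroup (G ≃g G)} (hΓ : IsQuasitransitive G Γ)
    {μ : Measure (Config G)} [IsProbabilityMeasure μ] (hinv : IsInvariant Γ μ)
    (hforest : ∀ᵐ ω ∂μ, (toGraph ω).IsAcyclic) :
    ∀ᵐ ω ∂μ, ∀ v, ¬ IsTrifurcation (toGraph ω) v := by
  classical
  obtain ⟨K, hK, hfol⟩ := hamen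
  have hmeas := measurableSet_isTrifurcation (G := G)
  have ha : InvariantFun Γ fun v => μ.real {ω | IsTrifurcation (toGraph ω) v} := by
    intro γ hγ v
    have h1 := map_measureReal_apply (μ := μ) (measurable_translate γ) (hmeas (γ v))
    rw [hinv γ hγ] at h1
    have h2 : translate γ ⁻¹' {ω | IsTrifurcation (toGraph ω) (γ v)} =
        {ω | IsTrifurcation (toGraph ω) v} := by
      ext ω
      exact isTrifurcation_map_iff (translateIso γ ω)
    rw [h2] at h1
    exact h1
  have hC : ∀ n, ∑ v ∈ K n, μ.real {ω | IsTrifurcation (toGraph ω) v} ≤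
      3 * (bdry G (K n)).ncard := by
    intro n
    have h1 : ∑ v ∈ K n, μ.real {ω | IsTrifurcation (toGraph ω) v} =
        ∫ ω, ∑ v ∈ K n, ind (IsTrifurcation (toGraph ω) v) ∂μ := by
      rw [integral_finsetSum _ fun v _ => integrable_ind (hmeas v)]
      exact Finset.sum_congr rfl fun v _ => (integral_ind (hmeas v)).symm
    have h2 : ∫ _, (3 * (bdry G (K n)).ncard : ℝ) ∂μ = 3 * (bdry G (K n)).ncard := by simp
    rw [h1, ← h2]
    refine integral_mono_ae (integrable_finsetSum _ fun v _ => integrable_ind (hmeas v))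
      (integrable_const _) ?_
    filter_upwards [hforest] with ω hω
    have h3 := card_trifurcation_le hω (toGraph_le ω) hlf (K n)
    have h4 : ∑ v ∈ K n, ind (IsTrifurcation (toGraph ω) v) =
        ({v ∈ K n | IsTrifurcation (toGraph ω) v}.card : ℝ) := by
      rw [Finset.card_filter]
      push_cast
      refine Finset.sum_congr rfl fun v _ => ?_
      by_cases h : IsTrifurcation (toGraph ω) v <;> simp [ind, h]
    rw [h4]
    exact_mod_cast h3
  refine ae_all_iff.2 fun v => ?_
  have h := ha.eq_zero hconn hlf hΓ hK hfol (fun _ => measureReal_nonneg) hC v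
  have h0 : μ {ω | IsTrifurcation (toGraph ω) v} = 0 := (measureReal_eq_zero_iff).1 h
  exact measure_eq_zero_iff_ae_notMem.1 h0

end BranchMeasurability

/-! ### Attaching a pendant finite tree -/

section Pendant

variable {V : Type*} {f : SimpleGraph V} {v u : V}

/-- The graph `f` with the edge between `v` and `u` added. When the component of `v` in `f` is finite
and does not contain `u`, this hangs a finite tree on the vertex `u`. -/
def attach (f : SimpleGraph V) (v u : V) : SimpleGraph V := f ⊔ SimpleGraph.edge v u

theorem attach_adj (hne : v ≠ u) {x y : V} :
    (attach f v u).Adj x y ↔ f.Adj x y ∨ s(x, y) = s(v, u) := by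
  rw [attach, SimpleGraph.sup_adj, SimpleGraph.edge_adj, Sym2.eq_iff]
  refine or_congr_right ⟨fun h => h.1, fun h => ⟨h, ?_⟩⟩
  rcases h with ⟨rfl, rfl⟩ | ⟨rfl, rfl⟩
  exacts [hne, hne.symm]

theorem attach_adj_self (hne : v ≠ u) : (attach f v u).Adj v u := (attach_adj hne).2 (Or.inr rfl)

theorem le_attach : f ≤ attach f v u := le_sup_left

theorem ne_of_not_reachable (hu : ¬ f.Reachable v u) : v ≠ u := by
  rintro rfl
  exact hu .rfl

/-- Adding a pendant tree does not create connections between the other vertices. -/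
theorem attach_reachable_iff (hu : ¬ f.Reachable v u) {x y : V} (hx : ¬ f.Reachable v x)
    (hy : ¬ f.Reachable v y) : (attach f v u).Reachable x y ↔ f.Reachable x y := by
  refine ⟨fun h => ?_, fun h => h.mono le_attach⟩
  refine (reachable_induction (p := fun z => (¬ f.Reachable v z → f.Reachable x z) ∧
    (f.Reachable v z → f.Reachable x u)) h ⟨fun _ => .rfl, fun h => absurd h hx⟩ ?_).1 hy
  rintro z z' ⟨h1, h2⟩ hzz'
  rcases (attach_adj (ne_of_not_reachable hu)).1 hzz' with h | h
  · by_cases hz : f.Reachable v z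
    · exact ⟨fun hz' => absurd (hz.trans h.reachable) hz', fun _ => h2 hz⟩
    · exact ⟨fun _ => (h1 hz).trans h.reachable,
        fun hz' => absurd (hz'.trans h.symm.reachable) hz⟩
  · rcases Sym2.eq_iff.1 h with ⟨rfl, rfl⟩ | ⟨rfl, rfl⟩
    · exact ⟨fun _ => h2 .rfl, fun h => absurd h hu⟩
    · exact ⟨fun h => absurd .rfl h, fun _ => h1 hu⟩

theorem attach_deleteEdges (hu : ¬ f.Reachable v u) :
    (attach f v u).deleteEdges {s(v, u)} = f := by
  ext x y
  rw [SimpleGraph.deleteEdges_adj, attach_adj (ne_of_not_reachable hu), Set.mem_singleton_iff]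
  refine ⟨fun h => h.1.resolve_right h.2, fun h => ⟨Or.inl h, fun h' => hu ?_⟩⟩
  rw [← SimpleGraph.mem_edgeSet, h', SimpleGraph.mem_edgeSet] at h
  exact h.reachable

theorem branch_attach (hu : ¬ f.Reachable v u) :
    branch (attach f v u) u v = {x | f.Reachable v x} := by
  rw [branch, Sym2.eq_swap, attach_deleteEdges hu]

theorem deleteEdges_attach {F : SimpleGraph V} (h : F.Adj v u) :
    attach (F.deleteEdges {s(v, u)}) v u = F := by
  ext x y
  rw [attach_adj h.ne, SimpleGraph.deleteEdges_adj, Set.mem_singleton_iff]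
  by_cases hxy : s(x, y) = s(v, u)
  · refine ⟨fun _ => ?_, fun _ => Or.inr hxy⟩
    rwa [← SimpleGraph.mem_edgeSet, hxy, SimpleGraph.mem_edgeSet]
  · exact ⟨fun h => (h.resolve_right hxy).1, fun h => Or.inl ⟨h, hxy⟩⟩

theorem mem_branch_attach_iff (hu : ¬ f.Reachable v u) {x y z : V} (hx : ¬ f.Reachable v x)
    (hxy : f.Adj x y) (hz : ¬ f.Reachable v z) :
    z ∈ branch (attach f v u) x y ↔ z ∈ branch f x y := by
  have hy : ¬ f.Reachable v y := fun h => hx (h.trans hxy.symm.reachable)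
  have hne : s(x, y) ≠ s(v, u) := fun h => by
    rcases Sym2.eq_iff.1 h with ⟨rfl, -⟩ | ⟨-, rfl⟩
    · exact hx .rfl
    · exact hy .rfl
  have heq : (attach f v u).deleteEdges {s(x, y)} = attach (f.deleteEdges {s(x, y)}) v u := by
    ext a b
    rw [SimpleGraph.deleteEdges_adj, attach_adj (ne_of_not_reachable hu),
      attach_adj (ne_of_not_reachable hu), SimpleGraph.deleteEdges_adj, Set.mem_singleton_iff]
    constructor
    · rintro ⟨h1 | h1, h2⟩
      exacts [Or.inl ⟨h1, h2⟩, Or.inr h1]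
    · rintro (⟨h1, h2⟩ | h1)
      exacts [⟨Or.inl h1, h2⟩, ⟨Or.inr h1, fun h => hne (h.symm.trans h1)⟩]
  have hle : ∀ {a}, ¬ f.Reachable v a → ¬ (f.deleteEdges {s(x, y)}).Reachable v a :=
    fun h h' => h (h'.mono (SimpleGraph.deleteEdges_le _))
  simp only [branch, Set.mem_ofPred_eq, heq]
  exact attach_reachable_iff (hle hu) (hle hy) (hle hz)

theorem infDir_attach_iff (hu : ¬ f.Reachable v u) (hfin : {x | f.Reachable v x}.Finite) {x y : V}
    (hx : ¬ f.Reachable v x) : InfDir (attach f v u) x y ↔ InfDir f x y := by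
  have hinf : ∀ {B C : Set V}, (∀ z, ¬ f.Reachable v z → z ∈ B → z ∈ C) → B.Infinite →
      C.Infinite := fun {B C} h hB hC => hB ((hC.union hfin).subset fun z hz => by
    by_cases hz' : f.Reachable v z
    · exact Or.inr hz'
    · exact Or.inl (h z hz' hz))
  constructor
  · rintro ⟨h1, h2⟩
    rcases (attach_adj (ne_of_not_reachable hu)).1 h1 with h1 | h1
    · exact ⟨h1, hinf (fun z hz => (mem_branch_attach_iff hu hx h1 hz).1) h2⟩
    · rcases Sym2.eq_iff.1 h1 with ⟨rfl, -⟩ | ⟨rfl, rfl⟩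
      · exact absurd .rfl hx
      · rw [branch_attach hu] at h2
        exact absurd hfin h2
  · rintro ⟨h1, h2⟩
    exact ⟨le_attach h1, hinf (fun z hz => (mem_branch_attach_iff hu hx h1 hz).2) h2⟩

theorem not_isCore_of_finite (hfin : {x | f.Reachable v x}.Finite) {x : V}
    (hx : f.Reachable v x) : ¬ IsCore f x := by
  rintro ⟨a, -, -, ha, -⟩
  exact ha.2 (hfin.subset fun z hz =>
    hx.trans (ha.1.reachable.trans (branch_subset_reachable hz)))

/-- A vertex of a pendant tree has at most one infinite branch, the one that contains `u`. -/
theorem not_isCore_attach (hac : (attach f v u).IsAcyclic) (hu : ¬ f.Reachable v u)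
    (hfin : {x | f.Reachable v x}.Finite) {x : V} (hx : f.Reachable v x) :
    ¬ IsCore (attach f v u) x := by
  have key : ∀ y, InfDir (attach f v u) x y → u ∈ branch (attach f v u) x y := by
    rintro y ⟨h1, h2⟩
    by_contra hub
    refine h2 (hfin.subset fun z hz => ?_)
    have hy : f.Reachable v y := by
      rcases (attach_adj (ne_of_not_reachable hu)).1 h1 with h1 | h1
      · exact hx.trans h1.reachable
      · rcases Sym2.eq_iff.1 h1 with ⟨rfl, rfl⟩ | ⟨rfl, -⟩
        · exact absurd (mem_branch_self _ _) hub
        · exact absurd hx hu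
    refine (reachable_induction (p := fun z => z ∈ branch (attach f v u) x y ∧ f.Reachable v z) hz
      ⟨mem_branch_self _ _, hy⟩ ?_).2
    rintro a b ⟨ha, ha'⟩ hab
    have hb : b ∈ branch (attach f v u) x y := SimpleGraph.Reachable.trans ha hab.reachable
    refine ⟨hb, ?_⟩
    rcases (attach_adj (ne_of_not_reachable hu)).1 (SimpleGraph.deleteEdges_adj.1 hab).1 with h | h
    · exact ha'.trans h.reachable
    · rcases Sym2.eq_iff.1 h with ⟨-, rfl⟩ | ⟨rfl, -⟩
      · exact absurd hb hub
      · exact absurd ha' hu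
  rintro ⟨a, b, hab, ha, hb⟩
  exact Set.disjoint_left.1 (disjoint_branch hac ha.1 hb.1 hab) (key a ha) (key b hb)

theorem isCore_attach_iff (hac : (attach f v u).IsAcyclic) (hu : ¬ f.Reachable v u)
    (hfin : {x | f.Reachable v x}.Finite) {x : V} : IsCore (attach f v u) x ↔ IsCore f x := by
  by_cases hx : f.Reachable v x
  · exact iff_of_false (not_isCore_attach hac hu hfin hx) (not_isCore_of_finite hfin hx)
  · simp only [IsCore, infDir_attach_iff hu hfin hx]

/-- The component of `z` contains no vertex with two infinite branches. -/
def NoCore (F : SimpleGraph V) (z : V) : Prop := ∀ y, F.Reachable z y → ¬ IsCore F y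

theorem noCore_congr {F : SimpleGraph V} {z z' : V} (h : F.Reachable z z') :
    NoCore F z ↔ NoCore F z' :=
  ⟨fun hz y hy => hz y (h.trans hy), fun hz y hy => hz y (h.symm.trans hy)⟩

theorem noCore_attach_iff (hac : (attach f v u).IsAcyclic) (hu : ¬ f.Reachable v u)
    (hfin : {x | f.Reachable v x}.Finite) {z : V} (hz : ¬ f.Reachable v z) :
    NoCore (attach f v u) z ↔ NoCore f z := by
  refine forall_congr' fun y => ?_
  rw [isCore_attach_iff hac hu hfin]
  by_cases hy : f.Reachable v y
  · have := not_isCore_of_finite hfin hy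
    exact iff_of_true (fun _ => this) fun _ => this
  · rw [attach_reachable_iff hu hz hy]

theorem isEssentialSpanningForest_attach_iff (hu : ¬ f.Reachable v u)
    (hfin : {x | f.Reachable v x}.Finite) : IsEssentialSpanningForest (attach f v u) ↔
      f.IsAcyclic ∧ ∀ x, ¬ f.Reachable v x → {y | f.Reachable x y}.Infinite := by
  have hinf : ∀ x, ¬ f.Reachable v x → ({y | (attach f v u).Reachable x y}.Infinite ↔
      {y | f.Reachable x y}.Infinite) := by
    intro x hx
    refine ⟨fun h hfin' => h ((hfin'.union hfin).subset fun y hy => ?_),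
      fun h => h.mono fun y hy => SimpleGraph.Reachable.mono le_attach hy⟩
    by_cases hvy : f.Reachable v y
    · exact Or.inr hvy
    · exact Or.inl ((attach_reachable_iff hu hx hvy).1 hy)
  have hac : (attach f v u).IsAcyclic ↔ f.IsAcyclic :=
    ⟨fun h => h.anti le_attach, fun h => h.sup_edge_of_not_reachable hu⟩
  rw [isEssentialSpanningForest_iff]
  rw [hac]
  refine and_congr_right fun _ => ⟨fun h x hx => (hinf x hx).1 (h x), fun h x => ?_⟩
  by_cases hx : f.Reachable v x
  · refine ((hinf u hu).2 (h u hu)).mono fun y hy => ?_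
    have h1 := (hx.symm.mono (le_attach (u := u))).trans
      (attach_adj_self (f := f) (ne_of_not_reachable hu)).reachable
    exact h1.trans hy
  · exact (hinf x hx).2 (h x hx)

end Pendant

/-! ### Moving a pendant finite tree -/

section Move

variable {V : Type*} {G : SimpleGraph V}

open Classical in
/-- The configuration with the edge between `v` and `u`, if there is one, open. -/
noncomputable def openEdge (v u : V) (ω : Config G) : Config G :=
  fun e => if (e : Sym2 V) = s(v, u) then true else ω e

theorem toGraph_openEdge {v u : V} (h : G.Adj v u) (ω : Config G) :
    toGraph (openEdge v u ω) = attach (toGraph ω) v u := by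
  ext a b
  rw [attach_adj h.ne, toGraph_adj, toGraph_adj]
  by_cases hab : s(a, b) = s(v, u)
  · refine iff_of_true ⟨?_, by simp only [openEdge, hab, if_true]⟩ (Or.inr hab)
    rwa [← SimpleGraph.mem_edgeSet, hab, SimpleGraph.mem_edgeSet]
  · simp only [openEdge, hab, if_false, or_false]

theorem restrict_openEdge {H : Finset V} {v u : V} (hv : v ∈ H) (hu : u ∈ H) (ω : Config G) :
    restrict H (openEdge v u ω) = openEdge v u (restrict H ω) := by
  funext e
  by_cases h : (e : Sym2 V) = s(v, u)
  · have : EdgeInside H e := by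
      intro x hx
      rw [h] at hx
      rcases Sym2.mem_iff.1 hx with rfl | rfl
      exacts [hv, hu]
    simp [restrict, openEdge, h, this]
  · simp [restrict, openEdge, h]

theorem openEdge_closeEdge {v u : V} {ω : Config G} (h : (toGraph ω).Adj v u) :
    openEdge v u (closeEdge v u ω) = ω := by
  funext e
  by_cases he : (e : Sym2 V) = s(v, u)
  · obtain ⟨h1, h2⟩ := toGraph_adj.1 h
    have : e = ⟨s(v, u), h1⟩ := Subtype.ext he
    simp [openEdge, this, h2]
  · simp [openEdge, closeEdge, he]

/-- A finite tree may be hung on `u` or on `w`, and the weak Gibbs property for large finite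
subgraphs compares the two possibilities. -/
theorem eventually_swappable_openEdge (hlf : ∀ v, (G.neighborSet v).Finite) {H : ℕ → Finset V}
    (hH : IsExhaustion G H) {ω : Config G} {v u w : V} (hvu : G.Adj v u) (hvw : G.Adj v w)
    (hu : ¬ (toGraph ω).Reachable v u) (hw : ¬ (toGraph ω).Reachable v w)
    (hfin : {x | (toGraph ω).Reachable v x}.Finite)
    (hFu : IsEssentialSpanningForest (toGraph (openEdge v u ω)))
    (hFw : IsEssentialSpanningForest (toGraph (openEdge v w ω))) :
    ∀ᶠ n in atTop, Swappable (H n) (openEdge v u ω) (openEdge v w ω) := by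
  classical
  filter_upwards [hH.eventually_subset ({v, u, w} ∪ hfin.toFinset.biUnion (nbrs hlf))] with n hn
  refine ⟨hFu.isBdryForest_inside _, hFw.isBdryForest_inside _, ?_⟩
  have hv' : v ∈ H n := hn (by simp)
  have hu' : u ∈ H n := hn (by simp)
  have hw' : w ∈ H n := hn (by simp)
  have hbd : ∀ a, a ∈ bdry G (H n) → ¬ (toGraph (restrict (H n) ω)).Reachable v a := by
    rintro a ⟨-, b, hb, hab⟩ hva
    refine hb (hn (Finset.mem_union_right _ (Finset.mem_biUnion.2 ⟨a, ?_, mem_nbrs.2 hab⟩)))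
    exact hfin.mem_toFinset.2 (hva.mono restrict_le)
  funext a b
  rw [bdryRel, bdryRel, inside_reachable_iff, inside_reachable_iff, restrict_openEdge hv' hu',
    restrict_openEdge hv' hw', toGraph_openEdge hvu, toGraph_openEdge hvw]
  refine propext (and_congr_right fun ha => and_congr_right fun hb => ?_)
  rw [attach_reachable_iff (fun h => hu (h.mono restrict_le)) (hbd _ ha) (hbd _ hb),
    attach_reachable_iff (fun h => hw (h.mono restrict_le)) (hbd _ ha) (hbd _ hb)]

/-- In the essential spanning forest `ω`, the part of the tree behind `v`, seen from its neighbour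
`u`, is finite, and it does not contain `w`. -/
def Movable (v u w : V) (ω : Config G) : Prop :=
  IsEssentialSpanningForest (toGraph ω) ∧ (toGraph ω).Adj v u ∧
    (branch (toGraph ω) u v).Finite ∧ w ∉ branch (toGraph ω) u v

/-- The finite tree behind `v` is detached from `u` and hung on `w`. -/
noncomputable def move (v u w : V) (ω : Config G) : Config G := openEdge v w (closeEdge v u ω)

theorem measurableSet_movable [Countable V] (v u w : V) :
    MeasurableSet {ω : Config G | Movable v u w ω} :=
  measurableSet_isEssentialSpanningForest.inter ((measurableSet_adj v u).inter
    ((MeasurableSet.congr (measurableSet_branch_infinite u v).compl (by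
      ext ω; exact Set.not_infinite)).inter (measurableSet_mem_branch u v w).compl))

section

variable {v u w : V} {ω : Config G}

theorem branch_eq_closeEdge :
    branch (toGraph ω) u v = {x | (toGraph (closeEdge v u ω)).Reachable v x} := by
  rw [branch, toGraph_closeEdge, Sym2.eq_swap]

theorem toGraph_move (hvw : G.Adj v w) :
    toGraph (move v u w ω) = attach (toGraph (closeEdge v u ω)) v w :=
  toGraph_openEdge hvw _

variable (h : Movable v u w ω) (hvw : G.Adj v w)

include h

theorem Movable.adj : G.Adj v u := toGraph_le ω h.2.1

theorem Movable.attach_eq : toGraph ω = attach (toGraph (closeEdge v u ω)) v u := by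
  rw [toGraph_closeEdge, deleteEdges_attach h.2.1]

theorem Movable.finite : {x | (toGraph (closeEdge v u ω)).Reachable v x}.Finite :=
  branch_eq_closeEdge ▸ h.2.2.1

theorem Movable.not_reachable_left : ¬ (toGraph (closeEdge v u ω)).Reachable v u := by
  rw [toGraph_closeEdge]
  exact not_reachable_deleteEdges_of_isAcyclic h.1.1 h.2.1

theorem Movable.not_reachable_right : ¬ (toGraph (closeEdge v u ω)).Reachable v w := by
  have := h.2.2.2
  rwa [branch_eq_closeEdge] at this

include hvw

theorem Movable.isEssentialSpanningForest_move :
    IsEssentialSpanningForest (toGraph (move v u w ω)) := by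
  have h1 := h.1
  rw [h.attach_eq, isEssentialSpanningForest_attach_iff h.not_reachable_left h.finite] at h1
  rw [toGraph_move hvw]
  exact (isEssentialSpanningForest_attach_iff h.not_reachable_right h.finite).2 h1

theorem Movable.symm : Movable v w u (move v u w ω) := by
  refine ⟨h.isEssentialSpanningForest_move hvw, ?_⟩
  rw [toGraph_move hvw, branch_attach h.not_reachable_right]
  exact ⟨attach_adj_self hvw.ne, h.finite, h.not_reachable_left⟩

theorem Movable.isCore_move_iff {x : V} :
    IsCore (toGraph (move v u w ω)) x ↔ IsCore (toGraph ω) x := by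
  have h1 := (h.isEssentialSpanningForest_move hvw).1
  have h2 := h.1.1
  rw [h.attach_eq] at h2
  rw [toGraph_move hvw] at h1 ⊢
  conv_rhs => rw [h.attach_eq]
  rw [isCore_attach_iff h1 h.not_reachable_right h.finite,
    isCore_attach_iff h2 h.not_reachable_left h.finite]

theorem Movable.noCore_move_iff {z : V} (hz : z ∉ branch (toGraph ω) u v) :
    NoCore (toGraph (move v u w ω)) z ↔ NoCore (toGraph ω) z := by
  have h1 := (h.isEssentialSpanningForest_move hvw).1
  have h2 := h.1.1
  rw [branch_eq_closeEdge] at hz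
  rw [h.attach_eq] at h2
  rw [toGraph_move hvw] at h1 ⊢
  conv_rhs => rw [h.attach_eq]
  rw [noCore_attach_iff h1 h.not_reachable_right h.finite hz,
    noCore_attach_iff h2 h.not_reachable_left h.finite hz]

end

/-- Moving a pendant finite tree from `u` to `w` does not lose mass. -/
theorem WeakGibbs.measure_movable_le [Countable V] {μ : Measure (Config G)}
    [IsProbabilityMeasure μ] (hμ : WeakGibbs μ) (hlf : ∀ v, (G.neighborSet v).Finite)
    {H : ℕ → Finset V} (hH : IsExhaustion G H) {v u w : V} (hvw : G.Adj v w) (hne : u ≠ w)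
    {D : Set (Config G)} (hD : MeasurableSet D)
    (hmove : ∀ ω ∈ D, Movable v u w ω → move v u w ω ∈ D) :
    μ {ω ∈ D | Movable v u w ω} ≤ μ {ω ∈ D | Movable v w u ω} := by
  classical
  let S : Set G.edgeSet := {e | (e : Sym2 V) = s(v, u) ∨ (e : Sym2 V) = s(v, w)}
  have hS : S.Finite := by
    have : S = Subtype.val ⁻¹' ({s(v, u), s(v, w)} : Set (Sym2 V)) := by
      ext e; simp [S]
    rw [this]
    exact Set.Finite.preimage Subtype.val_injective.injOn (Set.toFinite _)
  have hsym : s(v, u) ≠ s(v, w) := fun h => hne (Sym2.congr_right.1 h)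
  have hpatch : ∀ [∀ e, Decidable (e ∈ S)] (ω : Config G),
      S.piecewise (openEdge v w fun _ => false) ω = move v u w ω := by
    intro _ ω
    funext e
    by_cases h1 : (e : Sym2 V) = s(v, u)
    · simp [S, move, openEdge, closeEdge, h1]
    · by_cases h2 : (e : Sym2 V) = s(v, w)
      · simp [S, move, openEdge, h2]
      · simp [S, move, openEdge, closeEdge, h1, h2]
  refine hμ.measure_le_of_eventually_swappable hH.eventually_edgeInside
    (hD.inter (measurableSet_movable v u w)) (hD.inter (measurableSet_movable v w u)) hS
    (openEdge v u fun _ => false) (openEdge v w fun _ => false) ?_ ?_ ?_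
  · rintro ω ⟨-, h⟩ e he
    rcases he with he | he
    · obtain ⟨h1, h2⟩ := toGraph_adj.1 h.2.1
      have : e = ⟨s(v, u), h1⟩ := Subtype.ext he
      simp [openEdge, this, h2]
    · have h1 : ω e ≠ true := by
        intro h1
        have h2 : (toGraph ω).Adj v w := by
          refine toGraph_adj.2 ⟨hvw, ?_⟩
          rw [← h1]
          exact congrArg ω (Subtype.ext he.symm)
        exact h.2.2.2 (mem_branch_of_adj (mem_branch_self u v) h2 hne.symm)
      simp [openEdge, he, hsym.symm, h1]
  · rintro ω ⟨hωD, h⟩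
    rw [@hpatch (fun _ => Classical.propDecidable _) ω]
    exact ⟨hmove ω hωD h, h.symm hvw⟩
  · refine Eventually.of_forall ?_
    rintro ω ⟨-, h⟩
    rw [@hpatch (fun _ => Classical.propDecidable _) ω]
    have h1 := eventually_swappable_openEdge hlf hH h.adj hvw h.not_reachable_left
      h.not_reachable_right h.finite (by rw [openEdge_closeEdge h.2.1]; exact h.1)
      (h.isEssentialSpanningForest_move hvw)
    rwa [openEdge_closeEdge h.2.1] at h1

end Move

/-! ### Vertices without two infinite branches -/

section DeadEnd

variable {V : Type*} {F : SimpleGraph V} {v u : V}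

/-- A vertex with only one infinite branch has exactly one neighbour from which it is seen as the
root of a finite tree. -/
theorem exists_branch_finite (hF : IsEssentialSpanningForest F)
    (hlf : ∀ v, (F.neighborSet v).Finite) (hv : ¬ IsCore F v) :
    ∃ u, F.Adj v u ∧ (branch F u v).Finite := by
  obtain ⟨z, hz⟩ := exists_infDir hlf ((isEssentialSpanningForest_iff.1 hF).2 v)
  refine ⟨z, hz.1, ((Set.finite_singleton v).union ?_).subset (branch_subset_iUnion v z)⟩
  refine Set.Finite.biUnion ((hlf v).subset fun y hy => hy.1) fun y hy => ?_
  by_contra hinf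
  exact hv ⟨y, z, hy.2, ⟨hy.1, hinf⟩, hz⟩

theorem branch_finite_unique (hF : IsEssentialSpanningForest F) {u' : V} (hu : F.Adj v u)
    (hfin : (branch F u v).Finite) (hfin' : (branch F u' v).Finite) :
    u = u' := by
  by_contra hne
  refine (isEssentialSpanningForest_iff.1 hF).2 v ((hfin.union
    (hfin'.subset (branch_subset hF.1 hu hne))).subset fun x hx => ?_)
  refine reachable_induction (p := fun x => x ∈ branch F u v ∪ branch F v u) hx
    (Or.inl (mem_branch_self _ _)) ?_
  rintro x y (hx | hx) hxy
  · by_cases hy : y = u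
    · exact Or.inr (hy ▸ mem_branch_self _ _)
    · exact Or.inl (mem_branch_of_adj hx hxy hy)
  · by_cases hy : y = v
    · exact Or.inl (hy ▸ mem_branch_self _ _)
    · exact Or.inr (mem_branch_of_adj hx hxy hy)

theorem not_isCore_of_branch_finite (hF : F.IsAcyclic) (hfin : (branch F u v).Finite) :
    ¬ IsCore F v := by
  rintro ⟨a, b, hab, ha, hb⟩
  by_cases h : a = u
  · exact hb.2 (hfin.subset (branch_subset hF hb.1 fun h' => hab (h.trans h'.symm)))
  · exact ha.2 (hfin.subset (branch_subset hF ha.1 h))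

end DeadEnd

/-! ### The harmonic conditional probability of missing the core -/

section Harmonic

variable {V : Type*} {G : SimpleGraph V}

/-- The differences of the indicators `NoCore` around a vertex `v` with a single infinite branch
come from the neighbours outside of the finite tree behind `v`. -/
theorem ind_mul_sum_sub_eq (hlf : ∀ v, (G.neighborSet v).Finite) {ω : Config G}
    (hω : IsEssentialSpanningForest (toGraph ω)) (v : V) :
    ind (¬ IsCore (toGraph ω) v) *
      ∑ w ∈ nbrs hlf v, (ind (NoCore (toGraph ω) v) - ind (NoCore (toGraph ω) w)) =
    ∑ u ∈ nbrs hlf v, ∑ w ∈ nbrs hlf v,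
      (ind (Movable v u w ω ∧ NoCore (toGraph ω) u ∧ ¬ NoCore (toGraph ω) w) -
        ind (Movable v u w ω ∧ ¬ NoCore (toGraph ω) u ∧ NoCore (toGraph ω) w)) := by
  have hlf' : ∀ v, ((toGraph ω).neighborSet v).Finite := fun v =>
    (hlf v).subset fun w h => toGraph_le ω h
  by_cases hv : IsCore (toGraph ω) v
  · rw [ind_false (not_not.2 hv), zero_mul]
    refine (Finset.sum_eq_zero fun u _ => Finset.sum_eq_zero fun w _ => ?_).symm
    have h : ¬ Movable v u w ω := fun h => not_isCore_of_branch_finite hω.1 h.2.2.1 hv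
    rw [ind_false fun h' => h h'.1, ind_false fun h' => h h'.1, sub_zero]
  · rw [ind_true hv, one_mul]
    obtain ⟨u, hvu, hfin⟩ := exists_branch_finite hω hlf' hv
    refine Eq.trans ?_ (Finset.sum_eq_single u ?_ ?_).symm
    · refine Finset.sum_congr rfl fun w _ => ?_
      rw [ind_congr (noCore_congr hvu.reachable)]
      by_cases hw : w ∈ branch (toGraph ω) u v
      · have h : ¬ Movable v u w ω := fun h => h.2.2.2 hw
        rw [ind_congr (noCore_congr ((branch_subset_reachable hw).symm.trans hvu.reachable)),
          sub_self, ind_false fun h' => h h'.1, ind_false fun h' => h h'.1, sub_zero]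
      · have h : Movable v u w ω := ⟨hω, hvu, hfin, hw⟩
        by_cases h1 : NoCore (toGraph ω) u <;> by_cases h2 : NoCore (toGraph ω) w <;>
          simp [ind, h, h1, h2]
    · intro u' _ hne
      refine Finset.sum_eq_zero fun w _ => ?_
      have h : ¬ Movable v u' w ω := fun h =>
        hne (branch_finite_unique hω h.2.1 h.2.2.1 hfin)
      rw [ind_false fun h' => h h'.1, ind_false fun h' => h h'.1, sub_zero]
    · intro h
      exact absurd (mem_nbrs.2 (toGraph_le ω hvu)) h

/-- The set of vertices with two infinite branches. -/
def coreMap (ω : Config G) : V → Prop := fun v => IsCore (toGraph ω) v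

/-- The sigma-algebra generated by the set of vertices with two infinite branches. -/
abbrev coreSigma (G : SimpleGraph V) : MeasurableSpace (Config G) :=
  MeasurableSpace.comap coreMap inferInstance

theorem coreMap_translate (γ : G ≃g G) (ω : Config G) :
    coreMap (translate γ ω) = fun v => coreMap ω (γ.symm v) := by
  funext v
  have h := isCore_map_iff (translateIso γ ω) (v := γ.symm v)
  rw [translateIso_apply, γ.apply_symm_apply] at h
  exact propext h

theorem measurable_translate_coreSigma (γ : G ≃g G) :
    Measurable[coreSigma G, coreSigma G] (translate γ) := by
  refine measurable_comap_iff.2 ?_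
  have h : coreMap ∘ translate γ = (fun s : V → Prop => fun v => s (γ.symm v)) ∘ coreMap (G := G) :=
    funext fun ω => coreMap_translate γ ω
  rw [h]
  exact (measurable_pi_lambda _ fun v => measurable_pi_apply _).comp (comap_measurable _)

theorem measurableSet_isCore_coreSigma (v : V) :
    MeasurableSet[coreSigma G] {ω : Config G | IsCore (toGraph ω) v} :=
  ⟨{s | s v}, measurableSet_setOfPred.2 (measurable_pi_apply v), rfl⟩

variable [Countable V]

theorem coreSigma_le : coreSigma G ≤ (inferInstance : MeasurableSpace (Config G)) :=
  Measurable.comap_le (measurable_pi_lambda _ fun v =>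
    measurableSet_setOfPred.1 (measurableSet_isCore v))

theorem measurableSet_noCore (v : V) : MeasurableSet {ω : Config G | NoCore (toGraph ω) v} :=
  measurableSet_setOfPred.2 (Measurable.forall fun y =>
    (measurableSet_setOfPred.1 (measurableSet_reachable v y)).imp
      (measurableSet_setOfPred.1 (measurableSet_isCore y)).not)

variable {μ : Measure (Config G)} [IsProbabilityMeasure μ]

/-- Moving the finite tree behind `v` from `u` to `w` is measure preserving and changes neither the
core nor whether the components of `u` and `w` meet it. -/
theorem WeakGibbs.measure_movable_eq (hμ : WeakGibbs μ) (hlf : ∀ v, (G.neighborSet v).Finite)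
    {H : ℕ → Finset V} (hH : IsExhaustion G H) {v u w : V} (hvu : G.Adj v u) (hvw : G.Adj v w)
    {C : Set (Config G)} (hC : MeasurableSet[coreSigma G] C) :
    (μ.restrict C).real {ω | Movable v u w ω ∧ ¬ NoCore (toGraph ω) u ∧ NoCore (toGraph ω) w} =
      (μ.restrict C).real
        {ω | Movable v w u ω ∧ NoCore (toGraph ω) w ∧ ¬ NoCore (toGraph ω) u} := by
  by_cases hne : u = w
  · subst hne
    congr 1
    ext ω
    simp only [Set.mem_ofPred_eq]
    tauto
  let D : Set (Config G) := {ω | ω ∈ C ∧ ¬ NoCore (toGraph ω) u ∧ NoCore (toGraph ω) w}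
  have hCm : MeasurableSet C := coreSigma_le _ hC
  have hD : MeasurableSet D :=
    hCm.inter ((measurableSet_noCore u).compl.inter (measurableSet_noCore w))
  have hmove : ∀ {a b}, G.Adj v a → G.Adj v b → ∀ ω, Movable v a b ω →
      (NoCore (toGraph (move v a b ω)) a ↔ NoCore (toGraph ω) a) ∧
      (NoCore (toGraph (move v a b ω)) b ↔ NoCore (toGraph ω) b) ∧
      (move v a b ω ∈ C ↔ ω ∈ C) := by
    intro a b _ hb ω h
    refine ⟨h.noCore_move_iff hb (notMem_branch h.1.1 h.2.1.symm), h.noCore_move_iff hb h.2.2.2, ?_⟩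
    obtain ⟨s, -, rfl⟩ := hC
    have : coreMap (move v a b ω) = coreMap ω := funext fun x => propext (h.isCore_move_iff hb)
    rw [Set.mem_preimage, this, Set.mem_preimage]
  have h1 := hμ.measure_movable_le hlf hH hvw hne hD fun ω ⟨h1, h2, h3⟩ h => by
    obtain ⟨e1, e2, e3⟩ := hmove hvu hvw ω h
    exact ⟨e3.2 h1, fun h4 => h2 (e1.1 h4), e2.2 h3⟩
  have h2 := hμ.measure_movable_le hlf hH hvu (Ne.symm hne) hD fun ω ⟨h1, h2, h3⟩ h => by
    obtain ⟨e1, e2, e3⟩ := hmove hvw hvu ω h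
    exact ⟨e3.2 h1, fun h4 => h2 (e2.1 h4), e1.2 h3⟩
  have h3 := le_antisymm h1 h2
  rw [measureReal_def, measureReal_def, Measure.restrict_apply, Measure.restrict_apply]
  · congr 1
    convert h3 using 2
    · ext ω
      simp only [D, Set.mem_inter_iff, Set.mem_ofPred_eq]
      tauto
    · ext ω
      simp only [D, Set.mem_inter_iff, Set.mem_ofPred_eq]
      tauto
  · exact (measurableSet_movable v w u).inter
      ((measurableSet_noCore w).inter (measurableSet_noCore u).compl)
  · exact (measurableSet_movable v u w).inter
      ((measurableSet_noCore u).compl.inter (measurableSet_noCore w))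

/-- The integrated form of harmonicity: summed over the possible parents `u` and new neighbours `w` of
`v`, the differences are antisymmetric under exchanging `u` and `w` by a move. -/
theorem WeakGibbs.setIntegral_laplacian_eq_zero (hμ : WeakGibbs μ)
    (hforest : ∀ᵐ ω ∂μ, IsEssentialSpanningForest (toGraph ω))
    (hlf : ∀ v, (G.neighborSet v).Finite) {H : ℕ → Finset V} (hH : IsExhaustion G H) (v : V)
    {C : Set (Config G)} (hC : MeasurableSet[coreSigma G] C) :
    ∫ ω in C, ind (¬ IsCore (toGraph ω) v) *
      ∑ w ∈ nbrs hlf v, (ind (NoCore (toGraph ω) v) - ind (NoCore (toGraph ω) w)) ∂μ = 0 := by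
  have hm1 : ∀ u w, MeasurableSet {ω : Config G |
      Movable v u w ω ∧ NoCore (toGraph ω) u ∧ ¬ NoCore (toGraph ω) w} := fun u w =>
    (measurableSet_movable v u w).inter
      ((measurableSet_noCore u).inter (measurableSet_noCore w).compl)
  have hm2 : ∀ u w, MeasurableSet {ω : Config G |
      Movable v u w ω ∧ ¬ NoCore (toGraph ω) u ∧ NoCore (toGraph ω) w} := fun u w =>
    (measurableSet_movable v u w).inter
      ((measurableSet_noCore u).compl.inter (measurableSet_noCore w))
  have hi : ∀ u w, Integrable (fun ω : Config G =>
      ind (Movable v u w ω ∧ NoCore (toGraph ω) u ∧ ¬ NoCore (toGraph ω) w) -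
        ind (Movable v u w ω ∧ ¬ NoCore (toGraph ω) u ∧ NoCore (toGraph ω) w)) (μ.restrict C) :=
    fun u w => (integrable_ind (hm1 u w)).sub (integrable_ind (hm2 u w))
  rw [integral_congr_ae (ae_restrict_of_ae (hforest.mono fun ω hω =>
    ind_mul_sum_sub_eq hlf hω v)),
    integral_finsetSum _ fun u _ => integrable_finsetSum _ fun w _ => hi u w]
  have h : ∀ u ∈ nbrs hlf v, ∫ ω in C, ∑ w ∈ nbrs hlf v,
      (ind (Movable v u w ω ∧ NoCore (toGraph ω) u ∧ ¬ NoCore (toGraph ω) w) -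
        ind (Movable v u w ω ∧ ¬ NoCore (toGraph ω) u ∧ NoCore (toGraph ω) w)) ∂μ =
      ∑ w ∈ nbrs hlf v, ((μ.restrict C).real {ω : Config G |
        Movable v u w ω ∧ NoCore (toGraph ω) u ∧ ¬ NoCore (toGraph ω) w} -
        (μ.restrict C).real {ω : Config G |
        Movable v w u ω ∧ NoCore (toGraph ω) w ∧ ¬ NoCore (toGraph ω) u}) := by
    intro u hu
    rw [integral_finsetSum _ fun w _ => hi u w]
    refine Finset.sum_congr rfl fun w hw => ?_
    rw [integral_sub (integrable_ind (hm1 u w)) (integrable_ind (hm2 u w)), integral_ind (hm1 u w),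
      integral_ind (hm2 u w), hμ.measure_movable_eq hlf hH (mem_nbrs.1 hu) (mem_nbrs.1 hw) hC]
  rw [Finset.sum_congr rfl h]
  simp only [Finset.sum_sub_distrib]
  rw [sub_eq_zero]
  exact Finset.sum_comm

/-- The conditional probability, given the set of vertices with two infinite branches, that the
component of `v` does not meet this set. -/
noncomputable def noCoreProb (μ : Measure (Config G)) (v : V) : Config G → ℝ :=
  μ[fun ω => ind (NoCore (toGraph ω) v) | coreSigma G]

theorem integrable_noCore (v : V) : Integrable (fun ω => ind (NoCore (toGraph ω) v)) μ :=
  integrable_ind (measurableSet_noCore v)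

omit [Countable V] in
theorem ind_mul_eq_indicator {Ω : Type*} (p : Ω → Prop) (f : Ω → ℝ) :
    (fun ω => ind (p ω) * f ω) = {ω | p ω}.indicator f := by
  classical
  funext ω
  by_cases h : p ω
  · rw [ind_true h, one_mul, Set.indicator_of_mem (show ω ∈ {ω | p ω} from h)]
  · rw [ind_false h, zero_mul, Set.indicator_of_notMem (show ω ∉ {ω | p ω} from h)]

theorem noCoreProb_mem_Icc (μ : Measure (Config G)) [IsProbabilityMeasure μ] :
    ∀ᵐ ω ∂μ, ∀ v, 0 ≤ noCoreProb μ v ω ∧ noCoreProb μ v ω ≤ 1 := by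
  refine ae_all_iff.2 fun v => ?_
  have h1 : 0 ≤ᵐ[μ] noCoreProb μ v := condExp_nonneg (Eventually.of_forall fun ω => ind_nonneg _)
  have h2 : noCoreProb μ v ≤ᵐ[μ] μ[fun _ => (1 : ℝ) | coreSigma G] :=
    condExp_mono (integrable_noCore v) (integrable_const 1) (Eventually.of_forall fun ω => by
      change ind _ ≤ 1
      rw [← ind_true trivial]
      exact ind_mono fun _ => trivial)
  rw [condExp_const coreSigma_le] at h2
  filter_upwards [h1, h2] with ω h1 h2 using ⟨h1, h2⟩

theorem noCoreProb_eq_zero_of_isCore (μ : Measure (Config G)) [IsProbabilityMeasure μ] :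
    ∀ᵐ ω ∂μ, ∀ v, IsCore (toGraph ω) v → noCoreProb μ v ω = 0 := by
  refine ae_all_iff.2 fun v => ?_
  have h1 := condExp_indicator (integrable_noCore (μ := μ) v) (measurableSet_isCore_coreSigma v)
  have h2 : {ω : Config G | IsCore (toGraph ω) v}.indicator
      (fun ω => ind (NoCore (toGraph ω) v)) = fun _ => 0 := by
    rw [← ind_mul_eq_indicator]
    funext ω
    by_cases h : IsCore (toGraph ω) v
    · rw [ind_false fun h' : NoCore (toGraph ω) v => h' v .rfl h, mul_zero]
    · rw [ind_false h, zero_mul]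
  rw [h2, condExp_const coreSigma_le] at h1
  filter_upwards [h1] with ω hω hv
  rw [Set.indicator_of_mem (show ω ∈ {ω : Config G | IsCore (toGraph ω) v} from hv)] at hω
  exact hω.symm

/-- Off the set of vertices with two infinite branches, `noCoreProb` is harmonic. -/
theorem WeakGibbs.noCoreProb_harmonic (hμ : WeakGibbs μ)
    (hforest : ∀ᵐ ω ∂μ, IsEssentialSpanningForest (toGraph ω))
    (hlf : ∀ v, (G.neighborSet v).Finite) {H : ℕ → Finset V} (hH : IsExhaustion G H) :
    ∀ᵐ ω ∂μ, ∀ v, ¬ IsCore (toGraph ω) v →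
      ∑ w ∈ nbrs hlf v, (noCoreProb μ v ω - noCoreProb μ w ω) = 0 := by
  refine ae_all_iff.2 fun v => ?_
  let X : V → Config G → ℝ := fun v ω => ind (NoCore (toGraph ω) v)
  have hX : ∀ v, Integrable (X v) μ := integrable_noCore
  let L : Config G → ℝ := ∑ w ∈ nbrs hlf v, (X v - X w)
  have hLi : Integrable L μ := integrable_finsetSum' _ fun w _ => (hX v).sub (hX w)
  have hL : μ[L | coreSigma G] =ᵐ[μ] ∑ w ∈ nbrs hlf v, (noCoreProb μ v - noCoreProb μ w) := by
    refine (condExp_finsetSum (fun w _ => (hX v).sub (hX w)) _).trans ?_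
    have : ∀ᵐ ω ∂μ, ∀ w, μ[X v - X w | coreSigma G] ω = (noCoreProb μ v - noCoreProb μ w) ω :=
      ae_all_iff.2 fun w => condExp_sub (hX v) (hX w) _
    filter_upwards [this] with ω hω
    simp only [Finset.sum_apply, hω]
  have hs : MeasurableSet[coreSigma G] {ω : Config G | ¬ IsCore (toGraph ω) v} :=
    (measurableSet_isCore_coreSigma v).compl
  have h1 := condExp_indicator hLi hs
  have hLs : {ω : Config G | ¬ IsCore (toGraph ω) v}.indicator L =
      fun ω => ind (¬ IsCore (toGraph ω) v) *
        ∑ w ∈ nbrs hlf v, (ind (NoCore (toGraph ω) v) - ind (NoCore (toGraph ω) w)) := by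
    rw [← ind_mul_eq_indicator]
    funext ω
    simp only [L, Finset.sum_apply, Pi.sub_apply, X]
  have h2 : (fun _ => (0 : ℝ)) =ᵐ[μ]
      μ[{ω : Config G | ¬ IsCore (toGraph ω) v}.indicator L | coreSigma G] := by
    refine ae_eq_condExp_of_forall_setIntegral_eq coreSigma_le
      (hLi.indicator (coreSigma_le _ hs)) (fun _ _ _ => integrableOn_const)
      (fun C hC _ => ?_) aestronglyMeasurable_const
    rw [hLs, hμ.setIntegral_laplacian_eq_zero hforest hlf hH v hC, integral_zero]
  filter_upwards [h1, h2, hL] with ω h1 h2 hL hv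
  rw [Set.indicator_of_mem (show ω ∈ {ω : Config G | ¬ IsCore (toGraph ω) v} from hv), ← h2, hL] at h1
  simpa using h1.symm

/-- By invariance of `μ`, translating both the vertex and the configuration preserves the conditional
probability of missing the core. -/
theorem noCoreProb_translate {Γ : Subgroup (G ≃g G)} (hinv : IsInvariant Γ μ) {γ : G ≃g G}
    (hγ : γ ∈ Γ) (v : V) :
    (fun ω => noCoreProb μ (γ v) (translate γ ω)) =ᵐ[μ] noCoreProb μ v := by
  have hmp : MeasurePreserving (translate γ) μ μ := ⟨measurable_translate γ, hinv γ hγ⟩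
  have hsm : StronglyMeasurable[coreSigma G] (noCoreProb μ (γ v)) := stronglyMeasurable_condExp
  have hint : Integrable (noCoreProb μ (γ v)) μ := integrable_condExp
  refine ae_eq_condExp_of_forall_setIntegral_eq coreSigma_le (integrable_noCore v)
    (fun _ _ _ => (hmp.integrable_comp_of_integrable hint).integrableOn) (fun C hC _ => ?_)
    (hsm.comp_measurable (measurable_translate_coreSigma γ)).aestronglyMeasurable
  -- `C` is the preimage of its translate
  set C' := translate γ.symm ⁻¹' C with hC'
  have hC'm : MeasurableSet[coreSigma G] C' := measurable_translate_coreSigma γ.symm hC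
  have hCC' : C = translate γ ⁻¹' C' := by
    ext ω
    rw [hC', Set.mem_preimage, Set.mem_preimage, translate_symm_translate]
  have hset : ∀ f : Config G → ℝ, StronglyMeasurable f →
      ∫ ω in C, f (translate γ ω) ∂μ = ∫ ω in C', f ω ∂μ := by
    intro f hf
    have h := setIntegral_map (μ := μ) (coreSigma_le _ hC'm) hf.aestronglyMeasurable
      (measurable_translate γ).aemeasurable
    rw [hinv γ hγ] at h
    rw [hCC', h]
  have hX : StronglyMeasurable fun ω : Config G => ind (NoCore (toGraph ω) (γ v)) := by
    have : (fun ω : Config G => ind (NoCore (toGraph ω) (γ v))) =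
        {ω : Config G | NoCore (toGraph ω) (γ v)}.indicator fun _ => 1 := by
      rw [← ind_mul_eq_indicator]; simp
    rw [this]
    exact stronglyMeasurable_const.indicator (measurableSet_noCore _)
  rw [hset _ (hsm.mono coreSigma_le), noCoreProb,
    setIntegral_condExp coreSigma_le (integrable_noCore _) hC'm, ← hset _ hX]
  refine integral_congr_ae (Eventually.of_forall fun ω => ind_congr ?_)
  constructor
  · intro h y hy hc
    exact h (γ y) ((translateIso γ ω).reachable_iff.2 hy) ((isCore_map_iff (translateIso γ ω)).2 hc)
  · intro h y hy hc
    obtain ⟨y, rfl⟩ := γ.surjective y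
    exact h y ((translateIso γ ω).reachable_iff.1 hy) ((isCore_map_iff (translateIso γ ω)).1 hc)

end Harmonic

/-! ### The Dirichlet energy argument -/

section Energy

variable {V : Type*} {G : SimpleGraph V}

open Classical in
/-- The Dirichlet energy in `K` of a bounded function that is harmonic where it does not vanish is
of the order of the boundary. -/
theorem energy_le (hlf : ∀ v, (G.neighborSet v).Finite) {D : ℝ}
    (hD : ∀ v, ((nbrs hlf v).card : ℝ) ≤ D) {h : V → ℝ} (h0 : ∀ v, 0 ≤ h v) (h1 : ∀ v, h v ≤ 1)
    (hh : ∀ v, h v * ∑ w ∈ nbrs hlf v, (h v - h w) = 0) (K : Finset V) :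
    ∑ v ∈ K, ∑ w ∈ nbrs hlf v, (h v - h w) ^ 2 ≤ 3 * D * (bdry G K).ncard := by
  have e1 := sum_nbrs_le_sum_inter_add hlf hD zero_le_one (φ := fun v w => (h v - h w) ^ 2)
    (fun v w => by nlinarith [h0 v, h0 w, h1 v, h1 w]) K
  have e2 := sum_nbrs_le_sum_inter_add hlf hD zero_le_one (φ := fun v w => h v * (h w - h v))
    (fun v w => by nlinarith [h0 v, h0 w, h1 v, h1 w, mul_nonneg (h0 v) (h0 w)]) K
  -- Harmonicity off the zero set makes the sum of `h` against its Laplacian vanish.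
  have e3 : ∑ v ∈ K, ∑ w ∈ nbrs hlf v, h v * (h w - h v) = 0 := by
    refine Finset.sum_eq_zero fun v _ => ?_
    rw [← Finset.mul_sum, ← neg_eq_zero, ← mul_neg, ← Finset.sum_neg_distrib, ← hh v]
    simp only [neg_sub]
  have e4 : ∑ v ∈ K, ∑ w ∈ nbrs hlf v with w ∈ K, h w * (h v - h w) =
      ∑ v ∈ K, ∑ w ∈ nbrs hlf v with w ∈ K, h v * (h w - h v) := by
    refine Finset.sum_comm' fun x y => ?_
    simp only [Finset.mem_filter, mem_nbrs]
    rw [G.adj_comm]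
    tauto
  -- Summation by parts for the edges inside `K`.
  have e5 : ∑ v ∈ K, ∑ w ∈ nbrs hlf v with w ∈ K, (h v - h w) ^ 2 =
      -(∑ v ∈ K, ∑ w ∈ nbrs hlf v with w ∈ K, h v * (h w - h v)) -
        ∑ v ∈ K, ∑ w ∈ nbrs hlf v with w ∈ K, h w * (h v - h w) := by
    simp only [← Finset.sum_neg_distrib, ← Finset.sum_sub_distrib]
    exact Finset.sum_congr rfl fun v _ => Finset.sum_congr rfl fun w _ => by ring
  linarith

variable [Countable V] {μ : Measure (Config G)} [IsProbabilityMeasure μ]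

/-- If almost surely there is a vertex with two infinite branches, then every component contains
one. -/
theorem WeakGibbs.ae_not_noCore (hμ : WeakGibbs μ)
    (hforest : ∀ᵐ ω ∂μ, IsEssentialSpanningForest (toGraph ω)) (hconn : G.Connected)
    (hlf : ∀ v, (G.neighborSet v).Finite) (hamen : IsAmenable G) {Γ : Subgroup (G ≃g G)}
    (hΓ : IsQuasitransitive G Γ) (hinv : IsInvariant Γ μ)
    (hcore : ∀ᵐ ω ∂μ, ∃ v, IsCore (toGraph ω) v) :
    ∀ᵐ ω ∂μ, ∀ v, ¬ NoCore (toGraph ω) v := by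
  obtain ⟨K, hK, hfol⟩ := hamen
  obtain ⟨D, -, hD⟩ := (invariantFun_degree hlf (Γ := Γ)).exists_le hΓ
  let h : V → Config G → ℝ := noCoreProb μ
  have h01 := noCoreProb_mem_Icc μ
  have hsm : ∀ v, StronglyMeasurable (h v) := fun v =>
    (stronglyMeasurable_condExp (m := coreSigma G)).mono coreSigma_le
  have hint : ∀ v w, Integrable (fun ω => (h v ω - h w ω) ^ 2) μ := by
    intro v w
    refine Integrable.of_bound (((hsm v).sub (hsm w)).pow 2).aestronglyMeasurable 1 ?_
    filter_upwards [h01] with ω hω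
    rw [Real.norm_of_nonneg (sq_nonneg _)]
    have h1 := hω v
    have h2 := hω w
    change (noCoreProb μ v ω - noCoreProb μ w ω) ^ 2 ≤ 1
    nlinarith
  have ha : InvariantFun Γ fun v => ∑ w ∈ nbrs hlf v, ∫ ω, (h v ω - h w ω) ^ 2 ∂μ := by
    intro γ hγ v
    beta_reduce
    rw [sum_nbrs_equivariant]
    refine Finset.sum_congr rfl fun w _ => ?_
    have h1 := integral_map (μ := μ) (measurable_translate γ).aemeasurable
      (f := fun ω => (h (γ v) ω - h (γ w) ω) ^ 2)
      (((hsm (γ v)).sub (hsm (γ w))).pow 2).aestronglyMeasurable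
    rw [hinv γ hγ] at h1
    rw [h1]
    refine integral_congr_ae ?_
    filter_upwards [noCoreProb_translate hinv hγ v, noCoreProb_translate hinv hγ w] with ω hv hw
    change (noCoreProb μ (γ v) (translate γ ω) - noCoreProb μ (γ w) (translate γ ω)) ^ 2 = _
    rw [hv, hw]
  have hC : ∀ n, ∑ v ∈ K n, ∑ w ∈ nbrs hlf v, ∫ ω, (h v ω - h w ω) ^ 2 ∂μ ≤
      3 * D * (bdry G (K n)).ncard := by
    intro n
    have h1 : ∑ v ∈ K n, ∑ w ∈ nbrs hlf v, ∫ ω, (h v ω - h w ω) ^ 2 ∂μ =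
        ∫ ω, ∑ v ∈ K n, ∑ w ∈ nbrs hlf v, (h v ω - h w ω) ^ 2 ∂μ := by
      rw [integral_finsetSum _ fun v _ => integrable_finsetSum _ fun w _ => hint v w]
      exact Finset.sum_congr rfl fun v _ => (integral_finsetSum _ fun w _ => hint v w).symm
    have h2 : ∫ _, (3 * D * (bdry G (K n)).ncard : ℝ) ∂μ = 3 * D * (bdry G (K n)).ncard := by simp
    rw [h1, ← h2]
    refine integral_mono_ae (integrable_finsetSum _ fun v _ => integrable_finsetSum _ fun w _ =>
      hint v w) (integrable_const _) ?_
    filter_upwards [h01, noCoreProb_eq_zero_of_isCore μ, hμ.noCoreProb_harmonic hforest hlf hK]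
      with ω h3 h4 h5
    refine energy_le hlf hD (fun v => (h3 v).1) (fun v => (h3 v).2) (fun v => ?_) (K n)
    by_cases hv : IsCore (toGraph ω) v
    · rw [h4 v hv, zero_mul]
    · exact mul_eq_zero_of_right _ (h5 v hv)
  have hnn : ∀ v w, 0 ≤ ∫ ω, (h v ω - h w ω) ^ 2 ∂μ := fun v w =>
    integral_nonneg fun ω => sq_nonneg _
  -- The expected energy at each vertex vanishes, so `h` is constant along edges.
  have hadj : ∀ᵐ ω ∂μ, ∀ v w, G.Adj v w → h v ω = h w ω := by
    refine ae_all_iff.2 fun v => ae_all_iff.2 fun w => ?_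
    by_cases hvw : G.Adj v w
    · have h1 := ha.eq_zero hconn hlf hΓ hK hfol (fun v => Finset.sum_nonneg fun w _ => hnn v w) hC v
      have h2 := (Finset.sum_eq_zero_iff_of_nonneg fun w _ => hnn v w).1 h1 w (mem_nbrs.2 hvw)
      have h3 := (integral_eq_zero_iff_of_nonneg_ae (Eventually.of_forall fun ω => sq_nonneg _)
        (hint v w)).1 h2
      filter_upwards [h3] with ω hω _
      exact sub_eq_zero.1 (pow_eq_zero_iff two_ne_zero |>.1 hω)
    · exact Eventually.of_forall fun ω h => absurd h hvw
  have hzero : ∀ᵐ ω ∂μ, ∀ v, h v ω = 0 := by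
    filter_upwards [hadj, hcore, noCoreProb_eq_zero_of_isCore μ] with ω h1 ⟨c, hc⟩ h2 v
    refine reachable_induction (p := fun v => h v ω = 0) (hconn.preconnected c v) (h2 c hc) ?_
    intro x y hx hxy
    rw [← h1 x y hxy, hx]
  refine ae_all_iff.2 fun v => ?_
  have h1 : ∫ ω, ind (NoCore (toGraph ω) v) ∂μ = 0 := by
    rw [← integral_condExp (coreSigma_le (G := G))]
    refine (integral_congr_ae (hzero.mono fun ω hω => hω v)).trans ?_
    simp
  rw [integral_ind (measurableSet_noCore v), measureReal_eq_zero_iff] at h1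
  exact measure_eq_zero_iff_ae_notMem.1 h1

/-- If almost surely exactly one component has two ends, then there is no other component. -/
theorem WeakGibbs.ae_isTree (hμ : WeakGibbs μ)
    (hforest : ∀ᵐ ω ∂μ, IsEssentialSpanningForest (toGraph ω)) (hconn : G.Connected)
    (hlf : ∀ v, (G.neighborSet v).Finite) (hamen : IsAmenable G) {Γ : Subgroup (G ≃g G)}
    (hΓ : IsQuasitransitive G Γ) (hinv : IsInvariant Γ μ)
    (htwo : ∀ᵐ ω ∂μ, ∃! c : (toGraph ω).ConnectedComponent, numEnds (toGraph ω) c = 2) :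
    ∀ᵐ ω ∂μ, (toGraph ω).IsTree := by
  have hcore : ∀ᵐ ω ∂μ, ∃ v, IsCore (toGraph ω) v := by
    filter_upwards [hforest, htwo] with ω hω ⟨c, hc, _⟩
    obtain ⟨v, -, hv⟩ :=
      exists_isCore_of_hasDisjointRays hω.1 (hasDisjointRays_of_numEnds_eq_two hc)
    exact ⟨v, hv⟩
  filter_upwards [hforest, htwo, hμ.ae_not_noCore hforest hconn hlf hamen hΓ hinv hcore,
    ae_not_isTrifurcation hconn hlf hamen hΓ hinv (hforest.mono fun ω hω => hω.1)]
    with ω hω htwo hcomp htri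
  have hlf' : ∀ v, ((toGraph ω).neighborSet v).Finite := fun v =>
    (hlf v).subset fun w h => toGraph_le ω h
  have hends : ∀ v, numEnds (toGraph ω) ((toGraph ω).connectedComponentMk v) = 2 := by
    intro v
    have h := hcomp v
    rw [NoCore] at h
    push Not at h
    obtain ⟨y, hy, hc⟩ := h
    have heq : (toGraph ω).connectedComponentMk v = (toGraph ω).connectedComponentMk y :=
      SimpleGraph.ConnectedComponent.sound hy
    rw [heq]
    refine numEnds_eq_two (hc.hasDisjointRays hω.1 hlf') fun h3 => ?_
    obtain ⟨z, -, hz⟩ := exists_isTrifurcation_of_hasDisjointRays hω.1 h3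
    exact htri z hz
  have : Nonempty V := hconn.nonempty
  refine ⟨⟨fun x y => ?_⟩, hω.1⟩
  exact SimpleGraph.ConnectedComponent.exact (htwo.unique (hends x) (hends y))

end Energy

end EssentialForest

theorem lemma3p3 {V : Type*} [Countable V] [Infinite V] (G : SimpleGraph V)
    (hconn : G.Connected) (hlf : ∀ v, (G.neighborSet v).Finite)
    (hamen : EssentialForest.IsAmenable G)
    (Γ : Subgroup (G ≃g G)) (hΓ : EssentialForest.IsQuasitransitive G Γ)
    (μ : ProbabilityMeasure (EssentialForest.Config G))
    (hforest : ∀ᵐ ω ∂(μ : Measure (EssentialForest.Config G)),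
      EssentialForest.IsEssentialSpanningForest (EssentialForest.toGraph ω))
    (hinv : EssentialForest.IsInvariant Γ (μ : Measure (EssentialForest.Config G)))
    (hgibbs : EssentialForest.WeakGibbs (μ : Measure (EssentialForest.Config G)))
    (htwo : ∀ᵐ ω ∂(μ : Measure (EssentialForest.Config G)),
      ∃! c : (EssentialForest.toGraph ω).ConnectedComponent,
        EssentialForest.numEnds (EssentialForest.toGraph ω) c = 2) :
    (∀ᵐ ω ∂(μ : Measure (EssentialForest.Config G)), (EssentialForest.toGraph ω).IsTree) ∧
      EssentialForest.IsLimitUST G μ := by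
  have htree := hgibbs.ae_isTree hforest hconn hlf hamen hΓ hinv htwo
  exact ⟨htree, hgibbs.isLimitUST hconn hlf hamen hΓ hinv htree⟩
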